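/- **Theorem D.** Let $F$ be a non-archimedean local field, and let $n\ge 1$ and $r\ge 2n+1$ be integers (so $r\ge 3$). Let $1\le p\le\infty$ satisfy $1\le p<2-\frac{2}{n+2}$ or $2+\frac2n<p\le\infty$. Let $G=SL_r(F)$ with a left Haar measure. Then $G$ does not have property $AP_{pcb}^{Schur}$: there do not exist a constant $C$ and a net $(\varphi_\alpha)$ in the Fourier algebra $A(G)$ (the coefficients of the left regular representation on $L^2(G)$) such that $\varphi_\alpha\to 1$ uniformly on compact subsets of $G$ and $\|\check\varphi_\alpha\|_{cbMS^p(L^2(G))}\le C$ for all $\alpha$. Moreover, there do not exist a constant $C$ and a net $(f_\alpha)$ in $C_0(G)$ such that $f_\alpha\to1$ uniformly on compact subsets of $G$ and $\|\check f_\alpha\|_{MS^p(L^2(G))}\le C$ for all $\alpha$. Here $\check\varphi(g,h)=\varphi(g^{-1}h)$. For $p<\infty$, $S^p(H)$ is the space of operators $A$ on the Hilbert space $H$ with $\|A\|_p=\mathrm{Tr}(|A|^p)^{1/p}<\infty$, and $S^\infty(H)$ is the space of compact operators with the operator norm. For $\psi\in L^\infty(G\times G)$, the Schur multiplier $M_\psi$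 multiplies by $\psi$ the kernel in $L^2(G\times G)$ of a Hilbert–Schmidt operator on $L^2(G)$. The number $\|\psi\|_{MS^p(L^2(G))}$ is the norm of the extension of $M_\psi$ from $S^2\cap S^p$ to a bounded map of $S^p(L^2(G))$ ($\infty$ if there is none), and $\|\psi\|_{cbMS^p(L^2(G))}$ is its completely bounded norm, $\sup_m\|M_\psi\otimes \mathrm{id}\|$ on $S^p(L^2(G)\otimes\ell^2_m)$. -/

import Mathlib

open MeasureTheory Filter
open scoped ENNReal NNReal ZeroAtInfty ComplexConjugate InnerProductSpace

universe u

noncomputable section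

namespace SchurAP

section Schatten

variable {H : Type*} [NormedAddCommGroup H] [InnerProductSpace ℂ H]

/-- The trace `Tr T ∈ [0, ∞]` of a positive operator `T` on a Hilbert space: the supremum of
`∑ ⟨e i, T (e i)⟩` over finite orthonormal systems. For positive `T` this is the sum of
`⟨e i, T (e i)⟩` over any orthonormal basis. -/
def posTrace (T : H →L[ℂ] H) : ℝ≥0∞ :=
  ⨆ (n : ℕ) (e : Fin n → H) (_ : Orthonormal ℂ e),
    ∑ i, ENNReal.ofReal (RCLike.re ⟪e i, T (e i)⟫_ℂ)

variable [CompleteSpace H]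

/-- The Schatten norm: `‖A‖_p = Tr(|A|^p)^(1/p)` for `p < ∞` (where `|A| = (A* A)^(1/2)` and the
powers are taken in the continuous functional calculus), and the operator norm for `p = ∞`. -/
def schattenNorm (p : ℝ≥0∞) (A : H →L[ℂ] H) : ℝ≥0∞ :=
  if p = ∞ then ‖A‖ₑ
  else (posTrace (CFC.rpow (CFC.abs A) p.toReal)) ^ (1 / p.toReal)

/-- Membership in the Schatten class `S^p(H)`: the compact operators for `p = ∞`, and the
operators with finite Schatten norm for `p < ∞`. -/
def MemSchatten (p : ℝ≥0∞) (A : H →L[ℂ] H) : Prop :=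
  if p = ∞ then IsCompactOperator A else schattenNorm p A < ∞

end Schatten

section Schur

variable {X : Type*} [MeasurableSpace X]

/-- The bounded operator `A` on `L²(X, μ)` is the integral operator with kernel `k`:
`(A f)(x) = ∫ k(x, y) f(y) dμ(y)`. The Hilbert-Schmidt operators are exactly the operators with a
kernel in `L²(X × X, μ ⊗ μ)`. -/
def HasKernel (μ : Measure X) (A : Lp ℂ 2 μ →L[ℂ] Lp ℂ 2 μ) (k : X × X → ℂ) : Prop :=
  ∀ f : Lp ℂ 2 μ, (A f : X → ℂ) =ᵐ[μ] fun x => ∫ y, k (x, y) * (f : X → ℂ) y ∂μ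

/-- `A ∈ S²(L²(X, μ))`, and `B = M_φ A` is the image of `A` under the Schur multiplier with
symbol `φ`: the kernel of `B` is `φ` times the `L²` kernel of `A`. -/
def IsSchurImage (μ : Measure X) (φ : X → X → ℂ) (A B : Lp ℂ 2 μ →L[ℂ] Lp ℂ 2 μ) : Prop :=
  ∃ k : X × X → ℂ, MemLp k 2 (μ.prod μ) ∧ HasKernel μ A k ∧
    HasKernel μ B (fun z => φ z.1 z.2 * k z)

/-- `‖φ‖_{MS^p(L²(X, μ))} ≤ C`, for a symbol `φ ∈ L^∞(X × X)`: the Schur multiplier with symbol `φ`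
maps `S² ∩ S^p` (a dense subspace of `S^p`) into `S^p`, with norm at most `C` for the norm
of `S^p`. -/
def MSNormLE (p : ℝ≥0∞) (μ : Measure X) (φ : X → X → ℂ) (C : ℝ≥0) : Prop :=
  ∀ (A : Lp ℂ 2 μ →L[ℂ] Lp ℂ 2 μ) (k : X × X → ℂ),
    MemLp k 2 (μ.prod μ) → HasKernel μ A k → MemSchatten p A →
      ∃ B : Lp ℂ 2 μ →L[ℂ] Lp ℂ 2 μ, IsSchurImage μ φ A B ∧
        MemSchatten p B ∧ schattenNorm p B ≤ C * schattenNorm p A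

/-- The `(i, j)` entry of an operator on `H ⊗ ℓ²_n = Hⁿ` (Hilbert direct sum), seen as an `n × n`
matrix of operators on `H`. -/
def entry {H : Type*} [NormedAddCommGroup H] [InnerProductSpace ℂ H] {n : ℕ}
    (A : PiLp 2 (fun _ : Fin n => H) →L[ℂ] PiLp 2 (fun _ : Fin n => H)) (i j : Fin n) :
    H →L[ℂ] H :=
  (PiLp.proj 2 (fun _ : Fin n => H) i : PiLp 2 (fun _ : Fin n => H) →L[ℂ] H) ∘L A ∘L
    ((PiLp.continuousLinearEquiv 2 ℂ (fun _ : Fin n => H)).symm :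
      (Fin n → H) →L[ℂ] PiLp 2 (fun _ : Fin n => H)) ∘L
    ContinuousLinearMap.single ℂ (fun _ : Fin n => H) j

/-- `‖φ‖_{cbMS^p(L²(X, μ))} ≤ C`, for a symbol `φ ∈ L^∞(X × X)`: for every `n`, the amplification
`M_φ ⊗ id` on `S^p(L²(X, μ)) ⊗ M_n(ℂ)`, that is the map `(A i j) ↦ (M_φ (A i j))` on
operator matrices, is bounded by `C` for the norm of `S^p(L²(X, μ) ⊗ ℓ²_n)`. -/
def CBMSNormLE (p : ℝ≥0∞) (μ : Measure X) (φ : X → X → ℂ) (C : ℝ≥0) : Prop :=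
  ∀ (n : ℕ)
    (A : PiLp 2 (fun _ : Fin n => Lp ℂ 2 μ) →L[ℂ] PiLp 2 (fun _ : Fin n => Lp ℂ 2 μ)),
    (∀ i j, ∃ k : X × X → ℂ, MemLp k 2 (μ.prod μ) ∧ HasKernel μ (entry A i j) k) →
    MemSchatten p A →
      ∃ B : PiLp 2 (fun _ : Fin n => Lp ℂ 2 μ) →L[ℂ] PiLp 2 (fun _ : Fin n => Lp ℂ 2 μ),
        (∀ i j, IsSchurImage μ φ (entry A i j) (entry B i j)) ∧
        MemSchatten p B ∧ schattenNorm p B ≤ C * schattenNorm p A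

end Schur

section Group

variable {G : Type u} [Group G]

/-- The Herz-Schur symbol `(g, h) ↦ φ(g⁻¹ h)` of a function `φ` on a group. -/
def herzSchur (φ : G → ℂ) : G → G → ℂ := fun g h => φ (g⁻¹ * h)

/-- The Fourier algebra `A(G)` (with respect to a left Haar measure `μ`): the coefficients
`g ↦ ⟨λ(g) ξ, η⟩` of the left regular representation `(λ(g) ξ)(x) = ξ(g⁻¹ x)` on `L²(G, μ)`. -/
def MemFourierAlgebra [MeasurableSpace G] (μ : Measure G) (φ : G → ℂ) : Prop :=
  ∃ ξ η : G → ℂ, MemLp ξ 2 μ ∧ MemLp η 2 μ ∧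
    ∀ g, φ g = ∫ x, ξ (g⁻¹ * x) * conj (η x) ∂μ

/-- The property of completely bounded approximation by Schur multipliers on `S^p` of a locally
compact second countable group `G` with left Haar measure `μ`: there are a constant `C` and a net
`φ` in `A(G)` which converges to `1` uniformly on compact subsets and whose Herz-Schur
multipliers have cb-norm at most `C` on `S^p(L²(G, μ))`. -/
def HasAPcbSchur [TopologicalSpace G] [MeasurableSpace G] (p : ℝ≥0∞) (μ : Measure G) : Prop :=
  ∃ (C : ℝ≥0) (ι : Type u) (_ : Preorder ι) (_ : IsDirectedOrder ι) (_ : Nonempty ι)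
    (φ : ι → G → ℂ),
    (∀ a, MemFourierAlgebra μ (φ a)) ∧
    (∀ K : Set G, IsCompact K → TendstoUniformlyOn φ (fun _ => 1) atTop K) ∧
    ∀ a, CBMSNormLE p μ (herzSchur (φ a)) C

/-- The constant function `1` is the limit, uniformly on compact subsets of `G`, of a net of
functions in `C₀(G)` whose Herz-Schur multipliers are uniformly bounded on `S^p(L²(G, μ))`. -/
def HasC0SchurApproximation [TopologicalSpace G] [MeasurableSpace G]
    (p : ℝ≥0∞) (μ : Measure G) : Prop :=
  ∃ (C : ℝ≥0) (ι : Type u) (_ : Preorder ι) (_ : IsDirectedOrder ι) (_ : Nonempty ι)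
    (φ : ι → C₀(G, ℂ)),
    (∀ K : Set G, IsCompact K → TendstoUniformlyOn (fun a => ⇑(φ a)) (fun _ => 1) atTop K) ∧
    ∀ a, MSNormLE p μ (herzSchur (φ a)) C

end Group

end SchurAP

end

/-! Put K = SL_r(O) and let Φ be the average of f over K-double cosets. If the Herz-Schur multiplier
of f has norm at most C on S^p, then Φ varies exponentially little far out in the lattice of
diagonal matrices π^w, at a rate that depends only on C, p, n and the residue field. For f in
C_0(G), Φ tends to 0 at infinity, so summing a geometric series bounds |Φ| by 1/2 at one far point,
the same for the whole net. But the values of Φ at that point converge to 1 along the net. Since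
A(G) lies in C_0(G) and the cb norm dominates the norm, the C_0 statement implies the other one.

The rigidity of Φ comes from a finite problem. A Heisenberg group in SL_r is generated by a row
family A(x, z) and a column family B(y, w) with common centre. With D = π^a, D' = π^b suitably
chosen, the double coset of D A(x, z) B(y, w) D' depends only on s = z + w + x ⬝ y modulo ϖ^(k+1)
(`exists_heisenberg_family`). Averaging over cosets of K (`MSNormLE.exists_matOp`) turns f into a
bounded Schur multiplier of finite matrices over R = O/ϖ^(k+1) with symbol ψ(z + w + x ⬝ y), where ψ
is invariant under units. Here ψ(0) is Φ at π^(a+b), and ψ(ϖ^k) is Φ at a neighbouring lattice point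
(`exists_mul_rowSL_mul`).

Let N = |R| and let T be the matrix with symbol "Dirac mass at 0 minus uniform measure on (ϖ^k)".
Then T is N^(n/2) times a partial isometry of rank about N^(n+1). For p ≥ 2 the multiplier is
applied to T, and the image is paired with constant vectors. For p ≤ 2 it is applied to the rank-one
matrix of ones, and the image acts on a large subspace as (ψ(0) - ψ(ϖ^k)) T. Either way |ψ(0) -
ψ(ϖ^k)| ≤ 2 C N^(-ε), and ε > 0 in the stated range of p (`norm_sub_le_of_two_le`,
`norm_sub_le_of_le_two`, `exists_exponent`).

Each such estimate moves one unit of weight between two coordinates while n others stay far away.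
With 2n + 1 coordinates, n very positive, n very negative and one near 0, such moves lead to
infinity (`norm_sub_le_of_chain`). -/

noncomputable section

namespace SchurAP

/-! ### Schatten norms: partial isometries, and lower bounds by operator monotonicity -/

section SchattenEstimates

variable {H : Type*} [NormedAddCommGroup H] [InnerProductSpace ℂ H]

lemma posTrace_mono {S T : H →L[ℂ] H} (h : S ≤ T) : posTrace S ≤ posTrace T := by
  unfold posTrace
  refine iSup_mono fun n => iSup_mono fun e => iSup_mono fun _ => Finset.sum_le_sum fun i _ => ?_
  apply ENNReal.ofReal_le_ofReal
  have := (ContinuousLinearMap.le_def _ _).1 h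
  have := this.re_inner_nonneg_right (e i)
  rw [sub_apply, inner_sub_right, map_sub] at this
  exact sub_nonneg.1 this

lemma le_posTrace {ι : Type*} [Fintype ι] (T : H →L[ℂ] H) {e : ι → H} (he : Orthonormal ℂ e) :
    ∑ i, ENNReal.ofReal (RCLike.re ⟪e i, T (e i)⟫_ℂ) ≤ posTrace T := by
  let σ := Fintype.equivFin ι
  have h2 : Orthonormal ℂ (e ∘ σ.symm) := he.comp _ σ.symm.injective
  refine le_trans (le_of_eq ?_) (le_iSup_of_le (Fintype.card ι)
    (le_iSup_of_le (e ∘ σ.symm) (le_iSup_of_le h2 le_rfl)))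
  exact Fintype.sum_equiv σ _ _ (by simp)

lemma posTrace_smul (c : ℝ≥0) (T : H →L[ℂ] H) : posTrace (c • T) = c * posTrace T := by
  unfold posTrace
  simp only [ENNReal.mul_iSup, Finset.mul_sum]
  congr! 7 with n e _ i _
  have : (c • T) (e i) = ((c : ℝ) : ℂ) • T (e i) := by
    rw [smul_apply]; simp [NNReal.smul_def]
  rw [this, inner_smul_right]
  simp [ENNReal.ofReal_mul]

variable [CompleteSpace H]

lemma rpow_abs_eq (A : H →L[ℂ] H) {p : ℝ≥0} (hp : 0 < p) :
    CFC.rpow (CFC.abs A) (p : ℝ) = (star A * A) ^ (p / 2) := by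
  rw [← CFC.abs_nnrpow, CFC.nnrpow_eq_rpow hp]; rfl

/-- The spectrum lies in {0, 1}, where x ↦ (c x)^s coincides with the linear function x ↦ c^s x. -/
lemma smul_nnrpow_of_isStarProjection {P : H →L[ℂ] H} (hP : IsStarProjection P) (c : ℝ≥0)
    {s : ℝ≥0} (hs : 0 < s) : (c • P) ^ s = (c ^ (s : ℝ)) • P := by
  have hP0 : 0 ≤ P := hP.nonneg
  rw [CFC.nnrpow_def, ← cfcₙ_comp_smul c _ P
    (NNReal.continuous_nnrpow_const s).continuousOn (by simp [hs.ne']) hP0]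
  have : (quasispectrum ℝ≥0 P).EqOn (fun x => (c • x).nnrpow s) (fun x => (c ^ (s : ℝ)) • id x) := by
    intro x hx
    have hx' : (x : ℝ) ∈ quasispectrum ℝ P := by
      exact quasispectrum.algebraMap_mem ℝ hx
    have := hP.isIdempotentElem.quasispectrum_subset ℝ hx'
    simp only [Set.mem_insert_iff, Set.mem_singleton_iff, NNReal.coe_eq_zero, NNReal.coe_eq_one] at this
    rcases this with rfl | rfl <;> simp [hs.ne']
  rw [cfcₙ_congr this, cfcₙ_smul _ _ P continuousOn_id rfl, cfcₙ_id ℝ≥0 P]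

lemma schattenNorm_coe (A : H →L[ℂ] H) {p : ℝ≥0} (hp : 0 < p) :
    schattenNorm p A = posTrace ((star A * A) ^ (p / 2)) ^ (1 / (p : ℝ)) := by
  rw [schattenNorm, if_neg ENNReal.coe_ne_top, ENNReal.coe_toReal, rpow_abs_eq A hp]

/-- The Schatten norm of a multiple of a partial isometry. -/
lemma schattenNorm_le_of_star_mul_self {A P : H →L[ℂ] H} (hP : IsStarProjection P) {c : ℝ≥0}
    (hA : star A * A = (c ^ 2) • P) {k : ℝ≥0∞} (hk : posTrace P ≤ k) {p : ℝ≥0} (hp : 0 < p) :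
    schattenNorm p A ≤ c * k ^ (1 / (p : ℝ)) := by
  have hp' : (p : ℝ) ≠ 0 := by exact_mod_cast hp.ne'
  have h : (c ^ 2) ^ ((p / 2 : ℝ≥0) : ℝ) = c ^ (p : ℝ) := by
    rw [← NNReal.rpow_natCast, ← NNReal.rpow_mul]
    congr 1; push_cast; ring
  rw [schattenNorm_coe A hp, hA, smul_nnrpow_of_isStarProjection hP _ (by positivity),
    posTrace_smul, ENNReal.mul_rpow_of_nonneg _ _ (by positivity), h,
    ENNReal.coe_rpow_of_nonneg _ (by positivity), ← ENNReal.rpow_mul, mul_one_div_cancel hp',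
    ENNReal.rpow_one]
  gcongr

lemma norm_le_of_star_mul_self {A P : H →L[ℂ] H} (hP : IsStarProjection P) {c : ℝ≥0}
    (hA : star A * A = (c ^ 2) • P) : ‖A‖ₑ ≤ c := by
  have h1 : ‖A‖ * ‖A‖ = c ^ 2 * ‖P‖ := by
    rw [← CStarRing.norm_star_mul_self, hA, NNReal.smul_def, norm_smul]
    simp
  have h2 : ‖P‖ ≤ 1 := hP.norm_le
  have h3 : ‖A‖ ≤ c := by
    refine abs_le_of_sq_le_sq' ?_ c.2 |>.2
    rw [sq, h1]
    exact mul_le_of_le_one_right (sq_nonneg _) h2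
  rw [enorm_eq_nnnorm]
  exact_mod_cast h3

lemma le_smul_one_iff {X : H →L[ℂ] H} (hX : 0 ≤ X) (c : ℝ≥0) :
    X ≤ c • 1 ↔ ∀ v : H, ‖v‖ = 1 → RCLike.re ⟪v, X v⟫_ℂ ≤ c := by
  have key (v : H) : RCLike.re ⟪(c • (1 : H →L[ℂ] H) - X) v, v⟫_ℂ =
      c * ‖v‖ ^ 2 - RCLike.re ⟪v, X v⟫_ℂ := by
    have : (c • (1 : H →L[ℂ] H)) v = ((c : ℝ) : ℂ) • v := by simp [NNReal.smul_def]
    rw [sub_apply, inner_sub_left, map_sub, this, inner_smul_left, inner_self_eq_norm_sq_to_K,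
      ← inner_conj_symm (X v) v, RCLike.conj_re]
    congr 1
    rw [Complex.conj_ofReal]
    simp [← Complex.ofReal_pow]
  rw [ContinuousLinearMap.le_def, ContinuousLinearMap.isPositive_def']
  constructor
  · rintro ⟨-, h⟩ v hv
    have := h v
    rw [ContinuousLinearMap.reApplyInnerSelf_apply, key, hv] at this
    linarith
  · intro h
    refine ⟨((IsSelfAdjoint.all (c : ℝ)).smul (.one _)).sub (.of_nonneg hX),
      fun v => ?_⟩
    rw [ContinuousLinearMap.reApplyInnerSelf_apply, key]
    rcases eq_or_ne v 0 with rfl | hv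
    · simp
    have hv' : 0 < ‖v‖ := norm_pos_iff.2 hv
    have h1 := h (((‖v‖⁻¹ : ℝ) : ℂ) • v) (by rw [norm_smul]; simp [hv'.ne'])
    rw [map_smul, inner_smul_left, inner_smul_right, Complex.conj_ofReal] at h1
    simp only [RCLike.re_to_complex, Complex.re_ofReal_mul] at h1 ⊢
    rw [← mul_assoc, ← mul_inv, inv_mul_le_iff₀ (by positivity)] at h1
    nlinarith

/-- A positive operator X = |B|^p is bounded by its trace τ. The power 2/p ≤ 1 is operator monotone,
which turns X ≤ τ into B*B ≤ τ^(2/p); this is where p ≥ 2 enters. -/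
lemma enorm_le_schattenNorm (B : H →L[ℂ] H) {p : ℝ≥0∞} (hp : 2 ≤ p) :
    ‖B‖ₑ ≤ schattenNorm p B := by
  by_cases hp' : p = ∞
  · simp [schattenNorm, hp']
  lift p to ℝ≥0 using hp'
  have hp2 : (2 : ℝ≥0) ≤ p := by exact_mod_cast hp
  have hp0 : 0 < p := lt_of_lt_of_le (by norm_num) hp2
  have hpr : (p : ℝ) ≠ 0 := by exact_mod_cast hp0.ne'
  rw [schattenNorm_coe B hp0]
  set X := (star B * B) ^ (p / 2) with hX
  have hX0 : 0 ≤ X := CFC.nnrpow_nonneg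
  by_cases ht : posTrace X = ∞
  · rw [ht, ENNReal.top_rpow_of_pos (by positivity)]; exact le_top
  lift posTrace X to ℝ≥0 using ht with τ hτ
  have h1 : X ≤ τ • 1 := by
    rw [le_smul_one_iff hX0]
    intro v hv
    have := le_posTrace (ι := Unit) X (e := fun _ => v)
      ⟨fun _ => hv, fun i j h => (h (Subsingleton.elim _ _)).elim⟩
    rw [← hτ] at this
    simpa using this
  have h2 : X ^ (2 / p) ≤ (τ • (1 : H →L[ℂ] H)) ^ (2 / p) :=
    CFC.monotone_nnrpow ⟨zero_le, by rw [div_le_one hp0]; exact hp2⟩ h1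
  rw [hX, CFC.nnrpow_nnrpow, smul_nnrpow_of_isStarProjection (IsStarProjection.one _) _
    (by positivity), show p / 2 * (2 / p) = 1 by field_simp,
    CFC.nnrpow_one _ (star_mul_self_nonneg B), le_smul_one_iff (star_mul_self_nonneg B)] at h2
  have h3 : ∀ v : H, ‖v‖ = 1 → ‖B v‖ ^ 2 ≤ ((τ ^ (1 / (p : ℝ)) : ℝ≥0) : ℝ) ^ 2 := by
    intro v hv
    have := h2 v hv
    rw [mul_apply_eq_comp, ContinuousLinearMap.star_eq_adjoint,
      ContinuousLinearMap.adjoint_inner_right, inner_self_eq_norm_sq] at this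
    refine this.trans (le_of_eq ?_)
    rw [← NNReal.coe_pow, ← NNReal.rpow_natCast, ← NNReal.rpow_mul]
    congr 2; push_cast; ring
  rw [← ENNReal.coe_rpow_of_nonneg _ (by positivity), enorm_eq_nnnorm, ENNReal.coe_le_coe,
    ← NNReal.coe_le_coe]
  refine ContinuousLinearMap.opNorm_le_of_unit_norm (NNReal.coe_nonneg _) fun v hv => ?_
  exact (abs_le_of_sq_le_sq' (h3 v hv) (NNReal.coe_nonneg _)).2

lemma finrank_le_posTrace_starProjection (W : Submodule ℂ H) [FiniteDimensional ℂ W] :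
    (Module.finrank ℂ W : ℝ≥0∞) ≤ posTrace W.starProjection := by
  let b := stdOrthonormalBasis ℂ W
  have hb : Orthonormal ℂ (fun i => (b i : H)) := b.orthonormal.comp_linearIsometry W.subtypeₗᵢ
  refine le_trans (le_of_eq ?_) (le_posTrace _ hb)
  have key (i) : W.starProjection (b i : H) = b i := Submodule.starProjection_eq_self_iff.2 (b i).2
  simp [key, hb.1]

/-- A lower bound for the Schatten norm of an operator whose adjoint is bounded below on a finite
dimensional space. -/
lemma le_schattenNorm_of_le_norm_star (B : H →L[ℂ] H) {p : ℝ≥0} (hp0 : 0 < p) (hp2 : p ≤ 2)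
    (V : Submodule ℂ H) [FiniteDimensional ℂ V] {c : ℝ≥0}
    (h : ∀ u ∈ V, c * ‖u‖ ≤ ‖star B u‖) :
    c * (Module.finrank ℂ V : ℝ≥0∞) ^ (1 / (p : ℝ)) ≤ schattenNorm p B := by
  have hpr : (p : ℝ) ≠ 0 := by exact_mod_cast hp0.ne'
  rcases eq_or_ne c 0 with rfl | hc
  · simp
  have hc0 : (0 : ℝ) < c := by exact_mod_cast hc.bot_lt
  obtain ⟨W, hWV⟩ : ∃ W, W = V.map (star B : H →L[ℂ] H).toLinearMap := ⟨_, rfl⟩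
  have : FiniteDimensional ℂ W := by rw [hWV]; infer_instance
  have hW : Module.finrank ℂ W = Module.finrank ℂ V := by
    have : W = LinearMap.range ((star B : H →L[ℂ] H).toLinearMap.domRestrict V) :=
      hWV.trans (LinearMap.range_domRestrict _ _).symm
    rw [this]
    refine LinearMap.finrank_range_of_inj ((injective_iff_map_eq_zero _).2 fun u hu => ?_)
    have h1 := h u u.2
    rw [show star B (u : H) = 0 from hu, norm_zero] at h1
    exact Subtype.ext (norm_le_zero_iff.1 (nonpos_of_mul_nonpos_right h1 hc0))
  -- The projection of v to W is B*u with u in V, so its squared norm is ⟨u, Bv⟩ ≤ ‖u‖ ‖Bv‖, while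
  -- c‖u‖ is at most its norm. Hence c times the norm of the projection is at most ‖Bv‖.
  have h1 : (c ^ 2) • W.starProjection ≤ star B * B := by
    rw [ContinuousLinearMap.le_def, ContinuousLinearMap.isPositive_def']
    refine ⟨(IsSelfAdjoint.star_mul_self B).sub ((IsSelfAdjoint.all ((c ^ 2 : ℝ≥0) : ℝ)).smul
      isStarProjection_starProjection.isSelfAdjoint), fun v => ?_⟩
    have hv : W.starProjection v ∈ W := Submodule.starProjection_apply_mem _ _
    have hn : ‖W.orthogonalProjectionOnto v‖ = ‖W.starProjection v‖ := rfl
    obtain ⟨u, hu, huv⟩ := hWV.le hv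
    have h2 : ‖W.starProjection v‖ ^ 2 = RCLike.re ⟪u, B v⟫_ℂ := by
      rw [← ContinuousLinearMap.adjoint_inner_left, ← ContinuousLinearMap.star_eq_adjoint]
      rw [show star B u = W.starProjection v from huv, Submodule.re_inner_starProjection_eq_normSq, hn]
    have h3 : c * ‖u‖ ≤ ‖W.starProjection v‖ := by rw [← huv]; exact h u hu
    have h4 : ‖W.starProjection v‖ ^ 2 ≤ ‖u‖ * ‖B v‖ := h2 ▸ re_inner_le_norm u (B v)
    have h5 : c * ‖W.starProjection v‖ ≤ ‖B v‖ := by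
      rcases (norm_nonneg (W.starProjection v)).eq_or_lt with h0 | h0
      · rw [← h0, mul_zero]; positivity
      · refine le_of_mul_le_mul_right ?_ h0
        nlinarith [mul_le_mul_of_nonneg_right h3 (norm_nonneg (B v))]
    rw [ContinuousLinearMap.reApplyInnerSelf_apply, sub_apply, inner_sub_left, map_sub]
    have h6 : ((c ^ 2) • W.starProjection) v = ((c ^ 2 : ℝ) : ℂ) • W.starProjection v := by
      rw [Complex.coe_smul]; rfl
    rw [h6, mul_apply_eq_comp, ContinuousLinearMap.star_eq_adjoint,
      ContinuousLinearMap.adjoint_inner_left, inner_self_eq_norm_sq, inner_smul_left,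
      Complex.conj_ofReal, RCLike.re_to_complex, Complex.re_ofReal_mul, ← RCLike.re_to_complex,
      Submodule.re_inner_starProjection_eq_normSq, hn]
    nlinarith [mul_self_le_mul_self (by positivity) h5]
  -- The power p/2 is operator monotone because p ≤ 2.
  have h2 : ((c ^ 2) • W.starProjection) ^ (p / 2) ≤ (star B * B) ^ (p / 2) :=
    CFC.monotone_nnrpow ⟨zero_le, by rw [div_le_one (by norm_num)]; exact hp2⟩ h1
  have h : (c ^ 2) ^ ((p / 2 : ℝ≥0) : ℝ) = c ^ (p : ℝ) := by
    rw [← NNReal.rpow_natCast, ← NNReal.rpow_mul]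
    congr 1; push_cast; ring
  rw [smul_nnrpow_of_isStarProjection isStarProjection_starProjection _ (by positivity), h] at h2
  have h3 := posTrace_mono h2
  rw [posTrace_smul] at h3
  rw [schattenNorm_coe B hp0]
  calc (c : ℝ≥0∞) * (Module.finrank ℂ V : ℝ≥0∞) ^ (1 / (p : ℝ))
      = (((c ^ (p : ℝ) : ℝ≥0) : ℝ≥0∞) * (Module.finrank ℂ W : ℝ≥0∞)) ^ (1 / (p : ℝ)) := by
        rw [hW, ENNReal.mul_rpow_of_nonneg _ _ (by positivity),
          ENNReal.coe_rpow_of_nonneg _ (by positivity), ← ENNReal.rpow_mul,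
          mul_one_div_cancel hpr, ENNReal.rpow_one]
    _ ≤ _ := by
        gcongr
        refine le_trans ?_ h3
        gcongr
        exact finrank_le_posTrace_starProjection W

end SchattenEstimates

/-! ### Unitary invariance of the Schatten norms -/

section Conj

variable {H H' : Type*} [NormedAddCommGroup H] [InnerProductSpace ℂ H] [CompleteSpace H]
  [NormedAddCommGroup H'] [InnerProductSpace ℂ H'] [CompleteSpace H']

lemma posTrace_conj_le (e : H ≃ₗᵢ[ℂ] H') (A : H →L[ℂ] H) :
    posTrace (e.conjStarAlgEquiv A) ≤ posTrace A := by
  refine iSup_le fun n => iSup_le fun f => iSup_le fun hf => ?_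
  refine le_trans (le_of_eq ?_) (le_posTrace A (hf.comp_linearIsometryEquiv e.symm))
  refine Finset.sum_congr rfl fun i _ => ?_
  rw [LinearIsometryEquiv.conjStarAlgEquiv_apply_apply, ← e.inner_map_map (_ : H)]
  simp

lemma posTrace_conj (e : H ≃ₗᵢ[ℂ] H') (A : H →L[ℂ] H) :
    posTrace (e.conjStarAlgEquiv A) = posTrace A := by
  refine (posTrace_conj_le e A).antisymm ?_
  have := posTrace_conj_le e.symm (e.conjStarAlgEquiv A)
  rwa [← LinearIsometryEquiv.symm_conjStarAlgEquiv, StarAlgEquiv.symm_apply_apply] at this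

lemma schattenNorm_conj (e : H ≃ₗᵢ[ℂ] H') (A : H →L[ℂ] H) {p : ℝ≥0∞} (hp : p ≠ 0) :
    schattenNorm p (e.conjStarAlgEquiv A) = schattenNorm p A := by
  have hcont : Continuous (e.conjStarAlgEquiv : (H →L[ℂ] H) → (H' →L[ℂ] H')) :=
    e.toContinuousLinearEquiv.conjContinuousAlgEquiv.continuous
  by_cases hp' : p = ∞
  · simp only [schattenNorm, hp', if_true]
    have : ‖e.conjStarAlgEquiv A‖ = ‖A‖ :=
      NonUnitalStarAlgHom.norm_map e.conjStarAlgEquiv e.conjStarAlgEquiv.injective A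
    rw [← ofReal_norm, this, ofReal_norm]
  lift p to ℝ≥0 using hp'
  have hp0 : 0 < p := pos_iff_ne_zero.2 (by exact_mod_cast hp)
  rw [schattenNorm_coe _ hp0, schattenNorm_coe _ hp0, ← map_star, ← map_mul, ← posTrace_conj e]
  congr 2
  rw [CFC.nnrpow_def, CFC.nnrpow_def]
  symm
  have h0 := star_mul_self_nonneg A
  have h1 : 0 ≤ e.conjStarAlgEquiv (star A * A) := by
    rw [map_mul, map_star]; exact star_mul_self_nonneg _
  exact NonUnitalStarAlgHomClass.map_cfcₙ (R := ℝ≥0) (S := ℂ) e.conjStarAlgEquiv _ _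
    (NNReal.continuous_nnrpow_const _).continuousOn (by simp [hp0.ne']) hcont h0 h1

lemma memSchatten_conj (e : H ≃ₗᵢ[ℂ] H') (A : H →L[ℂ] H) {p : ℝ≥0∞} (hp : p ≠ 0)
    (h : MemSchatten p A) : MemSchatten p (e.conjStarAlgEquiv A) := by
  unfold MemSchatten at *
  split_ifs with hp'
  · rw [if_pos hp'] at h
    exact (h.comp_clm (e.symm : H' →L[ℂ] H)).clm_comp (e : H →L[ℂ] H')
  · rw [if_neg hp'] at h
    rwa [schattenNorm_conj e A hp]

end Conj

/-! ### Finite matrices as operators between orthonormal families -/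

section MatOp

open InnerProductSpace Matrix

variable {H : Type*} [NormedAddCommGroup H] [InnerProductSpace ℂ H]
  {ι : Type*} [Fintype ι]

/-- The operator `∑ T i j |e i⟩⟨g j|` attached to a matrix and two finite families of vectors. -/
def matOp (e g : ι → H) (T : Matrix ι ι ℂ) : H →L[ℂ] H :=
  ∑ i, ∑ j, T i j • rankOne ℂ (e i) (g j)

lemma matOp_apply (e g : ι → H) (T : Matrix ι ι ℂ) (v : H) :
    matOp e g T v = ∑ i, (∑ j, T i j * ⟪g j, v⟫_ℂ) • e i := by
  simp [matOp, Finset.sum_smul, mul_smul]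

lemma isCompactOperator_matOp (e g : ι → H) (T : Matrix ι ι ℂ) :
    IsCompactOperator (matOp e g T) := by
  have : FiniteDimensional ℂ (Submodule.span ℂ (Set.range e)) :=
    FiniteDimensional.span_of_finite ℂ (Set.finite_range e)
  let f : H →L[ℂ] Submodule.span ℂ (Set.range e) := (matOp e g T).codRestrict _ fun v => by
    rw [matOp_apply]
    exact Submodule.sum_mem _ fun i _ =>
      Submodule.smul_mem _ _ (Submodule.subset_span ⟨i, rfl⟩)
  have : ProperSpace (Submodule.span ℂ (Set.range e)) := FiniteDimensional.proper ℂ _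
  have hf : IsCompactOperator f := isCompactOperator_of_locallyCompactSpace_dom f
  exact hf.clm_comp (Submodule.subtypeL _)

lemma inner_matOp [DecidableEq ι] {g : ι → H} (hg : Orthonormal ℂ g) (f : ι → H)
    (T : Matrix ι ι ℂ) (i : ι) (v : H) :
    ⟪g i, matOp g f T v⟫_ℂ = ∑ j, T i j * ⟪f j, v⟫_ℂ := by
  rw [matOp_apply, hg.inner_right_fintype]

lemma inner_sum_smul_matOp (e g : ι → H) (x y : ι → ℂ) (B : H →L[ℂ] H) :
    ⟪∑ i, x i • e i, B (∑ j, y j • g j)⟫_ℂ = star x ⬝ᵥ (Matrix.of fun i j => ⟪e i, B (g j)⟫_ℂ) *ᵥ y := by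
  simp only [map_sum, map_smul, sum_inner, inner_smul_left, dotProduct, mulVec, Pi.star_apply,
    of_apply]
  refine Finset.sum_congr rfl fun i _ => ?_
  rw [inner_sum]
  simp only [inner_smul_right, RCLike.star_def, mul_comm]

lemma norm_sum_smul {e : ι → H} (he : Orthonormal ℂ e) (x : ι → ℂ) :
    ‖∑ i, x i • e i‖ ^ 2 = ∑ i, ‖x i‖ ^ 2 := by
  have h : ((‖∑ i, x i • e i‖ ^ 2 : ℝ) : ℂ) = ((∑ i, ‖x i‖ ^ 2 : ℝ) : ℂ) := by
    push_cast
    rw [← RCLike.ofReal_eq_complex_ofReal, ← inner_self_eq_norm_sq_to_K (𝕜 := ℂ) (∑ i, x i • e i),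
      he.inner_sum]
    refine Finset.sum_congr rfl fun i _ => ?_
    rw [Complex.conj_mul']
    rfl
  exact_mod_cast h

lemma matOp_mul [DecidableEq ι] {f : ι → H} (hf : Orthonormal ℂ f) (e g : ι → H)
    (S T : Matrix ι ι ℂ) : matOp e f S * matOp f g T = matOp e g (S * T) := by
  ext v
  rw [mul_apply_eq_comp, matOp_apply, matOp_apply e g]
  refine Finset.sum_congr rfl fun i _ => ?_
  congr 1
  simp only [inner_matOp hf, mul_apply, Finset.mul_sum, Finset.sum_mul]
  rw [Finset.sum_comm]
  simp [mul_assoc]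

lemma matOp_smul (e g : ι → H) (c : ℝ≥0) (T : Matrix ι ι ℂ) :
    matOp e g (c • T) = c • matOp e g T := by
  simp [matOp, Finset.smul_sum]

variable [CompleteSpace H]

lemma star_matOp (e g : ι → H) (T : Matrix ι ι ℂ) : star (matOp e g T) = matOp g e Tᴴ := by
  simp only [matOp, star_sum, star_smul, ContinuousLinearMap.star_eq_adjoint, adjoint_rankOne,
    conjTranspose_apply]
  exact Finset.sum_comm

lemma isStarProjection_matOp [DecidableEq ι] {g : ι → H} (hg : Orthonormal ℂ g)
    {P : Matrix ι ι ℂ} (hP : IsStarProjection P) : IsStarProjection (matOp g g P) where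
  isIdempotentElem := by
    rw [IsIdempotentElem, matOp_mul hg, hP.isIdempotentElem.eq]
  isSelfAdjoint := by
    rw [IsSelfAdjoint, star_matOp, ← star_eq_conjTranspose, hP.isSelfAdjoint.star_eq]

/-- For the projection Q, the sum of ‖Q f_i‖² over any orthonormal system f equals the double sum of
|⟨Q g_j, f_i⟩|². Bessel's inequality in i bounds it by the sum of ‖Q g_j‖², which is the trace of P.
-/
lemma posTrace_matOp_le [DecidableEq ι] {g : ι → H} (hg : Orthonormal ℂ g)
    {P : Matrix ι ι ℂ} (hP : IsStarProjection P) {k : ℝ≥0} (hk : P.trace = k) :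
    posTrace (matOp g g P) ≤ k := by
  have hQ := isStarProjection_matOp hg hP
  set Q := matOp g g P with hQd
  have hQi (u v : H) : ⟪Q u, v⟫_ℂ = ⟪u, Q v⟫_ℂ := by
    rw [← ContinuousLinearMap.adjoint_inner_right, ← ContinuousLinearMap.star_eq_adjoint,
      hQ.isSelfAdjoint.star_eq]
  have hQQ (u : H) : Q (Q u) = Q u := by
    rw [← mul_apply_eq_comp, hQ.isIdempotentElem.eq]
  have h1 (u : H) : RCLike.re ⟪u, Q u⟫_ℂ = ‖Q u‖ ^ 2 := by
    rw [← inner_self_eq_norm_sq (𝕜 := ℂ), hQi, hQQ]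
  have h2 (u : H) : ‖Q u‖ ^ 2 = ∑ j, ‖⟪Q (g j), u⟫_ℂ‖ ^ 2 := by
    have : Q u = ∑ j, ⟪g j, Q u⟫_ℂ • g j := by
      conv_lhs => rw [hQd, matOp_apply]
      simp only [hQd, inner_matOp hg]
    rw [this, norm_sum_smul hg]
    simp only [hQi]
  have h3 : ∑ j, ‖Q (g j)‖ ^ 2 = k := by
    have : ((∑ j, ‖Q (g j)‖ ^ 2 : ℝ) : ℂ) = k := by
      rw [← hk, trace, Complex.ofReal_sum]
      refine Finset.sum_congr rfl fun j _ => ?_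
      rw [Complex.ofReal_pow, ← RCLike.ofReal_eq_complex_ofReal,
        ← inner_self_eq_norm_sq_to_K (𝕜 := ℂ), hQi, hQQ, hQd, inner_matOp hg]
      simp [orthonormal_iff_ite.1 hg]
    exact_mod_cast this
  refine iSup_le fun n => iSup_le fun f => iSup_le fun hf => ?_
  simp only [h1, h2]
  rw [← ENNReal.ofReal_sum_of_nonneg (fun i _ => by positivity), ← ENNReal.ofReal_coe_nnreal, ← h3,
    Finset.sum_comm]
  refine ENNReal.ofReal_le_ofReal (Finset.sum_le_sum fun j _ => ?_)
  simp only [norm_inner_symm (Q (g j))]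
  exact hf.sum_inner_products_le _

lemma star_matOp_mul_self [DecidableEq ι] {e : ι → H} (he : Orthonormal ℂ e) (g : ι → H)
    (T : Matrix ι ι ℂ) : star (matOp e g T) * matOp e g T = matOp g g (Tᴴ * T) := by
  rw [star_matOp, matOp_mul he]

/-- The Schatten norms of a matrix which is a multiple of a partial isometry. -/
lemma schattenNorm_matOp_le [DecidableEq ι] {e g : ι → H} (he : Orthonormal ℂ e)
    (hg : Orthonormal ℂ g) {T P : Matrix ι ι ℂ} (hP : IsStarProjection P) {c k : ℝ≥0}
    (hT : Tᴴ * T = (c ^ 2) • P) (hk : P.trace = k) {p : ℝ≥0∞} (hp : p ≠ 0) :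
    schattenNorm p (matOp e g T) ≤ c * k ^ (1 / p.toReal) := by
  have h : star (matOp e g T) * matOp e g T = (c ^ 2) • matOp g g P := by
    rw [star_matOp_mul_self he, hT, matOp_smul]
  -- For p = ∞, `p.toReal` is 0 and 1 / 0 = 0, so the factor k^(1/p) is 1, as it should be.
  by_cases hp' : p = ∞
  · rw [schattenNorm, if_pos hp', hp']
    simpa using norm_le_of_star_mul_self (isStarProjection_matOp hg hP) h
  lift p to ℝ≥0 using hp'
  exact schattenNorm_le_of_star_mul_self (isStarProjection_matOp hg hP) h
    (posTrace_matOp_le hg hP hk) (pos_iff_ne_zero.2 (by exact_mod_cast hp))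

end MatOp

/-! ### Heisenberg matrices over a finite ring with an ideal contained in every nonzero ideal -/

section FiniteRing

open Matrix

open scoped Classical in
/-- The Dirac mass at `0` minus the uniform probability measure on an ideal. -/
def idealDiff {R : Type*} [CommRing R] (𝔞 : Ideal R) (s : R) : ℂ :=
  (if s = 0 then 1 else 0) - (if s ∈ 𝔞 then (Nat.card 𝔞 : ℂ)⁻¹ else 0)

variable {R : Type*} [CommRing R] {𝔞 : Ideal R}

lemma idealDiff_neg (s : R) : idealDiff 𝔞 (-s) = idealDiff 𝔞 s := by
  classical
  simp only [idealDiff]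
  congr 1
  · exact if_congr neg_eq_zero rfl rfl
  · exact if_congr (neg_mem_iff (S := Ideal R)) rfl rfl

lemma star_idealDiff (s : R) : star (idealDiff 𝔞 s) = idealDiff 𝔞 s := by
  simp only [idealDiff, star_sub]
  split_ifs <;> simp

lemma card_ideal_ne_zero (𝔞 : Ideal R) [Finite 𝔞] : (Nat.card 𝔞 : ℂ) ≠ 0 := by
  exact_mod_cast Nat.card_pos.ne'

/-- The Dirac mass and the uniform measure have the same mass on every coset of 𝔞. -/
lemma sum_idealDiff_add [Fintype 𝔞] (c : R) : ∑ t : 𝔞, idealDiff 𝔞 (t + c) = 0 := by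
  classical
  simp only [idealDiff, Finset.sum_sub_distrib]
  by_cases hc : c ∈ 𝔞
  · have h1 (t : 𝔞) : ((t : R) + c = 0) ↔ t = ⟨-c, 𝔞.neg_mem hc⟩ := by
      rw [Subtype.ext_iff, add_eq_zero_iff_eq_neg]
    have h2 (t : 𝔞) : (t : R) + c ∈ 𝔞 := 𝔞.add_mem t.2 hc
    simp [h1, h2]
  · have h1 (t : 𝔞) : (t : R) + c ∉ 𝔞 := fun h => hc ((𝔞.add_mem_iff_right t.2).1 h)
    have h2 (t : 𝔞) : (t : R) + c ≠ 0 := fun h => h1 t (h ▸ 𝔞.zero_mem)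
    simp [h1, h2]

lemma sum_ideal_of_const {ψ : R → ℂ} {ψ₁ : ℂ} [Fintype 𝔞] (h1 : ∀ t ∈ 𝔞, t ≠ 0 → ψ t = ψ₁) :
    ∑ t : 𝔞, ψ t = ψ 0 + (Nat.card 𝔞 - 1) * ψ₁ := by
  classical
  rw [← Finset.add_sum_erase _ _ (Finset.mem_univ (0 : 𝔞)), Finset.sum_congr rfl
    (g := fun _ => ψ₁) fun (t : 𝔞) ht => h1 t t.2 (by simpa using Finset.ne_of_mem_erase ht)]
  simp only [Finset.sum_const, Finset.card_erase_of_mem (Finset.mem_univ _), Finset.card_univ,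
    nsmul_eq_mul, Nat.card_eq_fintype_card, ZeroMemClass.coe_zero]
  rw [Nat.cast_sub Fintype.card_pos, Nat.cast_one]

variable [Fintype R]

lemma sum_mul_idealDiff (ψ : R → ℂ) (𝔞 : Ideal R) [Fintype 𝔞] :
    ∑ s, ψ s * idealDiff 𝔞 s = ψ 0 - (Nat.card 𝔞 : ℂ)⁻¹ * ∑ t : 𝔞, ψ t := by
  classical
  simp only [idealDiff, mul_sub, Finset.sum_sub_distrib, mul_ite, mul_one, mul_zero]
  rw [Finset.sum_ite_eq' Finset.univ (0 : R), if_pos (Finset.mem_univ _), ← Finset.sum_filter,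
    Finset.mul_sum]
  congr 1
  rw [Finset.sum_subtype (p := (· ∈ 𝔞)) _ (by simp)]
  exact Fintype.sum_congr _ _ fun t => mul_comm _ _

lemma sum_mul_idealDiff_of_const {ψ : R → ℂ} {ψ₁ : ℂ} (h1 : ∀ t ∈ 𝔞, t ≠ 0 → ψ t = ψ₁) :
    ∑ s, ψ s * idealDiff 𝔞 s = (1 - (Nat.card 𝔞 : ℂ)⁻¹) * (ψ 0 - ψ₁) := by
  have : Fintype 𝔞 := Fintype.ofFinite _
  have hc := card_ideal_ne_zero 𝔞
  rw [sum_mul_idealDiff, sum_ideal_of_const h1]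
  field_simp
  ring

/-- In the group algebra of R, the uniform measure on 𝔞 is idempotent, hence so is 1 minus it;
evenness turns this correlation into a convolution. -/
lemma sum_idealDiff_mul_idealDiff (u v : R) :
    ∑ z, idealDiff 𝔞 (z + u) * idealDiff 𝔞 (z + v) = idealDiff 𝔞 (u - v) := by
  have : Fintype 𝔞 := Fintype.ofFinite _
  rw [← Equiv.sum_comp (Equiv.subRight v)]
  simp only [Equiv.subRight_apply, sub_add_cancel]
  rw [sum_mul_idealDiff (fun z => idealDiff 𝔞 (z - v + u))]
  have (t : R) : t - v + u = t + (u - v) := by ring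
  simp only [this, sum_idealDiff_add, mul_zero, sub_zero, zero_add]

/-- A nonzero coordinate of d divides every t in 𝔞, so a translation of x shifts x ⬝ d by t. The sum
therefore equals its average over such shifts, which vanishes by `sum_idealDiff_add`. -/
lemma sum_idealDiff_dotProduct {n : ℕ} (h𝔞 : ∀ t ∈ 𝔞, ∀ d : R, d ≠ 0 → d ∣ t) (d : Fin n → R)
    (hd : d ≠ 0) (w : R) : ∑ x : Fin n → R, idealDiff 𝔞 (w + x ⬝ᵥ d) = 0 := by
  have : Fintype 𝔞 := Fintype.ofFinite _
  obtain ⟨k, hk⟩ := Function.ne_iff.1 hd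
  have h1 (t : 𝔞) : ∑ x : Fin n → R, idealDiff 𝔞 (t + (w + x ⬝ᵥ d)) =
      ∑ x : Fin n → R, idealDiff 𝔞 (w + x ⬝ᵥ d) := by
    obtain ⟨c, hc⟩ := h𝔞 t t.2 (d k) hk
    rw [← Equiv.sum_comp (Equiv.addRight (Pi.single k c)) (fun x => idealDiff 𝔞 (w + x ⬝ᵥ d))]
    refine Fintype.sum_congr _ _ fun x => ?_
    rw [Equiv.coe_addRight, add_dotProduct, single_dotProduct, hc]
    ring_nf
  have h2 : ∑ t : 𝔞, ∑ x : Fin n → R, idealDiff 𝔞 (t + (w + x ⬝ᵥ d)) = 0 := by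
    rw [Finset.sum_comm]
    exact Finset.sum_eq_zero fun x _ => sum_idealDiff_add _
  simp only [h1, Finset.sum_const, Finset.card_univ, nsmul_eq_mul] at h2
  refine (mul_eq_zero.1 h2).resolve_left ?_
  rw [← Nat.card_eq_fintype_card]
  exact card_ideal_ne_zero 𝔞

/-- The matrix `ψ (z + w + x ⬝ y)`, with rows `(x, z)` and columns `(y, w)`. -/
def heisMatrix (n : ℕ) (ψ : R → ℂ) : Matrix ((Fin n → R) × R) ((Fin n → R) × R) ℂ :=
  Matrix.of fun i j => ψ (i.2 + j.2 + i.1 ⬝ᵥ j.1)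

open scoped Classical in
/-- Convolution by `idealDiff` in the last variable. -/
def heisProj (n : ℕ) (𝔞 : Ideal R) : Matrix ((Fin n → R) × R) ((Fin n → R) × R) ℂ :=
  Matrix.of fun i j => if i.1 = j.1 then idealDiff 𝔞 (i.2 - j.2) else 0

lemma heisMatrix_mul_heisProj (n : ℕ) (ψ : R → ℂ) :
    heisMatrix n ψ * heisProj n 𝔞 = heisMatrix n fun s => ∑ v, ψ (s + v) * idealDiff 𝔞 v := by
  classical
  ext i j
  simp only [mul_apply, heisMatrix, heisProj, of_apply, Fintype.sum_prod_type, mul_ite, mul_zero]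
  rw [Finset.sum_comm]
  simp only [Finset.sum_ite_eq', Finset.mem_univ, if_true]
  rw [← Equiv.sum_comp (Equiv.addRight j.2)]
  refine Fintype.sum_congr _ _ fun v => ?_
  simp only [Equiv.coe_addRight, add_sub_cancel_right]
  ring_nf

lemma isStarProjection_heisProj (n : ℕ) : IsStarProjection (heisProj n 𝔞) where
  isIdempotentElem := by
    classical
    ext i j
    simp only [mul_apply, heisProj, of_apply, Fintype.sum_prod_type]
    rw [Finset.sum_comm]
    simp only [mul_ite, mul_zero, Finset.sum_ite_eq', Finset.mem_univ, if_true, ite_mul, zero_mul]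
    split_ifs with h
    · have := sum_idealDiff_mul_idealDiff (𝔞 := 𝔞) (-i.2) (-j.2)
      rw [← idealDiff_neg, show -(i.2 - j.2) = -i.2 - -j.2 by ring, ← this]
      refine Fintype.sum_congr _ _ fun v => ?_
      rw [← idealDiff_neg, neg_sub, sub_eq_add_neg, sub_eq_add_neg]
    · simp
  isSelfAdjoint := by
    classical
    ext i j
    simp only [star_eq_conjTranspose, conjTranspose_apply, heisProj, of_apply, apply_ite star,
      star_idealDiff, star_zero]
    rw [← idealDiff_neg, neg_sub]
    exact if_congr eq_comm rfl rfl

lemma trace_heisProj (n : ℕ) : (heisProj n 𝔞).trace =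
    (Nat.card R : ℂ) ^ (n + 1) * (1 - (Nat.card 𝔞 : ℂ)⁻¹) := by
  simp [trace, heisProj, idealDiff, Nat.card_eq_fintype_card, pow_succ, mul_sub]

/-- Summing over the last coordinate leaves `idealDiff` at i.2 - j.2 + x ⬝ (i.1 - j.1). The sum over
x then gives N^n on the diagonal blocks i.1 = j.1 and cancels elsewhere. So the test matrix is a
multiple of a partial isometry. -/
lemma conjTranspose_heisMatrix_mul_self (n : ℕ) (h𝔞 : ∀ t ∈ 𝔞, ∀ d : R, d ≠ 0 → d ∣ t) :
    (heisMatrix n (idealDiff 𝔞))ᴴ * heisMatrix n (idealDiff 𝔞) =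
      ((Nat.card R : ℝ≥0) ^ n) • heisProj n 𝔞 := by
  classical
  ext i j
  simp only [mul_apply, conjTranspose_apply, heisMatrix, of_apply, star_idealDiff, Matrix.smul_apply,
    heisProj, Fintype.sum_prod_type]
  have h1 (x : Fin n → R) : ∑ z, idealDiff 𝔞 (z + i.2 + x ⬝ᵥ i.1) *
      idealDiff 𝔞 (z + j.2 + x ⬝ᵥ j.1) = idealDiff 𝔞 (i.2 - j.2 + x ⬝ᵥ (i.1 - j.1)) := by
    simp only [add_assoc]
    rw [sum_idealDiff_mul_idealDiff, dotProduct_sub]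
    ring_nf
  simp only [h1]
  split_ifs with h
  · simp [h, NNReal.smul_def, Nat.card_eq_fintype_card]
  · rw [smul_zero, sum_idealDiff_dotProduct h𝔞 _ (sub_ne_zero.2 h)]

/-- Convolution by `idealDiff` subtracts from ψ its mean over cosets of 𝔞. Outside 𝔞 this kills ψ,
and on 𝔞 only the jump between 0 and the rest survives. -/
lemma heisMatrix_mul_heisProj_of_radial (n : ℕ) {ψ : R → ℂ} {ψ₁ : ℂ}
    (h1 : ∀ t ∈ 𝔞, t ≠ 0 → ψ t = ψ₁) (h2 : ∀ s ∉ 𝔞, ∀ t ∈ 𝔞, ψ (s + t) = ψ s) :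
    heisMatrix n ψ * heisProj n 𝔞 = (ψ 0 - ψ₁) • heisMatrix n (idealDiff 𝔞) := by
  classical
  have : Fintype 𝔞 := Fintype.ofFinite _
  have hc := card_ideal_ne_zero 𝔞
  have h3 := sum_ideal_of_const h1
  rw [heisMatrix_mul_heisProj]
  ext i j
  simp only [heisMatrix, of_apply, Matrix.smul_apply, smul_eq_mul]
  generalize i.2 + j.2 + i.1 ⬝ᵥ j.1 = s
  rw [sum_mul_idealDiff (fun v => ψ (s + v)), add_zero]
  by_cases hs : s ∈ 𝔞
  · have h4 : ∑ t : 𝔞, ψ (s + t) = ∑ t : 𝔞, ψ t :=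
      Equiv.sum_comp (Equiv.addLeft (⟨s, hs⟩ : 𝔞)) (fun t => ψ t)
    rw [h4, h3, idealDiff, if_pos hs]
    split_ifs with h0
    · rw [h0]; field_simp; ring
    · rw [h1 s hs h0]; field_simp; ring
  · have h0 : s ≠ 0 := fun h => hs (h ▸ 𝔞.zero_mem)
    rw [idealDiff, if_neg hs, if_neg h0]
    simp only [h2 s hs _ (Subtype.prop _), Finset.sum_const, Finset.card_univ, nsmul_eq_mul,
      ← Nat.card_eq_fintype_card]
    field_simp
    ring

lemma sum_heisMatrix (n : ℕ) (ψ : R → ℂ) :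
    ∑ i, ∑ j, heisMatrix n ψ i j = (Nat.card R : ℂ) ^ (2 * n + 1) * ∑ s, ψ s := by
  simp only [heisMatrix, of_apply, Fintype.sum_prod_type]
  have (x y : Fin n → R) (z : R) : ∑ w, ψ (z + w + x ⬝ᵥ y) = ∑ s, ψ s := by
    rw [← Equiv.sum_comp (Equiv.addLeft (z + x ⬝ᵥ y)) ψ]
    refine Fintype.sum_congr _ _ fun v => ?_
    rw [Equiv.coe_addLeft]
    ring_nf
  simp only [this, Finset.sum_const, Finset.card_univ, Fintype.card_pi, Finset.prod_const,
    Fintype.card_fin, nsmul_eq_mul, Nat.card_eq_fintype_card]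
  push_cast
  ring

end FiniteRing

/-! ### Schur multipliers with symbol ψ(z + w + x ⬝ y): the jump of ψ at 0 -/

section MultiplierEstimates

open Matrix

variable {R : Type*} [CommRing R] [Fintype R] {𝔞 : Ideal R}

/-- The rank of an idempotent is its trace, here N^(n+1) (1 - 1/|𝔞|), and |𝔞| ≥ 2. -/
lemma exists_finrank_heisProj (n : ℕ) (h𝔞2 : 2 ≤ Nat.card 𝔞) [DecidableEq R] :
    ∃ d : ℕ, d = Module.finrank ℂ (LinearMap.range (heisProj n 𝔞).mulVecLin) ∧
      (heisProj n 𝔞).trace = d ∧ (d : ℝ) ≤ (Nat.card R : ℝ) ^ (n + 1) ∧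
        (Nat.card R : ℝ) ^ (n + 1) / 2 ≤ d := by
  have hP := (isStarProjection_heisProj (R := R) (𝔞 := 𝔞) n).isIdempotentElem
  have hQ : IsIdempotentElem (heisProj n 𝔞).mulVecLin := by
    rw [IsIdempotentElem, Module.End.mul_eq_comp, ← mulVecLin_mul, hP.eq]
  have htr : (heisProj n 𝔞).trace =
      Module.finrank ℂ (LinearMap.range (heisProj n 𝔞).mulVecLin) := by
    rw [← (LinearMap.IsIdempotentElem.isProj_range _ hQ).trace, ← toLin'_apply', trace_toLin'_eq]
  refine ⟨_, rfl, htr, ?_⟩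
  rw [trace_heisProj] at htr
  have htr' : (Nat.card R : ℝ) ^ (n + 1) * (1 - (Nat.card 𝔞 : ℝ)⁻¹) =
      Module.finrank ℂ (LinearMap.range (heisProj n 𝔞).mulVecLin) := by
    apply Complex.ofReal_injective
    push_cast
    exact htr
  rw [← htr']
  have h2 : (2 : ℝ) ≤ Nat.card 𝔞 := by exact_mod_cast h𝔞2
  have h3 : (Nat.card 𝔞 : ℝ)⁻¹ ≤ 2⁻¹ := inv_anti₀ two_pos h2
  have h4 : 0 < (Nat.card 𝔞 : ℝ)⁻¹ := by positivity
  have h5 : 0 < (Nat.card R : ℝ) ^ (n + 1) := by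
    have : 0 < Nat.card R := Nat.card_pos
    positivity
  constructor <;> nlinarith

lemma conjTranspose_heisMatrix_mul_self_sq (n : ℕ) (h𝔞 : ∀ t ∈ 𝔞, ∀ d : R, d ≠ 0 → d ∣ t) :
    (heisMatrix n (idealDiff 𝔞))ᴴ * heisMatrix n (idealDiff 𝔞) =
      (((Nat.card R : ℝ≥0) ^ ((n : ℝ) / 2)) ^ 2) • heisProj n 𝔞 := by
  rw [conjTranspose_heisMatrix_mul_self n h𝔞, ← NNReal.rpow_natCast, ← NNReal.rpow_natCast,
    ← NNReal.rpow_mul]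
  congr 2
  push_cast
  ring

variable {H : Type*} [NormedAddCommGroup H] [InnerProductSpace ℂ H] [CompleteSpace H] {n : ℕ}

/-- Comparison of the values of a symbol of the form `ψ (z + w + x ⬝ y)` at `0` and on the rest
of a minimal ideal, for a Schur multiplier of `S^p` with `2 ≤ p ≤ ∞`. -/
lemma norm_sub_le_of_two_le (h𝔞 : ∀ t ∈ 𝔞, ∀ d : R, d ≠ 0 → d ∣ t) (h𝔞2 : 2 ≤ Nat.card 𝔞)
    {ψ : R → ℂ} {ψ₁ : ℂ} (h1 : ∀ t ∈ 𝔞, t ≠ 0 → ψ t = ψ₁)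
    {e g : (Fin n → R) × R → H} (he : Orthonormal ℂ e) (hg : Orthonormal ℂ g)
    {p : ℝ≥0∞} (hp : 2 ≤ p) {C : ℝ≥0}
    (hC : ∀ T : Matrix ((Fin n → R) × R) ((Fin n → R) × R) ℂ,
      schattenNorm p (matOp e g T) < ∞ → ∃ B : H →L[ℂ] H,
      (∀ i j, ⟪e i, B (g j)⟫_ℂ = heisMatrix n ψ i j * T i j) ∧
        schattenNorm p B ≤ C * schattenNorm p (matOp e g T)) :
    ‖ψ 0 - ψ₁‖ ≤ 2 * C * (Nat.card R : ℝ) ^ ((n + 1) / p.toReal - n / 2) := by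
  classical
  have hcR : 0 < Nat.card R := Nat.card_pos
  have hN0 : (0 : ℝ) < Nat.card R := by exact_mod_cast hcR
  obtain ⟨d, -, hd, hd1, hd2⟩ := exists_finrank_heisProj (R := R) n h𝔞2
  have hA := schattenNorm_matOp_le he hg (isStarProjection_heisProj (𝔞 := 𝔞) n) (k := d)
    (conjTranspose_heisMatrix_mul_self_sq n h𝔞) (by rw [hd]; simp)
    (lt_of_lt_of_le two_pos hp).ne'
  -- The image of the test matrix has symbol ψ times `idealDiff`, whose sum over R is (1 - 1/|𝔞|) (ψ
  -- 0 - ψ₁). Pairing with the all-ones vectors, of squared norm N^(n+1), detects this sum in the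
  -- operator norm of B.
  obtain ⟨B, hB, hBC⟩ := hC (heisMatrix n (idealDiff 𝔞)) (hA.trans_lt (ENNReal.mul_lt_top
    ENNReal.coe_lt_top (ENNReal.rpow_lt_top_of_nonneg (by positivity) ENNReal.coe_ne_top)))
  have hB1 : ‖B‖ ≤ C * ((Nat.card R : ℝ) ^ ((n : ℝ) / 2) * (d : ℝ) ^ (1 / p.toReal)) := by
    have h := (enorm_le_schattenNorm B hp).trans (hBC.trans (mul_le_mul_right hA _))
    rw [← ENNReal.coe_rpow_of_nonneg _ (by positivity), enorm_eq_nnnorm] at h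
    exact_mod_cast h
  have hsum : ⟪∑ i, (1 : ℂ) • e i, B (∑ j, (1 : ℂ) • g j)⟫_ℂ =
      (Nat.card R : ℂ) ^ (2 * n + 1) * ((1 - (Nat.card 𝔞 : ℂ)⁻¹) * (ψ 0 - ψ₁)) := by
    rw [← sum_mul_idealDiff_of_const h1, ← sum_heisMatrix]
    simp only [one_smul, map_sum, sum_inner]
    refine Fintype.sum_congr _ _ fun i => ?_
    rw [inner_sum]
    exact Fintype.sum_congr _ _ fun j => hB i j
  have hn1 {f : (Fin n → R) × R → H} (hf : Orthonormal ℂ f) :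
      ‖∑ i, (1 : ℂ) • f i‖ ^ 2 = (Nat.card R : ℝ) ^ (n + 1) := by
    rw [norm_sum_smul hf]
    simp [Nat.card_eq_fintype_card, pow_succ]
  have hle := norm_inner_le_norm (𝕜 := ℂ) (∑ i, (1 : ℂ) • e i) (B (∑ j, (1 : ℂ) • g j))
  have h2 : (2 : ℝ) ≤ Nat.card 𝔞 := by exact_mod_cast h𝔞2
  have h3 : ‖(1 - (Nat.card 𝔞 : ℂ)⁻¹)‖ = 1 - (Nat.card 𝔞 : ℝ)⁻¹ := by
    rw [show (1 - (Nat.card 𝔞 : ℂ)⁻¹) = ((1 - (Nat.card 𝔞 : ℝ)⁻¹ : ℝ) : ℂ) by push_cast; rfl,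
      Complex.norm_real, Real.norm_of_nonneg]
    rw [sub_nonneg]
    exact inv_le_one_of_one_le₀ (one_le_two.trans h2)
  have h4 : (Nat.card 𝔞 : ℝ)⁻¹ ≤ 2⁻¹ := inv_anti₀ two_pos h2
  rw [hsum, norm_mul, norm_mul, h3, norm_pow, Complex.norm_natCast] at hle
  have heq : ‖∑ i, (1 : ℂ) • e i‖ = ‖∑ i, (1 : ℂ) • g i‖ := by
    rw [← sq_eq_sq₀ (norm_nonneg _) (norm_nonneg _), hn1 he, hn1 hg]
  have h5 : (Nat.card R : ℝ) ^ (2 * n + 1) * (2⁻¹ * ‖ψ 0 - ψ₁‖) ≤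
      (Nat.card R : ℝ) ^ (n + 1) *
        (C * ((Nat.card R : ℝ) ^ ((n : ℝ) / 2) * (Nat.card R : ℝ) ^ ((n + 1) / p.toReal))) := by
    calc _ ≤ (Nat.card R : ℝ) ^ (2 * n + 1) * ((1 - (Nat.card 𝔞 : ℝ)⁻¹) * ‖ψ 0 - ψ₁‖) := by
          gcongr; linarith
      _ ≤ _ := hle
      _ ≤ ‖∑ i, (1 : ℂ) • e i‖ * (‖B‖ * ‖∑ i, (1 : ℂ) • g i‖) := by
          gcongr; exact B.le_opNorm _
      _ = (Nat.card R : ℝ) ^ (n + 1) * ‖B‖ := by rw [heq, ← hn1 hg]; ring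
      _ ≤ (Nat.card R : ℝ) ^ (n + 1) *
            (C * ((Nat.card R : ℝ) ^ ((n : ℝ) / 2) * (d : ℝ) ^ (1 / p.toReal))) := by gcongr
      _ ≤ _ := by
          gcongr
          rw [show ((n : ℝ) + 1) / p.toReal = ((n + 1 : ℕ) : ℝ) * (1 / p.toReal) by push_cast; ring,
            Real.rpow_mul hN0.le, Real.rpow_natCast]
          gcongr
  have h6 : (Nat.card R : ℝ) ^ (2 * n + 1) =
      (Nat.card R : ℝ) ^ (n + 1) * (Nat.card R : ℝ) ^ n := by ring
  rw [h6, mul_assoc] at h5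
  have h7 := le_of_mul_le_mul_left h5 (by positivity)
  have h8 : (Nat.card R : ℝ) ^ ((n : ℝ) / 2) * (Nat.card R : ℝ) ^ (((n : ℝ) + 1) / p.toReal) =
      (Nat.card R : ℝ) ^ n * (Nat.card R : ℝ) ^ ((n + 1) / p.toReal - n / 2) := by
    rw [← Real.rpow_natCast, ← Real.rpow_add hN0, ← Real.rpow_add hN0]
    congr 1; ring
  rw [h8] at h7
  have h9 : (Nat.card R : ℝ) ^ n * (2⁻¹ * ‖ψ 0 - ψ₁‖) ≤ (Nat.card R : ℝ) ^ n *
      (C * (Nat.card R : ℝ) ^ ((n + 1) / p.toReal - n / 2)) := by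
    refine h7.trans_eq ?_; ring
  linarith [le_of_mul_le_mul_left h9 (by positivity)]

lemma isStarProjection_const (ι : Type*) [Fintype ι] [Nonempty ι] :
    IsStarProjection (Matrix.of fun _ _ : ι => (Fintype.card ι : ℂ)⁻¹) where
  isIdempotentElem := by
    ext i j
    simp [mul_apply]
  isSelfAdjoint := by
    ext i j
    simp

lemma trace_const_inv_card (ι : Type*) [Fintype ι] [Nonempty ι] :
    (Matrix.of fun _ _ : ι => (Fintype.card ι : ℂ)⁻¹).trace = ((1 : ℝ≥0) : ℝ) := by
  simp [trace]

lemma conjTranspose_mul_self_const_one (ι : Type*) [Fintype ι] [Nonempty ι] :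
    (Matrix.of fun _ _ : ι => (1 : ℂ))ᴴ * (Matrix.of fun _ _ : ι => (1 : ℂ)) =
      ((Fintype.card ι : ℝ≥0) ^ 2) • Matrix.of fun _ _ : ι => (Fintype.card ι : ℂ)⁻¹ := by
  ext i j
  simp [mul_apply, NNReal.smul_def, sq]

/-- Comparison of the values of a symbol of the form `ψ (z + w + x ⬝ y)` at `0` and on the rest
of a minimal ideal, for a Schur multiplier of `S^p` with `1 ≤ p ≤ 2`. -/
lemma norm_sub_le_of_le_two (h𝔞 : ∀ t ∈ 𝔞, ∀ d : R, d ≠ 0 → d ∣ t) (h𝔞2 : 2 ≤ Nat.card 𝔞)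
    {ψ : R → ℂ} {ψ₁ : ℂ} (h1 : ∀ t ∈ 𝔞, t ≠ 0 → ψ t = ψ₁)
    (h2 : ∀ s ∉ 𝔞, ∀ t ∈ 𝔞, ψ (s + t) = ψ s)
    {e g : (Fin n → R) × R → H} (he : Orthonormal ℂ e) (hg : Orthonormal ℂ g)
    {p : ℝ≥0} (hp1 : 1 ≤ p) (hp2 : p ≤ 2) {C : ℝ≥0}
    (hC : ∀ T : Matrix ((Fin n → R) × R) ((Fin n → R) × R) ℂ,
      schattenNorm p (matOp e g T) < ∞ → ∃ B : H →L[ℂ] H,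
      (∀ i j, ⟪e i, B (g j)⟫_ℂ = heisMatrix n ψ i j * T i j) ∧
        schattenNorm p B ≤ C * schattenNorm p (matOp e g T)) :
    ‖ψ 0 - ψ₁‖ ≤ 2 * C * (Nat.card R : ℝ) ^ (n / 2 + 1 - (n + 1) / (p : ℝ)) := by
  classical
  have hcR : 0 < Nat.card R := Nat.card_pos
  have hN0 : (0 : ℝ) < Nat.card R := by exact_mod_cast hcR
  have hp0 : 0 < p := one_pos.trans_le hp1
  obtain ⟨d, hdr, hd, hd1, hd2⟩ := exists_finrank_heisProj (R := R) n h𝔞2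
  set T := heisMatrix n (idealDiff 𝔞) with hT
  set P := heisProj n 𝔞 with hPd
  have hcI : (Fintype.card ((Fin n → R) × R) : ℝ≥0) = (Nat.card R : ℝ≥0) ^ (n + 1) := by
    simp [Nat.card_eq_fintype_card, pow_succ]
  have hA := schattenNorm_matOp_le he hg (T := Matrix.of fun _ _ => 1)
    (isStarProjection_const ((Fin n → R) × R)) (k := 1)
    (c := Fintype.card ((Fin n → R) × R)) (conjTranspose_mul_self_const_one _) (trace_const_inv_card _)
    (p := p) (by exact_mod_cast hp0.ne')
  -- The all-ones matrix has rank one, so its Schatten norm is at most N^(n+1) for every p, and its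
  -- image is the symbol itself.
  obtain ⟨B, hB, hBC⟩ := hC (Matrix.of fun _ _ => 1) (hA.trans_lt (ENNReal.mul_lt_top
    ENNReal.coe_lt_top (ENNReal.rpow_lt_top_of_nonneg (by positivity) ENNReal.coe_ne_top)))
  have hBe : (Matrix.of fun i j => ⟪e i, B (g j)⟫_ℂ) = heisMatrix n ψ := by
    ext i j
    simp [hB]
  have hΦ := heisMatrix_mul_heisProj_of_radial (𝔞 := 𝔞) n h1 h2
  rw [← hT, ← hPd] at hΦ
  have hTT := conjTranspose_heisMatrix_mul_self_sq (𝔞 := 𝔞) n h𝔞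
  rw [← hT, ← hPd] at hTT
  set c₀ : ℝ≥0 := (Nat.card R : ℝ≥0) ^ ((n : ℝ) / 2) with hc₀
  have hc₀0 : 0 < c₀ := NNReal.rpow_pos (by exact_mod_cast hcR)
  let L : ((Fin n → R) × R → ℂ) →ₗ[ℂ] H :=
    (Fintype.linearCombination ℂ e) ∘ₗ T.mulVecLin
  have hL (x) : L x = ∑ i, (T *ᵥ x) i • e i := rfl
  have hself (x : (Fin n → R) × R → ℂ) : star x ⬝ᵥ x = ((∑ i, ‖x i‖ ^ 2 : ℝ) : ℂ) := by
    simp [dotProduct, Complex.conj_mul']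
  have hnorm (x) (hx : P *ᵥ x = x) : ‖L x‖ = c₀ * ‖∑ j, x j • g j‖ := by
    have : (∑ i, ‖(T *ᵥ x) i‖ ^ 2 : ℝ) = c₀ ^ 2 * ∑ j, ‖x j‖ ^ 2 := by
      have h : star (T *ᵥ x) ⬝ᵥ (T *ᵥ x) = ((c₀ : ℝ) : ℂ) ^ 2 * (star x ⬝ᵥ x) := by
        rw [star_mulVec, ← dotProduct_mulVec, mulVec_mulVec, hTT, smul_mulVec, hx, dotProduct_smul,
          NNReal.smul_def, Complex.real_smul]
        push_cast; rfl
      rw [hself, hself] at h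
      exact_mod_cast h
    rw [← sq_eq_sq₀ (norm_nonneg _) (by positivity), hL, norm_sum_smul he, mul_pow,
      norm_sum_smul hg, this]
  let V := (LinearMap.range P.mulVecLin).map L
  have hPx : ∀ x ∈ LinearMap.range P.mulVecLin, P *ᵥ x = x := by
    rintro _ ⟨y, rfl⟩
    rw [mulVecLin_apply, mulVec_mulVec, (isStarProjection_heisProj (𝔞 := 𝔞) n).isIdempotentElem.eq]
  have hV : Module.finrank ℂ V = d := by
    have : V = LinearMap.range (L.domRestrict (LinearMap.range P.mulVecLin)) :=
      (LinearMap.range_domRestrict _ _).symm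
    rw [this, hdr]
    refine LinearMap.finrank_range_of_inj ((injective_iff_map_eq_zero _).2 fun x hx => ?_)
    have h3 := hnorm x (hPx x x.2)
    rw [show L x = 0 from hx, norm_zero, eq_comm, mul_eq_zero] at h3
    have h4 := h3.resolve_left (by exact_mod_cast hc₀0.ne')
    have h5 := norm_sum_smul hg (x : (Fin n → R) × R → ℂ)
    rw [h4, sq, zero_mul, eq_comm, Finset.sum_eq_zero_iff_of_nonneg (fun _ _ => by positivity)] at h5
    ext i
    simpa using h5 i (Finset.mem_univ i)
  -- For x in the range of P, pairing B* (T x) with x gives (ψ 0 - ψ₁) ‖T x‖². Cauchy-Schwarz and ‖T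
  -- x‖ = c₀ ‖x‖ bound B* below by |ψ 0 - ψ₁| c₀ on V = T (range P), a space of dimension d.
  have hlow := le_schattenNorm_of_le_norm_star B hp0 hp2 V (c := ‖ψ 0 - ψ₁‖₊ * c₀) (by
    rintro _ ⟨x, hx, rfl⟩
    have hx' := hPx x hx
    have hΦx : heisMatrix n ψ *ᵥ x = (ψ 0 - ψ₁) • T *ᵥ x := by
      conv_lhs => rw [← hx', mulVec_mulVec, hΦ, smul_mulVec]
    have h3 : ⟪star B (L x), ∑ j, x j • g j⟫_ℂ = (ψ 0 - ψ₁) * ((‖L x‖ ^ 2 : ℝ) : ℂ) := by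
      rw [ContinuousLinearMap.star_eq_adjoint, ContinuousLinearMap.adjoint_inner_left, hL,
        inner_sum_smul_matOp, hBe, hΦx, norm_sum_smul he, dotProduct_smul, hself, smul_eq_mul]
    have h4 := norm_inner_le_norm (𝕜 := ℂ) (star B (L x)) (∑ j, x j • g j)
    rw [h3, norm_mul, Complex.norm_real, norm_pow, norm_norm, hnorm x hx'] at h4
    rw [hnorm x hx', NNReal.coe_mul, coe_nnnorm]
    rcases (norm_nonneg (∑ j, x j • g j)).eq_or_lt with h0 | h0
    · rw [← h0]; simp
    · refine le_of_mul_le_mul_right (le_trans (le_of_eq ?_) h4) h0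
      ring)
  have h3 := hlow.trans (hBC.trans (mul_le_mul_right hA _))
  rw [hV, hcI] at h3
  have h4 : ‖ψ 0 - ψ₁‖ * (Nat.card R : ℝ) ^ ((n : ℝ) / 2) * (d : ℝ) ^ (1 / (p : ℝ)) ≤
      C * (Nat.card R : ℝ) ^ (n + 1) := by
    have h : ((d : ℝ≥0) : ℝ≥0∞) ^ (1 / (p : ℝ)) = (((d : ℝ≥0) ^ (1 / (p : ℝ)) : ℝ≥0) : ℝ≥0∞) :=
      (ENNReal.coe_rpow_of_nonneg _ (by positivity)).symm
    rw [← ENNReal.coe_natCast, h, ENNReal.coe_one, ENNReal.one_rpow, mul_one] at h3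
    exact_mod_cast h3
  -- The rank is at least N^(n+1) / 2, and (1/2)^(1/p) ≥ 1/2 because p ≥ 1.
  have h5 : 2⁻¹ * (Nat.card R : ℝ) ^ (((n : ℝ) + 1) / (p : ℝ)) ≤ (d : ℝ) ^ (1 / (p : ℝ)) := by
    have hp1' : (1 : ℝ) / p ≤ 1 := by
      rw [div_le_one (by exact_mod_cast hp0)]; exact_mod_cast hp1
    calc 2⁻¹ * (Nat.card R : ℝ) ^ (((n : ℝ) + 1) / (p : ℝ))
        ≤ (2⁻¹ : ℝ) ^ (1 / (p : ℝ)) * (Nat.card R : ℝ) ^ (((n : ℝ) + 1) / (p : ℝ)) := by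
          gcongr
          exact Real.self_le_rpow_of_le_one (by norm_num) (by norm_num) hp1'
      _ = ((Nat.card R : ℝ) ^ (n + 1) / 2) ^ (1 / (p : ℝ)) := by
          rw [show ((n : ℝ) + 1) / (p : ℝ) = ((n + 1 : ℕ) : ℝ) * (1 / (p : ℝ)) by push_cast; ring,
            Real.rpow_mul hN0.le, Real.rpow_natCast, ← Real.mul_rpow (by positivity) (by positivity)]
          congr 1
          ring
      _ ≤ _ := by gcongr
  have h6 : ‖ψ 0 - ψ₁‖ * (Nat.card R : ℝ) ^ ((n : ℝ) / 2) *
      (2⁻¹ * (Nat.card R : ℝ) ^ (((n : ℝ) + 1) / (p : ℝ))) ≤ C * (Nat.card R : ℝ) ^ (n + 1) :=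
    le_trans (by gcongr) h4
  have h7 : (Nat.card R : ℝ) ^ (n + 1) = (Nat.card R : ℝ) ^ ((n : ℝ) / 2) *
      (Nat.card R : ℝ) ^ (((n : ℝ) + 1) / (p : ℝ)) *
        (Nat.card R : ℝ) ^ ((n : ℝ) / 2 + 1 - (n + 1) / (p : ℝ)) := by
    rw [← Real.rpow_natCast, ← Real.rpow_add hN0, ← Real.rpow_add hN0]
    congr 1; push_cast; ring
  rw [h7] at h6
  have h8 : 0 < (Nat.card R : ℝ) ^ ((n : ℝ) / 2) * (Nat.card R : ℝ) ^ (((n : ℝ) + 1) / (p : ℝ)) := by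
    positivity
  refine le_of_mul_le_mul_right ?_ h8
  linarith

end MultiplierEstimates

/-! ### From integral kernels on L² to finite matrices -/

section Kernel

open InnerProductSpace

variable {X : Type*} [MeasurableSpace X] {μ : Measure X}

lemma _root_.MeasureTheory.MemLp.ae_memLp_prodMk_left [SFinite μ] {k : X × X → ℂ}
    (hk : MemLp k 2 (μ.prod μ)) : ∀ᵐ x ∂μ, MemLp (fun y => k (x, y)) 2 μ := by
  have h := (memLp_two_iff_integrable_sq_norm hk.1).1 hk
  filter_upwards [hk.1.prodMk_left, h.prod_right_ae] with x h1 h2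
  exact (memLp_two_iff_integrable_sq_norm h1).2 h2

/-- An integral operator has at most one square integrable kernel. -/
lemma HasKernel.ae_unique [SFinite μ] [MeasurableSpace.CountablyGenerated X]
    {A : Lp ℂ 2 μ →L[ℂ] Lp ℂ 2 μ} {k k' : X × X → ℂ} (hk : MemLp k 2 (μ.prod μ))
    (hk' : MemLp k' 2 (μ.prod μ)) (h : HasKernel μ A k) (h' : HasKernel μ A k') :
    ∀ᵐ x ∂μ, ∀ᵐ y ∂μ, k (x, y) = k' (x, y) := by
  have : Fact ((2 : ℝ≥0∞) ≠ ∞) := ⟨by norm_num⟩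
  let f : ℕ → Lp ℂ 2 μ := TopologicalSpace.denseSeq (Lp ℂ 2 μ)
  have hf : DenseRange f := TopologicalSpace.denseRange_denseSeq _
  -- Testing against a countable dense sequence gives one null set of x for all test functions.
  have h1 : ∀ᵐ x ∂μ, ∀ n, ∫ y, k (x, y) * f n y ∂μ = ∫ y, k' (x, y) * f n y ∂μ :=
    ae_all_iff.2 fun n => (h (f n)).symm.trans (h' (f n))
  filter_upwards [h1, hk.ae_memLp_prodMk_left, hk'.ae_memLp_prodMk_left] with x hx hkx hkx'
  let u : Lp ℂ 2 μ := hkx.star.toLp _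
  let u' : Lp ℂ 2 μ := hkx'.star.toLp _
  have hu {g : X → ℂ} (hg : MemLp g 2 μ) (v : Lp ℂ 2 μ) :
      ⟪hg.star.toLp _, v⟫_ℂ = ∫ y, g y * v y ∂μ := by
    rw [L2.inner_def]
    refine integral_congr_ae ?_
    filter_upwards [hg.star.coeFn_toLp] with y hy
    rw [hy]
    simp [mul_comm]
  have huu : u = u' := by
    refine hf.eq_of_inner_left ℂ fun n => ?_
    exact (hu hkx _).trans ((hx n).trans (hu hkx' _).symm)
  filter_upwards [hkx.star.coeFn_toLp, hkx'.star.coeFn_toLp] with y h2 h3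
  have h4 : star (k (x, y)) = star (k' (x, y)) := by
    have : (u : X → ℂ) y = u' y := by rw [huu]
    simpa [u, u', h2, h3] using this
  exact star_injective h4

variable {ι : Type*}

/-- The normalised indicator function of a set, in `L²`. -/
def unitIndicator (μ : Measure X) {E : Set X} (hE : MeasurableSet E) (h : μ E ≠ ∞) : Lp ℂ 2 μ :=
  indicatorConstLp 2 hE h (((Real.sqrt (μ.real E))⁻¹ : ℝ) : ℂ)

lemma orthonormal_unitIndicator {E : ι → Set X} (hE : ∀ i, MeasurableSet (E i))
    (h : ∀ i, μ (E i) ≠ ∞) (h0 : ∀ i, μ (E i) ≠ 0) (hd : Pairwise fun i j => Disjoint (E i) (E j)) :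
    Orthonormal ℂ fun i => unitIndicator μ (hE i) (h i) := by
  classical
  rw [orthonormal_iff_ite]
  intro i j
  have hpos : 0 < μ.real (E i) := ENNReal.toReal_pos (h0 i) (h i)
  rw [unitIndicator, unitIndicator, L2.inner_indicatorConstLp_indicatorConstLp _ _ (h i) (h j)]
  split_ifs with hij
  · subst hij
    rw [Set.inter_self, RCLike.inner_apply, Complex.conj_ofReal, ← Complex.ofReal_mul, ← mul_inv,
      Real.mul_self_sqrt hpos.le]
    simp [hpos.ne']
  · rw [(hd hij).inter_eq]
    simp

variable [Fintype ι]

lemma memLp_sum_mul_prod [SFinite μ] {e g : ι → X → ℂ} (he : ∀ i, MemLp (e i) 2 μ)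
    (hg : ∀ i, MemLp (g i) 2 μ) (T : Matrix ι ι ℂ) :
    MemLp (fun z : X × X => ∑ i, ∑ j, T i j * (e i z.1 * conj (g j z.2))) 2 (μ.prod μ) := by
  refine memLp_finsetSum _ fun i _ => memLp_finsetSum _ fun j _ => MemLp.const_mul ?_ _
  have hm : AEStronglyMeasurable (fun z : X × X => e i z.1 * conj (g j z.2)) (μ.prod μ) :=
    (he i).1.comp_fst.mul (hg j).star.1.comp_snd
  rw [memLp_two_iff_integrable_sq_norm hm]
  have h1 := (memLp_two_iff_integrable_sq_norm (he i).1).1 (he i)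
  have h2 := (memLp_two_iff_integrable_sq_norm (hg j).1).1 (hg j)
  simpa [mul_pow] using h1.mul_prod h2

lemma hasKernel_matOp [SFinite μ] {e g : ι → Lp ℂ 2 μ} {e' g' : ι → X → ℂ}
    (he : ∀ i, e i =ᵐ[μ] e' i) (hg : ∀ i, g i =ᵐ[μ] g' i) (T : Matrix ι ι ℂ) :
    HasKernel μ (matOp e g T) fun z => ∑ i, ∑ j, T i j * (e' i z.1 * conj (g' j z.2)) := by
  intro f
  have hgj (j : ι) : Integrable (fun y => conj (g' j y) * f y) μ := by
    have := L2.integrable_inner (𝕜 := ℂ) (g j) f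
    refine this.congr ?_
    filter_upwards [hg j] with y hy
    rw [hy, RCLike.inner_apply, mul_comm]
  have hint (j : ι) : ⟪g j, f⟫_ℂ = ∫ y, conj (g' j y) * f y ∂μ := by
    rw [L2.inner_def]
    refine integral_congr_ae ?_
    filter_upwards [hg j] with y hy
    rw [hy, RCLike.inner_apply, mul_comm]
  rw [matOp_apply]
  have h1 : ((∑ i, (∑ j, T i j * ⟪g j, f⟫_ℂ) • e i : Lp ℂ 2 μ) : X → ℂ) =ᵐ[μ]
      fun x => ∑ i, (∑ j, T i j * ⟪g j, f⟫_ℂ) * e' i x := by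
    refine (Lp.coeFn_finsetSum _ _).trans ?_
    have h2 : ∀ᵐ x ∂μ, ∀ i, ((∑ j, T i j * ⟪g j, f⟫_ℂ) • e i : Lp ℂ 2 μ) x =
        (∑ j, T i j * ⟪g j, f⟫_ℂ) * e' i x := by
      refine ae_all_iff.2 fun i => ?_
      filter_upwards [Lp.coeFn_smul (∑ j, T i j * ⟪g j, f⟫_ℂ) (e i), he i] with x h3 h4
      rw [h3, Pi.smul_apply, h4, smul_eq_mul]
    filter_upwards [h2] with x hx
    simp [hx]
  refine h1.trans (Eventually.of_forall fun x => ?_)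
  dsimp only
  have h3 (y : X) : (∑ i, ∑ j, T i j * (e' i x * conj (g' j y))) * f y =
      ∑ i, ∑ j, T i j * e' i x * (conj (g' j y) * f y) := by
    simp only [Finset.sum_mul]
    refine Finset.sum_congr rfl fun i _ => Finset.sum_congr rfl fun j _ => by ring
  simp only [h3]
  rw [integral_finsetSum _ fun i _ => integrable_finsetSum _ fun j _ => (hgj j).const_mul _]
  refine Finset.sum_congr rfl fun i _ => ?_
  rw [integral_finsetSum _ fun j _ => (hgj j).const_mul _, Finset.sum_mul]
  refine Finset.sum_congr rfl fun j _ => ?_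
  rw [integral_const_mul, hint]
  ring

/-- A Schur multiplier of `S^p(L²)` gives a Schur multiplier of finite matrices by averaging the
symbol over pairwise disjoint sets. -/
lemma MSNormLE.exists_matOp [SFinite μ] [MeasurableSpace.CountablyGenerated X]
    {p : ℝ≥0∞} {φ : X → X → ℂ} {C : ℝ≥0} (hφ : MSNormLE p μ φ C)
    {E E' : ι → Set X} (hE : ∀ i, MeasurableSet (E i)) (hE' : ∀ i, MeasurableSet (E' i))
    (hd : Pairwise fun i j => Disjoint (E i) (E j))
    (hd' : Pairwise fun i j => Disjoint (E' i) (E' j)) {m : ℝ≥0∞} (hm : m ≠ ∞)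
    (h : ∀ i, μ (E i) = m) (h' : ∀ i, μ (E' i) = m) (T : Matrix ι ι ℂ)
    (hT : schattenNorm p (matOp (fun i => unitIndicator μ (hE i) ((h i).trans_ne hm))
      (fun i => unitIndicator μ (hE' i) ((h' i).trans_ne hm)) T) < ∞) :
    ∃ B : Lp ℂ 2 μ →L[ℂ] Lp ℂ 2 μ,
      (∀ i j, ⟪unitIndicator μ (hE i) ((h i).trans_ne hm),
        B (unitIndicator μ (hE' j) ((h' j).trans_ne hm))⟫_ℂ =
          ((m.toReal ^ 2)⁻¹ * ∫ x in E i, ∫ y in E' j, φ x y ∂μ ∂μ) * T i j) ∧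
      schattenNorm p B ≤ C * schattenNorm p
        (matOp (fun i => unitIndicator μ (hE i) ((h i).trans_ne hm))
          (fun i => unitIndicator μ (hE' i) ((h' i).trans_ne hm)) T) := by
  set e : ι → Lp ℂ 2 μ := fun i => unitIndicator μ (hE i) ((h i).trans_ne hm) with he
  set g : ι → Lp ℂ 2 μ := fun i => unitIndicator μ (hE' i) ((h' i).trans_ne hm) with hg
  obtain ⟨c, hc⟩ : ∃ c : ℝ, c = (Real.sqrt m.toReal)⁻¹ := ⟨_, rfl⟩
  -- The constant c is the height of the normalised indicators. It occurs four times in the pairing: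
  -- twice in the kernel of `matOp e g T` and once each from e i and g j.
  have hc4 : c ^ 4 = (m.toReal ^ 2)⁻¹ := by
    rw [hc, inv_pow, show 4 = 2 * 2 by rfl, pow_mul, Real.sq_sqrt ENNReal.toReal_nonneg]
  have he' (i) : e i =ᵐ[μ] (E i).indicator fun _ => (c : ℂ) := by
    have := indicatorConstLp_coeFn (p := 2) (hs := hE i) (hμs := (h i).trans_ne hm) (c := (c : ℂ))
    simpa [he, unitIndicator, Measure.real, h i, hc] using this
  have hg' (i) : g i =ᵐ[μ] (E' i).indicator fun _ => (c : ℂ) := by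
    have := indicatorConstLp_coeFn (p := 2) (hs := hE' i) (hμs := (h' i).trans_ne hm) (c := (c : ℂ))
    simpa [hg, unitIndicator, Measure.real, h' i, hc] using this
  have hk := hasKernel_matOp he' hg' T
  have hk2 := memLp_sum_mul_prod (μ := μ) (fun i => (memLp_congr_ae (he' i)).1 (Lp.memLp (e i)))
    (fun i => (memLp_congr_ae (hg' i)).1 (Lp.memLp (g i))) T
  have hmem : MemSchatten p (matOp e g T) := by
    unfold MemSchatten
    split_ifs
    · exact isCompactOperator_matOp e g T
    · exact hT
  obtain ⟨B, ⟨k', hk'2, hk', hB⟩, -, hBC⟩ := hφ _ _ hk2 hk hmem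
  refine ⟨B, fun i j => ?_, hBC⟩
  have huniq := HasKernel.ae_unique hk2 hk'2 hk hk'
  -- By disjointness only the (i, j) term of the kernel is nonzero on E i × E' j.
  have hval : ∀ x ∈ E i, ∀ y ∈ E' j, ∑ a, ∑ b, T a b * (((E a).indicator (fun _ => (c : ℂ)) x) *
      conj ((E' b).indicator (fun _ => (c : ℂ)) y)) = T i j * (c : ℂ) ^ 2 := by
    intro x hx y hy
    rw [Finset.sum_eq_single i, Finset.sum_eq_single j]
    · rw [Set.indicator_of_mem hx, Set.indicator_of_mem hy, Complex.conj_ofReal]; ring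
    · intro b _ hb
      rw [Set.indicator_of_notMem (s := E' b) ((hd' hb).notMem_of_mem_right hy)]; simp
    · simp
    · intro a _ ha
      rw [Set.indicator_of_notMem (s := E a) ((hd ha).notMem_of_mem_right hx)]; simp
    · simp
  have hcalc : ∀ᵐ x ∂μ, ⟪e i x, (B (g j) : X → ℂ) x⟫_ℂ =
      (E i).indicator (fun x => T i j * (c : ℂ) ^ 4 * ∫ y in E' j, φ x y ∂μ) x := by
    filter_upwards [he' i, hB (g j), huniq] with x h1 h2 h3
    rw [h1, h2]
    by_cases hx : x ∈ E i
    · rw [Set.indicator_of_mem hx, Set.indicator_of_mem hx, RCLike.inner_apply, Complex.conj_ofReal]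
      have : ∫ y, φ x y * k' (x, y) * (g j : X → ℂ) y ∂μ =
          ∫ y, (E' j).indicator (fun y => T i j * (c : ℂ) ^ 3 * φ x y) y ∂μ := by
        refine integral_congr_ae ?_
        filter_upwards [h3, hg' j] with y h4 h5
        rw [h5, ← h4]
        by_cases hy : y ∈ E' j
        · rw [Set.indicator_of_mem hy, Set.indicator_of_mem hy, hval x hx y hy]; ring
        · rw [Set.indicator_of_notMem hy, Set.indicator_of_notMem hy, mul_zero]
      rw [this, integral_indicator (hE' j), integral_const_mul]
      ring
    · rw [Set.indicator_of_notMem hx, Set.indicator_of_notMem hx]; simp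
  rw [L2.inner_def, integral_congr_ae hcalc, integral_indicator (hE i), integral_const_mul]
  have hc4' : (c : ℂ) ^ 4 = ((m.toReal : ℂ) ^ 2)⁻¹ := by exact_mod_cast congrArg Complex.ofReal hc4
  rw [hc4']
  push_cast
  ring

/-- The unitary identification of `H` with the Hilbert direct sum of one copy of `H`. -/
def piLpOneEquiv (H : Type*) [NormedAddCommGroup H] [InnerProductSpace ℂ H] :
    PiLp 2 (fun _ : Fin 1 => H) ≃ₗᵢ[ℂ] H where
  toLinearEquiv := (PiLp.equivOfUnique 2 ℂ (fun _ : Fin 1 => H)).toLinearEquiv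
  norm_map' x := by
    rw [PiLp.norm_eq_of_L2]
    simp

lemma entry_conj_piLpOneEquiv {H : Type*} [NormedAddCommGroup H] [InnerProductSpace ℂ H]
    [CompleteSpace H] (A : PiLp 2 (fun _ : Fin 1 => H) →L[ℂ] PiLp 2 (fun _ : Fin 1 => H)) (i j : Fin 1) :
    entry A i j = (piLpOneEquiv H).conjStarAlgEquiv A := by
  obtain rfl := Subsingleton.elim i 0
  obtain rfl := Subsingleton.elim j 0
  ext1 v
  have h : (Pi.single 0 v : Fin 1 → H) = (piLpOneEquiv H).symm v := by
    funext a
    obtain rfl := Subsingleton.elim a 0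
    rw [Pi.single_eq_same]
    rfl
  change A (WithLp.toLp 2 (Pi.single 0 v)) 0 = A ((piLpOneEquiv H).symm v) 0
  rw [h]

/-- This is the amplification of size 1, transported along `piLpOneEquiv`. -/
lemma CBMSNormLE.msNormLE {p : ℝ≥0∞} (hp : p ≠ 0) {φ : X → X → ℂ} {C : ℝ≥0}
    (h : CBMSNormLE p μ φ C) : MSNormLE p μ φ C := by
  intro A k hk hA hAp
  let U := piLpOneEquiv (Lp ℂ 2 μ)
  have hUA (i j) : entry (U.symm.conjStarAlgEquiv A) i j = A := by
    rw [entry_conj_piLpOneEquiv, ← LinearIsometryEquiv.symm_conjStarAlgEquiv]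
    exact U.conjStarAlgEquiv.apply_symm_apply A
  obtain ⟨B, hB, hBp, hBC⟩ := h 1 (U.symm.conjStarAlgEquiv A)
    (fun i j => ⟨k, hk, by rwa [hUA]⟩) (memSchatten_conj _ _ hp hAp)
  refine ⟨U.conjStarAlgEquiv B, ?_, memSchatten_conj _ _ hp hBp, ?_⟩
  · have := hB 0 0
    rwa [hUA, entry_conj_piLpOneEquiv] at this
  · rw [schattenNorm_conj _ _ hp]
    rwa [schattenNorm_conj _ _ hp] at hBC

end Kernel

/-- The number -ε is the exponent of |R| in the two multiplier estimates, and the hypothesis on p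
makes ε positive. For p = ∞ the convention x / 0 = 0 gives ε = n/2. -/
lemma exists_exponent {n : ℕ} (hn : 1 ≤ n) {p : ℝ≥0∞}
    (hp : (1 ≤ p ∧ p < ENNReal.ofReal (2 - 2 / ((n : ℝ) + 2))) ∨
      ENNReal.ofReal (2 + 2 / (n : ℝ)) < p) :
    ∃ ε : ℝ, 0 < ε ∧ (2 ≤ p ∧ ε = n / 2 - (n + 1) / p.toReal ∨
      1 ≤ p ∧ p ≤ 2 ∧ ε = (n + 1) / p.toReal - (n / 2 + 1)) := by
  have hn0 : (0 : ℝ) < n := by exact_mod_cast hn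
  rcases hp with ⟨h1, h2⟩ | h
  · refine ⟨_, ?_, Or.inr ⟨h1, ?_, rfl⟩⟩
    · have h3 := (ENNReal.lt_ofReal_iff_toReal_lt h2.ne_top).1 h2
      have h4 : 1 ≤ p.toReal := by
        have := ENNReal.toReal_mono h2.ne_top h1
        simpa using this
      rw [sub_pos, lt_div_iff₀ (by linarith)]
      have h5 : (2 - 2 / ((n : ℝ) + 2)) * (n + 2) = 2 * n + 2 := by field_simp; ring
      have h6 := mul_lt_mul_of_pos_right h3 (show (0 : ℝ) < n + 2 by positivity)
      rw [h5] at h6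
      linarith
    · refine h2.le.trans ?_
      rw [show (2 : ℝ≥0∞) = ENNReal.ofReal 2 by simp]
      refine ENNReal.ofReal_le_ofReal ?_
      have : (0 : ℝ) < 2 / ((n : ℝ) + 2) := by positivity
      linarith
  · have h2 : (2 : ℝ≥0∞) ≤ p := by
      refine le_trans ?_ h.le
      rw [show (2 : ℝ≥0∞) = ENNReal.ofReal 2 by simp]
      refine ENNReal.ofReal_le_ofReal ?_
      have : (0 : ℝ) < 2 / (n : ℝ) := by positivity
      linarith
    refine ⟨_, ?_, Or.inl ⟨h2, rfl⟩⟩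
    by_cases hp : p = ∞
    · rw [hp]; simpa using hn0
    · have h3 := (ENNReal.ofReal_lt_iff_lt_toReal (by positivity) hp).1 h
      have h4 : (2 + 2 / (n : ℝ)) * n = 2 * n + 2 := by field_simp
      have h5 := mul_lt_mul_of_pos_right h3 hn0
      have h6 : (0 : ℝ) < p.toReal := lt_trans (by positivity) h3
      rw [sub_pos, div_lt_iff₀ h6]
      linarith

/-! ### Averages over double cosets, and their variation along a Heisenberg family -/

section Average

variable {G : Type*} [Group G]

lemma disjoint_preimage_coset {K : Subgroup G} {a b : G} (h : a * b⁻¹ ∉ K) :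
    Disjoint ((fun u => a * u) ⁻¹' (K : Set G)) ((fun u => b * u) ⁻¹' (K : Set G)) := by
  rw [Set.disjoint_left]
  intro u ha hb
  refine h ?_
  have := K.mul_mem ha (K.inv_mem hb)
  simpa [mul_assoc] using this

variable [MeasurableSpace G]

/-- The average of a function over a double coset of a subgroup. -/
def doubleCosetAvg (μ : Measure G) (K : Subgroup G) (f : G → ℂ) (g : G) : ℂ :=
  ((μ K).toReal ^ 2)⁻¹ * ∫ u in (K : Set G), ∫ w in (K : Set G), f (u⁻¹ * g * w) ∂μ ∂μ

variable [MeasurableMul G] {μ : Measure G} [μ.IsMulLeftInvariant] {K : Subgroup G}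

lemma setIntegral_preimage_mul_left (F : G → ℂ) (a : G) (s : Set G) :
    ∫ u in (fun u => a * u) ⁻¹' s, F (a * u) ∂μ = ∫ x in s, F x ∂μ :=
  (measurePreserving_mul_left μ a).setIntegral_preimage_emb (measurableEmbedding_mulLeft a) F s

lemma setIntegral_preimage_coset (F : G → ℂ) (a : G) (s : Set G) :
    ∫ u in (fun u => a * u) ⁻¹' s, F u ∂μ = ∫ x in s, F (a⁻¹ * x) ∂μ := by
  rw [← setIntegral_preimage_mul_left (fun x => F (a⁻¹ * x)) a s]
  simp

lemma setIntegral_mul_left_of_mem (F : G → ℂ) {k : G} (hk : k ∈ K) :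
    ∫ u in (K : Set G), F (k * u) ∂μ = ∫ u in (K : Set G), F u ∂μ := by
  rw [← setIntegral_preimage_mul_left F k]
  congr 2
  ext u
  simp [K.mul_mem_cancel_left hk]

/-- The variable u enters through its inverse, so left invariance of μ gives invariance under K on
either side. -/
lemma doubleCosetAvg_mul_left (f : G → ℂ) (g : G) {k : G} (hk : k ∈ K) :
    doubleCosetAvg μ K f (k * g) = doubleCosetAvg μ K f g := by
  unfold doubleCosetAvg
  congr 1
  rw [← setIntegral_mul_left_of_mem (fun u => ∫ w in (K : Set G), f (u⁻¹ * (k * g) * w) ∂μ) hk]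
  simp [mul_assoc]

lemma doubleCosetAvg_mul_right (f : G → ℂ) (g : G) {k : G} (hk : k ∈ K) :
    doubleCosetAvg μ K f (g * k) = doubleCosetAvg μ K f g := by
  unfold doubleCosetAvg
  congr 2
  funext u
  rw [← setIntegral_mul_left_of_mem (fun w => f (u⁻¹ * g * w)) hk]
  simp [mul_assoc]

lemma measurableSet_preimage_coset (hK : MeasurableSet (K : Set G)) (a : G) :
    MeasurableSet ((fun u => a * u) ⁻¹' (K : Set G)) := measurable_const_mul a hK

open Matrix in
/-- The variation of the average of the symbol of a Schur multiplier along a family of double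
cosets parametrised by `z + w + x ⬝ y` in a finite ring. -/
lemma norm_sub_le_of_doubleCosetAvg [SFinite μ] [MeasurableSpace.CountablyGenerated G]
    (hK : MeasurableSet (K : Set G)) (hK0 : μ K ≠ 0) (hKt : μ K ≠ ∞)
    {R : Type*} [CommRing R] [Fintype R] {𝔞 : Ideal R} {n : ℕ}
    (h𝔞 : ∀ t ∈ 𝔞, ∀ d : R, d ≠ 0 → d ∣ t) (h𝔞2 : 2 ≤ Nat.card 𝔞)
    {ψ : R → ℂ} {ψ₁ : ℂ} (h1 : ∀ t ∈ 𝔞, t ≠ 0 → ψ t = ψ₁)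
    (h2 : ∀ s ∉ 𝔞, ∀ t ∈ 𝔞, ψ (s + t) = ψ s)
    {x y : (Fin n → R) × R → G} (hx : ∀ i j, x i * (x j)⁻¹ ∈ K → i = j)
    (hy : ∀ i j, (y i)⁻¹ * y j ∈ K → i = j) {f : G → ℂ} {ε : ℝ} {p : ℝ≥0∞}
    (hf : ∀ i j, doubleCosetAvg μ K f (x i * y j) = heisMatrix n ψ i j)
    (hp : 2 ≤ p ∧ ε = n / 2 - (n + 1) / p.toReal ∨
      1 ≤ p ∧ p ≤ 2 ∧ ε = (n + 1) / p.toReal - (n / 2 + 1))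
    {C : ℝ≥0} (hC : MSNormLE p μ (herzSchur f) C) :
    ‖ψ 0 - ψ₁‖ ≤ 2 * C * (Nat.card R : ℝ) ^ (-ε) := by
  have hE (i) : μ ((fun u => x i * u) ⁻¹' (K : Set G)) = μ K := measure_preimage_mul _ _ _
  have hE' (j) : μ ((fun u => (y j)⁻¹ * u) ⁻¹' (K : Set G)) = μ K := measure_preimage_mul _ _ _
  have hd : Pairwise fun i j =>
      Disjoint ((fun u => x i * u) ⁻¹' (K : Set G)) ((fun u => x j * u) ⁻¹' (K : Set G)) :=
    fun i j hij => disjoint_preimage_coset fun h => hij (hx i j h)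
  have hd' : Pairwise fun i j => Disjoint ((fun u => (y i)⁻¹ * u) ⁻¹' (K : Set G))
      ((fun u => (y j)⁻¹ * u) ⁻¹' (K : Set G)) :=
    fun i j hij => disjoint_preimage_coset fun h => hij (hy i j (by simpa using h))
  have hmain := fun T => hC.exists_matOp (fun i => measurableSet_preimage_coset hK (x i))
    (fun j => measurableSet_preimage_coset hK (y j)⁻¹) hd hd' hKt hE hE' T
  -- The cells are the left cosets (x i)⁻¹ K and y j K. For g = (x i)⁻¹ u and h = y j w one has g⁻¹
  -- h = u⁻¹ (x i) (y j) w, so the mean of the symbol over a cell is a double coset average.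
  have hval (i j) : (((μ K).toReal ^ 2)⁻¹ * ∫ g in (fun u => x i * u) ⁻¹' (K : Set G),
      ∫ h in (fun u => (y j)⁻¹ * u) ⁻¹' (K : Set G), herzSchur f g h ∂μ ∂μ) = heisMatrix n ψ i j := by
    rw [← hf, doubleCosetAvg]
    congr 1
    simp [setIntegral_preimage_coset, herzSchur, mul_assoc]
  simp only [hval] at hmain
  have he := orthonormal_unitIndicator (μ := μ) (fun i => measurableSet_preimage_coset hK (x i))
    (fun i => (hE i).trans_ne hKt) (fun i => (hE i).trans_ne hK0) hd
  have hg := orthonormal_unitIndicator (μ := μ) (fun j => measurableSet_preimage_coset hK (y j)⁻¹)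
    (fun i => (hE' i).trans_ne hKt) (fun i => (hE' i).trans_ne hK0) hd'
  rcases hp with ⟨hp, rfl⟩ | ⟨hp1, hp2, rfl⟩
  · rw [neg_sub]
    exact norm_sub_le_of_two_le h𝔞 h𝔞2 h1 he hg hp hmain
  · lift p to ℝ≥0 using ne_top_of_le_ne_top (by norm_num) hp2
    rw [neg_sub]
    exact norm_sub_le_of_le_two h𝔞 h𝔞2 h1 h2 he hg (by exact_mod_cast hp1) (by exact_mod_cast hp2)
      hmain

end Average

/-! ### Unipotent, diagonal and integral elements of the special linear group -/

section SpecialLinear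

open Matrix

variable {ι F : Type*} [Fintype ι] [DecidableEq ι] [Field F]

lemma det_one_add_vecMulVec {R : Type*} [CommRing R] {u v : ι → R} (h : v ⬝ᵥ u = 0) :
    (1 + vecMulVec u v).det = 1 := by
  rw [vecMulVec_eq Unit, det_one_add_mul_comm]
  rw [det_unique]
  simpa [mul_apply, dotProduct] using h

/-- The unipotent element `1 + u ⊗ v` of the special linear group, for `v ⬝ u = 0`. -/
def rankOneSL (u v : ι → F) (h : v ⬝ᵥ u = 0) : SpecialLinearGroup ι F :=
  ⟨1 + vecMulVec u v, det_one_add_vecMulVec h⟩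

/-- A diagonal element of the special linear group. -/
def diagSL (t : ι → Fˣ) (h : ∏ i, t i = 1) : SpecialLinearGroup ι F :=
  ⟨diagonal fun i => (t i : F), by
    rw [det_diagonal, ← Units.coe_prod, h, Units.val_one]⟩

lemma rankOneSL_apply (u v : ι → F) (h : v ⬝ᵥ u = 0) (i j : ι) :
    rankOneSL u v h i j = (1 : Matrix ι ι F) i j + u i * v j := rfl

lemma diagSL_apply (t : ι → Fˣ) (h : ∏ i, t i = 1) (i j : ι) :
    diagSL t h i j = diagonal (fun i => (t i : F)) i j := rfl

lemma SL_ext_mulVec {A B : SpecialLinearGroup ι F}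
    (h : ∀ w, (A : Matrix ι ι F) *ᵥ w = (B : Matrix ι ι F) *ᵥ w) : A = B :=
  Subtype.ext (Matrix.ext_of_mulVec_single fun _ => h _)

lemma SL_mul_mulVec (A B : SpecialLinearGroup ι F) (w : ι → F) :
    ((A * B : SpecialLinearGroup ι F) : Matrix ι ι F) *ᵥ w =
      (A : Matrix ι ι F) *ᵥ ((B : Matrix ι ι F) *ᵥ w) := by
  rw [mulVec_mulVec]; rfl

lemma rankOneSL_mulVec (u v : ι → F) (h : v ⬝ᵥ u = 0) (w : ι → F) :
    (rankOneSL u v h : Matrix ι ι F) *ᵥ w = w + (v ⬝ᵥ w) • u := by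
  simp [rankOneSL, add_mulVec, vecMulVec_mulVec]

lemma diagSL_mulVec (t : ι → Fˣ) (h : ∏ i, t i = 1) (w : ι → F) :
    (diagSL t h : Matrix ι ι F) *ᵥ w = fun i => t i * w i := by
  ext i; simp [diagSL, mulVec_diagonal]

lemma diagSL_mul_diagSL (t t' : ι → Fˣ) (h : ∏ i, t i = 1) (h' : ∏ i, t' i = 1) :
    diagSL t h * diagSL t' h' =
      diagSL (t * t') (by simp [Finset.prod_mul_distrib, h, h']) := by
  apply SL_ext_mulVec
  intro w
  simp only [SL_mul_mulVec, diagSL_mulVec]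
  simp [mul_assoc]

lemma diagSL_mul_rankOneSL (t : ι → Fˣ) (h : ∏ i, t i = 1) (u v : ι → F) (huv : v ⬝ᵥ u = 0) :
    diagSL t h * rankOneSL u v huv =
      rankOneSL (fun i => t i * u i) (fun i => ((t i)⁻¹ : Fˣ) * v i) (by
        rw [← huv]; exact Finset.sum_congr rfl fun i _ => by
          rw [mul_mul_mul_comm, Units.inv_mul, one_mul]) * diagSL t h := by
  apply SL_ext_mulVec
  intro w
  simp only [SL_mul_mulVec, rankOneSL_mulVec, diagSL_mulVec]
  ext i
  simp only [Pi.add_apply, Pi.smul_apply, smul_eq_mul]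
  have : (fun i => (((t i)⁻¹ : Fˣ) : F) * v i) ⬝ᵥ (fun i => t i * w i) = v ⬝ᵥ w :=
    Finset.sum_congr rfl fun i _ => by
      rw [mul_mul_mul_comm, Units.inv_mul, one_mul]
  rw [this]; ring

lemma rankOneSL_mul_right (u v v' : ι → F) (h : v ⬝ᵥ u = 0) (h' : v' ⬝ᵥ u = 0) :
    rankOneSL u v h * rankOneSL u v' h' = rankOneSL u (v + v') (by simp [add_dotProduct, h, h']) := by
  apply SL_ext_mulVec
  intro w
  simp only [SL_mul_mulVec, rankOneSL_mulVec, dotProduct_add,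
    dotProduct_smul, h, add_dotProduct, add_smul]
  simp
  abel

lemma rankOneSL_mul_left (u u' v : ι → F) (h : v ⬝ᵥ u = 0) (h' : v ⬝ᵥ u' = 0) :
    rankOneSL u v h * rankOneSL u' v h' = rankOneSL (u + u') v (by simp [dotProduct_add, h, h']) := by
  apply SL_ext_mulVec
  intro w
  simp only [SL_mul_mulVec, rankOneSL_mulVec, dotProduct_add,
    dotProduct_smul, h', smul_add]
  simp
  abel

lemma rankOneSL_inv_right (u v : ι → F) (h : v ⬝ᵥ u = 0) :
    (rankOneSL u v h)⁻¹ = rankOneSL u (-v) (by simp [h]) := by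
  rw [inv_eq_iff_mul_eq_one, rankOneSL_mul_right]
  ext i j
  simp [rankOneSL]

lemma rankOneSL_inv_left (u v : ι → F) (h : v ⬝ᵥ u = 0) :
    (rankOneSL u v h)⁻¹ = rankOneSL (-u) v (by simp [h]) := by
  rw [inv_eq_iff_mul_eq_one, rankOneSL_mul_left]
  ext i j
  simp [rankOneSL]

section Integral

variable {O : Type*} [CommRing O] [Algebra O F]

variable (ι O F) in
/-- The subgroup of integral matrices of the special linear group. -/
def integralSL : Subgroup (SpecialLinearGroup ι F) :=
  (SpecialLinearGroup.map (n := ι) (algebraMap O F)).range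

lemma mem_integralSL [FaithfulSMul O F] {g : SpecialLinearGroup ι F} :
    g ∈ integralSL ι F O ↔ ∀ i j, g i j ∈ (algebraMap O F).range := by
  constructor
  · rintro ⟨A, rfl⟩ i j
    exact ⟨A i j, rfl⟩
  · intro h
    choose A hA using h
    have hA' : (algebraMap O F).mapMatrix (of A) = g := by ext i j; exact hA i j
    refine ⟨⟨of A, ?_⟩, ?_⟩
    · apply FaithfulSMul.algebraMap_injective O F
      rw [RingHom.map_det, hA', g.2, map_one]
    · exact Subtype.ext hA'

lemma one_apply_mem_range (i j : ι) : (1 : Matrix ι ι F) i j ∈ (algebraMap O F).range := by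
  rw [one_apply]; split_ifs
  exacts [one_mem _, zero_mem _]

lemma rankOneSL_mem [FaithfulSMul O F] {u v : ι → F} {h : v ⬝ᵥ u = 0} :
    rankOneSL u v h ∈ integralSL ι F O ↔ ∀ i j, u i * v j ∈ (algebraMap O F).range := by
  rw [mem_integralSL]
  refine forall₂_congr fun i j => ?_
  rw [rankOneSL_apply]
  exact (algebraMap O F).range.add_mem_cancel_left (one_apply_mem_range i j)

lemma diagSL_mem [FaithfulSMul O F] {t : ι → Fˣ} {h : ∏ i, t i = 1}
    (ht : ∀ i, (t i : F) ∈ (algebraMap O F).range) : diagSL t h ∈ integralSL ι F O := by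
  rw [mem_integralSL]
  intro i j
  rw [diagSL_apply, diagonal_apply]
  split
  exacts [ht i, zero_mem _]

end Integral

end SpecialLinear

/-! ### Double cosets of a Heisenberg family -/

section Heisenberg

open Matrix

/-- In D A(x, z) B(y, w) D' the commutation relation moves B(y, 0) to the left and A(x, 0) to the
right, where conjugation by D and D' puts them in K. What remains is D A(0, z + w + x ⬝ y) D', which
matters only modulo I. The hypotheses `hAI` and `hBI` keep the cosets of distinct parameters modulo
I apart. -/
lemma exists_heisenberg_family {G : Type*} [Group G] {K : Subgroup G} {Φ : G → ℂ}
    (hl : ∀ g, ∀ k ∈ K, Φ (k * g) = Φ g) (hr : ∀ g, ∀ k ∈ K, Φ (g * k) = Φ g)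
    {O : Type*} [CommRing O] {I : Ideal O} {n : ℕ} {A B : (Fin n → O) → O → G} {D D' : G}
    (hA : ∀ x z x' z', A x z * (A x' z')⁻¹ = A (x - x') (z - z'))
    (hB : ∀ y w y' w', (B y w)⁻¹ * B y' w' = B (y' - y) (w' - w))
    (hAB : ∀ x z y w, A x z * B y w = B y 0 * A 0 (z + w + x ⬝ᵥ y) * A x 0)
    (hBK : ∀ y, D * B y 0 * D⁻¹ ∈ K) (hAK : ∀ x, D'⁻¹ * A x 0 * D' ∈ K)
    (hAI : ∀ x z, D * A x z * D⁻¹ ∈ K → (∀ k, x k ∈ I) ∧ z ∈ I)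
    (hBI : ∀ y w, D'⁻¹ * B y w * D' ∈ K → (∀ k, y k ∈ I) ∧ w ∈ I)
    (hI : ∀ c ∈ I, D * A 0 c * D⁻¹ ∈ K) :
    ∃ ψ : O ⧸ I → ℂ, (∀ s, ψ (Ideal.Quotient.mk I s) = Φ (D * A 0 s * D')) ∧
      ∃ x y : (Fin n → O ⧸ I) × (O ⧸ I) → G, (∀ i j, x i * (x j)⁻¹ ∈ K → i = j) ∧
        (∀ i j, (y i)⁻¹ * y j ∈ K → i = j) ∧ ∀ i j, Φ (x i * y j) = heisMatrix n ψ i j := by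
  have hwd (s s' : O) (h : s - s' ∈ I) : Φ (D * A 0 s * D') = Φ (D * A 0 s' * D') := by
    rw [← hl (D * A 0 s' * D') _ (hI _ h)]
    have := hA 0 s 0 s'
    rw [sub_zero] at this
    rw [← this]
    simp [mul_assoc]
  have hmk : Function.Surjective (Ideal.Quotient.mk I) := Ideal.Quotient.mk_surjective
  obtain ⟨out, hout'⟩ := hmk.hasRightInverse
  have hout (s : O ⧸ I) : Ideal.Quotient.mk I (out s) = s := hout' s
  have hψ (s : O) : Φ (D * A 0 (out (Ideal.Quotient.mk I s)) * D') = Φ (D * A 0 s * D') :=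
    hwd _ _ (by rw [← Ideal.Quotient.eq, hout])
  have key {i j : (Fin n → O ⧸ I) × (O ⧸ I)}
      (h : (∀ k, (fun k => out (i.1 k)) k - out (j.1 k) ∈ I) ∧ out i.2 - out j.2 ∈ I) : i = j := by
    refine Prod.ext (funext fun k => ?_) ?_
    · rw [← hout (i.1 k), ← hout (j.1 k)]
      exact Ideal.Quotient.eq.2 (h.1 k)
    · rw [← hout i.2, ← hout j.2]
      exact Ideal.Quotient.eq.2 h.2
  refine ⟨fun s => Φ (D * A 0 (out s) * D'), hψ,
    fun i => D * A (fun k => out (i.1 k)) (out i.2),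
    fun j => B (fun k => out (j.1 k)) (out j.2) * D', fun i j h => ?_, fun i j h => ?_,
    fun i j => ?_⟩
  · refine key (hAI _ _ ?_)
    rw [← Pi.sub_def, ← hA]
    simpa [mul_assoc] using h
  · refine (key (hBI _ _ ?_)).symm
    rw [← Pi.sub_def, ← hB]
    simpa [mul_assoc] using h
  · set x : Fin n → O := fun k => out (i.1 k)
    set y : Fin n → O := fun k => out (j.1 k)
    have h1 : D * A x (out i.2) * (B y (out j.2) * D') =
        (D * B y 0 * D⁻¹) * (D * A 0 (out i.2 + out j.2 + x ⬝ᵥ y) * D') * (D'⁻¹ * A x 0 * D') := by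
      rw [show D * A x (out i.2) * (B y (out j.2) * D') =
        D * (A x (out i.2) * B y (out j.2)) * D' by group, hAB]
      group
    rw [h1, hr _ _ (hAK x), hl _ _ (hBK y), ← hψ]
    simp only [heisMatrix, of_apply]
    congr 5
    simp [map_add, dotProduct, hout, x, y]

end Heisenberg

/-! ### The rings O/ϖ^(k+1) and unit-invariant functions on them -/

section DVR

variable {O : Type*} [CommRing O] [IsDomain O] [IsDiscreteValuationRing O] {ϖ : O}

/-- A nonzero class is represented by a unit times ϖ^j with j ≤ k, so it divides ϖ^k. -/
lemma quotient_pow_dvd (hϖ : Irreducible ϖ) {k : ℕ} {t d : O ⧸ Ideal.span {ϖ ^ (k + 1)}}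
    (ht : t ∈ Ideal.span {Ideal.Quotient.mk (Ideal.span {ϖ ^ (k + 1)}) (ϖ ^ k)}) (hd : d ≠ 0) :
    d ∣ t := by
  obtain ⟨d, rfl⟩ := Ideal.Quotient.mk_surjective d
  refine dvd_trans ?_ (Ideal.mem_span_singleton.1 ht)
  have hd0 : d ≠ 0 := by rintro rfl; simp at hd
  obtain ⟨j, u, rfl⟩ := IsDiscreteValuationRing.eq_unit_mul_pow_irreducible hd0 hϖ
  have hj : j ≤ k := by
    by_contra! hj
    refine hd (Ideal.Quotient.eq_zero_iff_mem.2 (Ideal.mem_span_singleton.2 ?_))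
    exact (pow_dvd_pow _ hj).mul_left _
  refine map_dvd _ ?_
  rw [Units.mul_left_dvd]
  exact pow_dvd_pow _ hj

/-- A multiple c ϖ^k is zero modulo ϖ^(k+1) unless c is a unit. -/
lemma eq_of_unit_invariant (hϖ : Irreducible ϖ) {k : ℕ}
    {ψ : O ⧸ Ideal.span {ϖ ^ (k + 1)} → ℂ}
    (hu : ∀ (u : Oˣ) s, ψ (Ideal.Quotient.mk _ (u * s)) = ψ (Ideal.Quotient.mk _ s))
    {t : O ⧸ Ideal.span {ϖ ^ (k + 1)}}
    (ht : t ∈ Ideal.span {Ideal.Quotient.mk (Ideal.span {ϖ ^ (k + 1)}) (ϖ ^ k)}) (ht0 : t ≠ 0) :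
    ψ t = ψ (Ideal.Quotient.mk _ (ϖ ^ k)) := by
  obtain ⟨c, rfl⟩ := Ideal.mem_span_singleton.1 ht
  obtain ⟨c, rfl⟩ := Ideal.Quotient.mk_surjective c
  rw [← map_mul, mul_comm] at ht0 ⊢
  by_cases hc : IsUnit c
  · obtain ⟨u, rfl⟩ := hc
    exact hu _ _
  · refine absurd (Ideal.Quotient.eq_zero_iff_mem.2 (Ideal.mem_span_singleton.2 ?_)) ht0
    rw [pow_succ']
    refine mul_dvd_mul_right ?_ _
    rw [← Ideal.mem_span_singleton, ← hϖ.maximalIdeal_eq]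
    exact hc

/-- For s = u ϖ^j with j < k, the sum s + c ϖ^k is ϖ^j (u + c ϖ^(k-j)), again a unit times ϖ^j. -/
lemma add_eq_of_unit_invariant (hϖ : Irreducible ϖ) {k : ℕ}
    {ψ : O ⧸ Ideal.span {ϖ ^ (k + 1)} → ℂ}
    (hu : ∀ (u : Oˣ) s, ψ (Ideal.Quotient.mk _ (u * s)) = ψ (Ideal.Quotient.mk _ s))
    {s t : O ⧸ Ideal.span {ϖ ^ (k + 1)}}
    (hs : s ∉ Ideal.span {Ideal.Quotient.mk (Ideal.span {ϖ ^ (k + 1)}) (ϖ ^ k)})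
    (ht : t ∈ Ideal.span {Ideal.Quotient.mk (Ideal.span {ϖ ^ (k + 1)}) (ϖ ^ k)}) :
    ψ (s + t) = ψ s := by
  obtain ⟨c, rfl⟩ := Ideal.mem_span_singleton.1 ht
  obtain ⟨c, rfl⟩ := Ideal.Quotient.mk_surjective c
  obtain ⟨s, rfl⟩ := Ideal.Quotient.mk_surjective s
  have hs0 : s ≠ 0 := by rintro rfl; simp at hs
  obtain ⟨j, u, rfl⟩ := IsDiscreteValuationRing.eq_unit_mul_pow_irreducible hs0 hϖ
  have hj : j < k := by
    by_contra! hj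
    exact hs (Ideal.mem_span_singleton.2 (map_dvd _ ((pow_dvd_pow _ hj).mul_left _)))
  obtain ⟨i, rfl⟩ := Nat.exists_eq_add_of_lt hj
  have hu' : IsUnit ((u : O) + ϖ ^ (i + 1) * c) := by
    by_contra h
    rw [← mem_nonunits_iff, ← IsLocalRing.mem_maximalIdeal, hϖ.maximalIdeal_eq,
      Ideal.mem_span_singleton] at h
    have h2 : ϖ ∣ (u : O) :=
      (dvd_add_left ((dvd_pow_self ϖ (Nat.succ_ne_zero i)).mul_right c)).1 h
    exact hϖ.not_isUnit (isUnit_of_dvd_unit h2 u.isUnit)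
  obtain ⟨v, hv⟩ := hu'
  rw [← map_mul, ← map_add, hu u, ← hu v (ϖ ^ j), hv]
  congr 2
  ring

lemma card_quotient_pow (hϖ : Irreducible ϖ) (k : ℕ) :
    Nat.card (O ⧸ Ideal.span {ϖ ^ k}) = Nat.card (O ⧸ Ideal.span {ϖ}) ^ k := by
  rw [← Ideal.span_singleton_pow]
  have := (Ideal.span_singleton_prime hϖ.ne_zero).2 hϖ.prime
  exact cardQuot_pow_of_prime (P := Ideal.span {ϖ}) (by simpa using hϖ.ne_zero)

end DVR

/-! ### The averaged symbol on a Heisenberg family over a discrete valuation ring -/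

section Average

open Matrix

variable {G : Type*} [Group G] [MeasurableSpace G] [MeasurableMul G] {μ : Measure G}
  [μ.IsMulLeftInvariant] {K : Subgroup G} [SFinite μ] [MeasurableSpace.CountablyGenerated G]

/-- The finite estimate is used for R = O/ϖ^(k+1) and its ideal (ϖ^k). Conjugation by the elements T
of K makes ψ unit-invariant, hence constant on the nonzero part of the ideal and periodic outside
it. -/
lemma norm_sub_le_of_heisenberg
    (hK : MeasurableSet (K : Set G)) (hK0 : μ K ≠ 0) (hKt : μ K ≠ ∞)
    {O : Type*} [CommRing O] [IsDomain O] [IsDiscreteValuationRing O] {ϖ : O} (hϖ : Irreducible ϖ)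
    [Finite (O ⧸ Ideal.span {ϖ})] {k n : ℕ} {A B : (Fin n → O) → O → G} {D D' : G}
    (hA : ∀ x z x' z', A x z * (A x' z')⁻¹ = A (x - x') (z - z'))
    (hB : ∀ y w y' w', (B y w)⁻¹ * B y' w' = B (y' - y) (w' - w))
    (hAB : ∀ x z y w, A x z * B y w = B y 0 * A 0 (z + w + x ⬝ᵥ y) * A x 0)
    (hBK : ∀ y, D * B y 0 * D⁻¹ ∈ K) (hAK : ∀ x, D'⁻¹ * A x 0 * D' ∈ K)
    (hAI : ∀ x z, D * A x z * D⁻¹ ∈ K → (∀ i, ϖ ^ (k + 1) ∣ x i) ∧ ϖ ^ (k + 1) ∣ z)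
    (hBI : ∀ y w, D'⁻¹ * B y w * D' ∈ K → (∀ i, ϖ ^ (k + 1) ∣ y i) ∧ ϖ ^ (k + 1) ∣ w)
    (hI : ∀ c, ϖ ^ (k + 1) ∣ c → D * A 0 c * D⁻¹ ∈ K)
    (hu : ∀ (u : Oˣ) (s : O), ∃ T ∈ K, T * (D * A 0 s * D') * T⁻¹ = D * A 0 (u * s) * D')
    {f : G → ℂ} {ε : ℝ} {p : ℝ≥0∞}
    (hp : 2 ≤ p ∧ ε = n / 2 - (n + 1) / p.toReal ∨
      1 ≤ p ∧ p ≤ 2 ∧ ε = (n + 1) / p.toReal - (n / 2 + 1))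
    {C : ℝ≥0} (hC : MSNormLE p μ (herzSchur f) C) :
    ‖doubleCosetAvg μ K f (D * D') - doubleCosetAvg μ K f (D * A 0 (ϖ ^ k) * D')‖ ≤
      2 * C * ((Nat.card (O ⧸ Ideal.span {ϖ}) : ℝ) ^ (k + 1)) ^ (-ε) := by
  simp only [← Ideal.mem_span_singleton (y := ϖ ^ (k + 1))] at hAI hBI hI
  obtain ⟨ψ, hψ, x, y, hx, hy, hxy⟩ := exists_heisenberg_family
    (fun g k hk => doubleCosetAvg_mul_left (μ := μ) (K := K) f g hk)
    (fun g k hk => doubleCosetAvg_mul_right f g hk) hA hB hAB hBK hAK hAI hBI hI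
  have hψu (u : Oˣ) (s : O) : ψ (Ideal.Quotient.mk _ (u * s)) = ψ (Ideal.Quotient.mk _ s) := by
    obtain ⟨T, hT, h⟩ := hu u s
    rw [hψ, hψ, ← h, doubleCosetAvg_mul_right _ _ (K.inv_mem hT), doubleCosetAvg_mul_left _ _ hT]
  have hcard := card_quotient_pow hϖ (k + 1)
  have hq : Nat.card (O ⧸ Ideal.span {ϖ}) ≠ 0 := Nat.card_pos.ne'
  have hfin : Finite (O ⧸ Ideal.span {ϖ ^ (k + 1)}) :=
    Nat.finite_of_card_ne_zero (by rw [hcard]; exact pow_ne_zero _ hq)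
  have := Fintype.ofFinite (O ⧸ Ideal.span {ϖ ^ (k + 1)})
  have hA0 : A 0 0 = 1 := by simpa using (hA 0 0 0 0).symm
  have h2 : 2 ≤ Nat.card (Ideal.span {Ideal.Quotient.mk (Ideal.span {ϖ ^ (k + 1)}) (ϖ ^ k)}) := by
    refine Finite.one_lt_card_iff_nontrivial.2 ⟨⟨0, ⟨_, Ideal.mem_span_singleton_self _⟩, ?_⟩⟩
    intro h
    have h3 := Ideal.mem_span_singleton.1
      (Ideal.Quotient.eq_zero_iff_mem.1 (congrArg Subtype.val h).symm)
    rw [pow_dvd_pow_iff hϖ.ne_zero hϖ.not_isUnit] at h3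
    omega
  have h := norm_sub_le_of_doubleCosetAvg hK hK0 hKt (fun t ht d hd => quotient_pow_dvd hϖ ht hd) h2
    (fun t ht ht0 => eq_of_unit_invariant hϖ hψu ht ht0)
    (fun s hs t ht => add_eq_of_unit_invariant hϖ hψu hs ht) hx hy hxy hp hC
  rw [hψ, ← map_zero (Ideal.Quotient.mk _), hψ, hA0, mul_one, hcard] at h
  exact_mod_cast h

end Average

/-! ### Heisenberg groups inside the special linear group -/

section Slots

open Matrix

/-- Two distinct indices and a list of `n` further indices: the positions of a Heisenberg group
inside a matrix group. -/
structure HeisenbergIndex (n : ℕ) (ι : Type*) where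
  p : ι
  q : ι
  j : Fin n → ι
  p_ne_q : p ≠ q
  j_injective : Function.Injective j
  j_ne_p : ∀ k, j k ≠ p
  j_ne_q : ∀ k, j k ≠ q

namespace HeisenbergIndex

variable {n : ℕ} {ι : Type*} [DecidableEq ι] (s : HeisenbergIndex n ι)

section Vector

variable {F O : Type*} [Field F] [CommRing O] [Algebra O F]

variable (F) in
/-- The extension by zero of a vector. -/
def ext (x : Fin n → O) : ι → F := Function.extend s.j (fun k => algebraMap O F (x k)) 0

@[simp] lemma ext_j (x : Fin n → O) (k : Fin n) : s.ext F x (s.j k) = algebraMap O F (x k) :=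
  s.j_injective.extend_apply _ _ _

lemma ext_of_ne (x : Fin n → O) {i : ι} (hi : ∀ k, s.j k ≠ i) : s.ext F x i = 0 :=
  Function.extend_apply' _ _ _ fun ⟨k, hk⟩ => hi k hk

@[simp] lemma ext_p (x : Fin n → O) : s.ext F x s.p = 0 := s.ext_of_ne x s.j_ne_p

@[simp] lemma ext_q (x : Fin n → O) : s.ext F x s.q = 0 := s.ext_of_ne x s.j_ne_q

lemma ext_add (x y : Fin n → O) : s.ext F (x + y) = s.ext F x + s.ext F y := by
  ext i
  by_cases hi : ∃ k, s.j k = i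
  · obtain ⟨k, rfl⟩ := hi
    simp
  · push Not at hi
    simp [s.ext_of_ne _ hi]

lemma ext_neg (x : Fin n → O) : s.ext F (-x) = -s.ext F x := by
  ext i
  by_cases hi : ∃ k, s.j k = i
  · obtain ⟨k, rfl⟩ := hi
    simp
  · push Not at hi
    simp [s.ext_of_ne _ hi]

lemma ext_sub (x y : Fin n → O) : s.ext F (x - y) = s.ext F x - s.ext F y := by
  rw [sub_eq_add_neg, ext_add, ext_neg, sub_eq_add_neg]

@[simp] lemma ext_zero : s.ext F (0 : Fin n → O) = 0 := by
  simpa using s.ext_sub (F := F) (0 : Fin n → O) 0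

variable [Fintype ι]

lemma ext_dotProduct (x y : Fin n → O) : s.ext F x ⬝ᵥ s.ext F y = algebraMap O F (x ⬝ᵥ y) := by
  simp only [dotProduct, map_sum, map_mul]
  symm
  refine Finset.sum_of_injOn s.j s.j_injective.injOn (by simp) (fun i _ hi => ?_) (by simp)
  rw [s.ext_of_ne x fun k hk => hi ⟨k, by simp, hk⟩, zero_mul]

/-- The unipotent elements supported on one row. -/
def rowSL (x : Fin n → O) (z : O) : SpecialLinearGroup ι F :=
  rankOneSL (Pi.single s.p 1) (s.ext F x + Pi.single s.q (algebraMap O F z))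
    (by simp [s.p_ne_q])

/-- The unipotent elements supported on one column. -/
def colSL (y : Fin n → O) (w : O) : SpecialLinearGroup ι F :=
  rankOneSL (s.ext F y + Pi.single s.p (algebraMap O F w)) (Pi.single s.q 1)
    (by simp [s.p_ne_q.symm])

/-- The two families share their centre, the elementary matrices at position (p, q). -/
lemma rowSL_zero_left (z : O) : s.rowSL (F := F) 0 z = s.colSL 0 z := by
  apply SL_ext_mulVec
  intro w
  simp only [rowSL, colSL, rankOneSL_mulVec]
  ext i
  by_cases hi : i = s.p
  · subst hi; simp [mul_comm]
  · simp [hi]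

lemma rowSL_mul_inv (x : Fin n → O) (z : O) (x' : Fin n → O) (z' : O) :
    s.rowSL (F := F) x z * (s.rowSL x' z')⁻¹ = s.rowSL (x - x') (z - z') := by
  simp only [rowSL, rankOneSL_inv_right, rankOneSL_mul_right]
  congr 1
  rw [ext_sub, map_sub, Pi.single_sub]
  abel

lemma rowSL_inv_mul (x : Fin n → O) (z : O) (x' : Fin n → O) (z' : O) :
    (s.rowSL (F := F) x z)⁻¹ * s.rowSL x' z' = s.rowSL (x' - x) (z' - z) := by
  simp only [rowSL, rankOneSL_inv_right, rankOneSL_mul_right]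
  congr 1
  rw [ext_sub, map_sub, Pi.single_sub]
  abel

lemma colSL_mul_inv (x : Fin n → O) (z : O) (x' : Fin n → O) (z' : O) :
    s.colSL (F := F) x z * (s.colSL x' z')⁻¹ = s.colSL (x - x') (z - z') := by
  simp only [colSL, rankOneSL_inv_left, rankOneSL_mul_left]
  congr 1
  rw [ext_sub, map_sub, Pi.single_sub]
  abel

lemma colSL_inv_mul (x : Fin n → O) (z : O) (x' : Fin n → O) (z' : O) :
    (s.colSL (F := F) x z)⁻¹ * s.colSL x' z' = s.colSL (x' - x) (z' - z) := by
  simp only [colSL, rankOneSL_inv_left, rankOneSL_mul_left]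
  congr 1
  rw [ext_sub, map_sub, Pi.single_sub]
  abel

lemma rowSL_mul_colSL (x : Fin n → O) (z : O) (y : Fin n → O) (w : O) :
    s.rowSL (F := F) x z * s.colSL y w =
      s.colSL y 0 * s.rowSL 0 (z + w + x ⬝ᵥ y) * s.rowSL x 0 := by
  apply SL_ext_mulVec
  intro v
  simp only [rowSL, colSL, SL_mul_mulVec, rankOneSL_mulVec]
  simp only [dotProduct_add, dotProduct_smul, add_dotProduct, ext_dotProduct, map_add, map_zero,
    ext_zero, single_dotProduct, dotProduct_single, Pi.single_zero, Pi.single_eq_same, ext_p, ext_q,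
    Pi.single_eq_of_ne s.p_ne_q, Pi.single_eq_of_ne s.p_ne_q.symm, Pi.add_apply, smul_eq_mul,
    add_zero, zero_add, mul_zero, zero_mul, one_mul, mul_one, Pi.smul_apply, Pi.zero_apply]
  ext i
  by_cases hi : i = s.p
  · subst hi
    simp
    ring
  · simp [hi]
    try ring

/-- With rows and columns exchanged the commutator changes sign; replacing x by -x restores + x ⬝ y.
-/
lemma colSL_mul_rowSL (x : Fin n → O) (z : O) (y : Fin n → O) (w : O) :
    s.colSL (F := F) (-x) z * s.rowSL y w =
      s.rowSL y 0 * s.colSL 0 (z + w + x ⬝ᵥ y) * s.colSL (-x) 0 := by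
  have h : s.ext F y ⬝ᵥ s.ext F x = algebraMap O F (x ⬝ᵥ y) := by rw [ext_dotProduct, dotProduct_comm]
  apply SL_ext_mulVec
  intro v
  simp only [rowSL, colSL, SL_mul_mulVec, rankOneSL_mulVec]
  simp only [dotProduct_add, dotProduct_smul, add_dotProduct, h, map_add, map_zero,
    ext_zero, single_dotProduct, dotProduct_single, Pi.single_zero, Pi.single_eq_same, ext_p, ext_q,
    Pi.single_eq_of_ne s.p_ne_q, Pi.single_eq_of_ne s.p_ne_q.symm, Pi.add_apply, smul_eq_mul,
    add_zero, zero_add, mul_zero, zero_mul, one_mul, mul_one, Pi.smul_apply, Pi.zero_apply, ext_neg,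
    dotProduct_neg, Pi.neg_apply]
  ext i
  by_cases hi : i = s.p
  · subst hi
    simp
    ring
  · simp [hi]
    try ring

end Vector

end HeisenbergIndex

end Slots

/-! ### Powers of a uniformiser: conjugation and double cosets -/

section ZPow

open Matrix hiding zpow_add zpow_sub zpow_neg_one

variable {ι F : Type*} [Fintype ι] [DecidableEq ι] [Field F]

lemma prod_zpow_eq_one (π : Fˣ) {a : ι → ℤ} (ha : ∑ i, a i = 0) : ∏ i, π ^ a i = 1 := by
  have : ∏ i, π ^ a i = π ^ ∑ i, a i := by
    induction (Finset.univ : Finset ι) using Finset.induction_on with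
    | empty => simp
    | insert i s hi ih => rw [Finset.prod_insert hi, Finset.sum_insert hi, ih, zpow_add]
  rw [this, ha, zpow_zero]

/-- The diagonal element with entries the powers of `π` with given exponents. -/
def zpowSL (π : Fˣ) (a : ι → ℤ) (ha : ∑ i, a i = 0) : SpecialLinearGroup ι F :=
  diagSL (fun i => π ^ a i) (prod_zpow_eq_one π ha)

lemma zpowSL_mul (π : Fˣ) (a b : ι → ℤ) (ha : ∑ i, a i = 0) (hb : ∑ i, b i = 0) :
    zpowSL π a ha * zpowSL π b hb =
      zpowSL π (a + b) (by simp [Finset.sum_add_distrib, ha, hb]) := by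
  rw [zpowSL, zpowSL, diagSL_mul_diagSL, zpowSL]
  congr 1
  funext i
  simp [zpow_add]

lemma zpowSL_inv (π : Fˣ) (a : ι → ℤ) (ha : ∑ i, a i = 0) :
    (zpowSL π a ha)⁻¹ = zpowSL π (-a) (by simp [ha]) := by
  rw [inv_eq_iff_mul_eq_one, zpowSL_mul]
  ext i j
  simp [zpowSL, diagSL]

lemma zpowSL_apply (π : Fˣ) (a : ι → ℤ) (ha : ∑ i, a i = 0) (i j : ι) :
    zpowSL π a ha i j = if i = j then ((π ^ a i : Fˣ) : F) else 0 := by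
  rw [zpowSL, diagSL_apply, diagonal_apply]

section Integral

variable {O : Type*} [CommRing O] [Algebra O F]

lemma zpow_mul_mem {π : Fˣ} {ϖ : O} (hπ : (π : F) = algebraMap O F ϖ) {e : ℤ} (he : 0 ≤ e) (x : O) :
    ((π ^ e : Fˣ) : F) * algebraMap O F x ∈ (algebraMap O F).range := by
  lift e to ℕ using he
  rw [zpow_natCast, Units.val_pow_eq_pow_val, hπ, ← map_pow, ← map_mul]
  exact ⟨_, rfl⟩

lemma pow_dvd_of_zpow_mul_mem [FaithfulSMul O F] {π : Fˣ} {ϖ : O} (hπ : (π : F) = algebraMap O F ϖ)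
    {e : ℤ} {m : ℕ} (he : e ≤ -m) {x : O}
    (h : ((π ^ e : Fˣ) : F) * algebraMap O F x ∈ (algebraMap O F).range) : ϖ ^ m ∣ x := by
  obtain ⟨c, hc⟩ := h
  obtain ⟨d, hd⟩ : ∃ d : ℕ, -e = d := ⟨(-e).toNat, by omega⟩
  refine (pow_dvd_pow ϖ (by omega : m ≤ d)).trans ⟨c, ?_⟩
  apply FaithfulSMul.algebraMap_injective O F
  rw [map_mul, map_pow, ← hπ, hc, ← Units.val_pow_eq_pow_val, ← zpow_natCast, ← hd, ← mul_assoc,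
    ← Units.val_mul, ← zpow_add, neg_add_cancel, zpow_zero, Units.val_one, one_mul]

namespace HeisenbergIndex

variable {n : ℕ} (s : HeisenbergIndex n ι) [FaithfulSMul O F] (π : Fˣ)

/-- Conjugation by π^a multiplies the entry at (i, j) by π^(a i - a j). -/
lemma zpowSL_conj_rowSL_mem {a : ι → ℤ} (ha : ∑ i, a i = 0) (x : Fin n → O) (z : O) :
    zpowSL π a ha * s.rowSL x z * (zpowSL π a ha)⁻¹ ∈ integralSL ι F O ↔
      (∀ k, ((π ^ (a s.p - a (s.j k)) : Fˣ) : F) * algebraMap O F (x k) ∈ (algebraMap O F).range) ∧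
        ((π ^ (a s.p - a s.q) : Fˣ) : F) * algebraMap O F z ∈ (algebraMap O F).range := by
  rw [zpowSL, rowSL, diagSL_mul_rankOneSL, mul_inv_cancel_right, rankOneSL_mem]
  constructor
  · intro h
    refine ⟨fun k => ?_, ?_⟩
    · have := h s.p (s.j k)
      simpa [s.j_ne_q k, zpow_sub₀ π.ne_zero, div_eq_mul_inv, mul_assoc] using this
    · have := h s.p s.q
      simpa [zpow_sub₀ π.ne_zero, div_eq_mul_inv, mul_assoc] using this
  · rintro ⟨h1, h2⟩ i i'
    by_cases hi : i = s.p
    · subst hi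
      by_cases hq : i' = s.q
      · subst hq
        simpa [zpow_sub₀ π.ne_zero, div_eq_mul_inv, mul_assoc] using h2
      by_cases hj : ∃ k, s.j k = i'
      · obtain ⟨k, rfl⟩ := hj
        simpa [s.j_ne_q k, zpow_sub₀ π.ne_zero, div_eq_mul_inv, mul_assoc] using h1 k
      · push Not at hj
        simp [s.ext_of_ne _ hj, hq, zero_mem]
    · simp [hi, zero_mem]

lemma zpowSL_conj_colSL_mem {a : ι → ℤ} (ha : ∑ i, a i = 0) (x : Fin n → O) (z : O) :
    zpowSL π a ha * s.colSL x z * (zpowSL π a ha)⁻¹ ∈ integralSL ι F O ↔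
      (∀ k, ((π ^ (a (s.j k) - a s.q) : Fˣ) : F) * algebraMap O F (x k) ∈ (algebraMap O F).range) ∧
        ((π ^ (a s.p - a s.q) : Fˣ) : F) * algebraMap O F z ∈ (algebraMap O F).range := by
  rw [zpowSL, colSL, diagSL_mul_rankOneSL, mul_inv_cancel_right, rankOneSL_mem]
  constructor
  · intro h
    refine ⟨fun k => ?_, ?_⟩
    · have := h (s.j k) s.q
      simpa [s.j_ne_p k, zpow_sub₀ π.ne_zero, div_eq_mul_inv, mul_assoc, mul_comm, mul_left_comm] using this
    · have := h s.p s.q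
      simpa [zpow_sub₀ π.ne_zero, div_eq_mul_inv, mul_assoc, mul_comm, mul_left_comm] using this
  · rintro ⟨h1, h2⟩ i i'
    by_cases hi : i' = s.q
    · subst hi
      by_cases hq : i = s.p
      · subst hq
        simpa [zpow_sub₀ π.ne_zero, div_eq_mul_inv, mul_assoc, mul_comm, mul_left_comm] using h2
      by_cases hj : ∃ k, s.j k = i
      · obtain ⟨k, rfl⟩ := hj
        simpa [s.j_ne_p k, zpow_sub₀ π.ne_zero, div_eq_mul_inv, mul_assoc, mul_comm, mul_left_comm] using h1 k
      · push Not at hj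
        simp [s.ext_of_ne _ hj, hq, zero_mem]
    · simp [hi, zero_mem]

/-- T is diagonal with u at p and its inverse at j 0, so it commutes with powers of π and multiplies
the (p, q) entry by u. The compensating entry sits outside q, where it would produce u²; this uses n
≥ 1. -/
lemma exists_conj_eq_unit_mul [NeZero n] {a b : ι → ℤ} (ha : ∑ i, a i = 0)
    (hb : ∑ i, b i = 0) (u : Oˣ) (z : O) : ∃ T ∈ integralSL ι F O,
      T * (zpowSL π a ha * s.rowSL 0 z * zpowSL π b hb) * T⁻¹ =
        zpowSL π a ha * s.rowSL 0 (u * z) * zpowSL π b hb := by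
  set v : Fˣ := Units.map (algebraMap O F : O →* F) u
  let t : ι → Fˣ := Pi.mulSingle s.p v * Pi.mulSingle (s.j 0) v⁻¹
  have ht : ∏ i, t i = 1 := by simp [t, Finset.prod_mul_distrib]
  have htp : t s.p = v := by simp [t, (s.j_ne_p 0).symm]
  have htq : t s.q = 1 := by simp [t, (s.j_ne_q 0).symm, s.p_ne_q.symm]
  have hcomm (c : ι → ℤ) (hc : ∑ i, c i = 0) :
      diagSL t ht * zpowSL π c hc = zpowSL π c hc * diagSL t ht := by
    simp only [zpowSL, diagSL_mul_diagSL, mul_comm]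
  have hrow : diagSL t ht * s.rowSL 0 z = s.rowSL 0 (u * z) * diagSL t ht := by
    rw [rowSL, diagSL_mul_rankOneSL]
    congr 1
    ext i i'
    by_cases hi : i = s.p <;> by_cases hi' : i' = s.q
    · subst hi; subst hi'
      simp [rankOneSL, rowSL, htp, htq, vecMulVec_apply, v]
    all_goals simp [rankOneSL, rowSL, vecMulVec_apply, hi, hi']
  refine ⟨diagSL t ht, diagSL_mem fun i => ?_, ?_⟩
  · have h1 (w : Oˣ) (i k : ι) : ((Pi.mulSingle k (Units.map (algebraMap O F : O →* F) w) : ι → Fˣ) i : F) ∈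
        (algebraMap O F).range := by
      by_cases h : i = k
      · subst h; simp
      · simp [h, one_mem]
    have h2 := h1 u⁻¹ i (s.j 0)
    rw [map_inv] at h2
    simp only [t, Pi.mul_apply, Units.val_mul]
    exact mul_mem (h1 u i s.p) h2
  · rw [mul_inv_eq_iff_eq_mul]
    rw [show diagSL t ht * (zpowSL π a ha * s.rowSL 0 z * zpowSL π b hb) =
      (diagSL t ht * zpowSL π a ha) * s.rowSL 0 z * zpowSL π b hb by group, hcomm,
      mul_assoc (zpowSL π a ha), hrow, ← mul_assoc, mul_assoc _ _ (zpowSL π b hb), hcomm]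
    group

/-- Write α and β for the values of a + b at p and q. The block of the product at (p, q) is upper
triangular with diagonal π^α, π^β and corner π^(β-1). As β ≤ α, the corner has the least valuation,
so the elementary divisors are π^(β-1) and π^(α+1). -/
lemma exists_mul_rowSL_mul {ϖ : O} (hπ : (π : F) = algebraMap O F ϖ) {k : ℕ} {a b : ι → ℤ}
    (ha : ∑ i, a i = 0) (hb : ∑ i, b i = 0) (hpq : (a + b) s.q ≤ (a + b) s.p)
    (hk : a s.p - a s.q = -(k + 1)) : ∃ U ∈ integralSL ι F O, ∃ V ∈ integralSL ι F O,
      zpowSL π a ha * s.rowSL 0 (ϖ ^ k) * zpowSL π b hb =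
        U * zpowSL π (a + b + Pi.single s.p 1 - Pi.single s.q 1)
          (by simp [Finset.sum_add_distrib, ha, hb]) * V := by
  have hr : ((π ^ (a s.p - a s.q) : Fˣ) : F) * algebraMap O F (ϖ ^ k) = (π : F)⁻¹ := by
    rw [hk, map_pow, ← hπ, ← Units.val_pow_eq_pow_val, ← Units.val_mul, ← zpow_natCast,
      ← zpow_add, neg_add_rev, neg_add_cancel_right, zpow_neg_one, Units.val_inv_eq_inv_val]
  have he : 0 ≤ (a + b) s.p - (a + b) s.q + 1 := by omega
  set e := (a + b) s.p - (a + b) s.q + 1 with he'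
  have hdot' (c : F) : (Pi.single s.p c : ι → F) ⬝ᵥ Pi.single s.q (1 : F) = 0 := by simp [s.p_ne_q]
  have hdot'' (c : F) : (Pi.single s.q c : ι → F) ⬝ᵥ Pi.single s.p (1 : F) = 0 := by
    simp [s.p_ne_q.symm]
  let L (c : F) : SpecialLinearGroup ι F := rankOneSL (Pi.single s.q 1) (Pi.single s.p c) (hdot' c)
  let E (c : F) : SpecialLinearGroup ι F := rankOneSL (Pi.single s.p 1) (Pi.single s.q c) (hdot'' c)
  have hL (c : F) (hc : c ∈ (algebraMap O F).range) : L c ∈ integralSL ι F O := by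
    refine rankOneSL_mem.2 fun i i' => mul_mem ?_ ?_ <;> rw [Pi.single_apply] <;> split
    exacts [one_mem _, zero_mem _, hc, zero_mem _]
  have hE (c : F) (hc : c ∈ (algebraMap O F).range) : E c ∈ integralSL ι F O := by
    refine rankOneSL_mem.2 fun i i' => mul_mem ?_ ?_ <;> rw [Pi.single_apply] <;> split
    exacts [one_mem _, zero_mem _, hc, zero_mem _]
  have hpi : (π : F) ∈ (algebraMap O F).range := ⟨ϖ, hπ.symm⟩
  -- The product E 1 * L (-1) * E 1 is the Weyl element exchanging p and q up to sign. L π and L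
  -- (π^e) are the row and column operations that clear the block against its corner.
  refine ⟨L π * E 1 * L (-1) * E 1, mul_mem (mul_mem (mul_mem (hL _ hpi) (hE _ (one_mem _)))
    (hL _ (neg_mem (one_mem _)))) (hE _ (one_mem _)), L ((π ^ e : Fˣ) : F), hL _ ?_, ?_⟩
  · simpa using zpow_mul_mem (O := O) hπ he 1
  have h1 : zpowSL π a ha * s.rowSL 0 (ϖ ^ k) = E (π : F)⁻¹ * zpowSL π a ha := by
    rw [zpowSL, rowSL, diagSL_mul_rankOneSL]
    congr 1
    ext i i'
    by_cases hi : i = s.p <;> by_cases hi' : i' = s.q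
    · subst hi; subst hi'
      rw [← hr]
      simp [rankOneSL, E, vecMulVec_apply, zpow_sub₀ π.ne_zero, div_eq_mul_inv, mul_assoc]
    all_goals simp [rankOneSL, E, vecMulVec_apply, hi, hi']
  rw [h1, mul_assoc, zpowSL_mul]
  have hπ0 : (π : F) ≠ 0 := π.ne_zero
  have hqp := s.p_ne_q.symm
  apply SL_ext_mulVec
  intro w
  simp only [SL_mul_mulVec, L, E, rankOneSL_mulVec, zpowSL, diagSL_mulVec]
  simp only [single_dotProduct, Pi.add_apply, Pi.sub_apply, Pi.smul_apply, Pi.single_eq_same,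
    Pi.single_eq_of_ne s.p_ne_q, Pi.single_eq_of_ne hqp, smul_eq_mul, mul_one, mul_zero, add_zero,
    one_mul, neg_mul, sub_zero]
  have e1 : ((π ^ (a s.p + b s.p + 1) : Fˣ) : F) = π * (π ^ (a s.p + b s.p) : Fˣ) := by
    rw [zpow_add, zpow_one, Units.val_mul, mul_comm]
  have e2 : ((π ^ (a s.q + b s.q) : Fˣ) : F) = π * (π ^ (a s.q + b s.q - 1) : Fˣ) := by
    rw [zpow_sub, zpow_one, ← Units.val_mul, mul_inv_cancel_comm_assoc]
  have e3 : ((π ^ (a s.q + b s.q - 1) : Fˣ) : F) * (π ^ e : Fˣ) = (π ^ (a s.p + b s.p) : Fˣ) := by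
    rw [← Units.val_mul, ← zpow_add, he']
    congr 2
    simp only [Pi.add_apply]
    ring
  ext i
  by_cases hi : i = s.p
  · subst hi
    simp only [Pi.add_apply, Pi.sub_apply, Pi.smul_apply, Pi.single_eq_same,
      Pi.single_eq_of_ne s.p_ne_q, smul_eq_mul, mul_one, mul_zero, add_zero, sub_zero, zero_add, e1, e2]
    field_simp
    linear_combination (-w s.p) * e3
  by_cases hi' : i = s.q
  · subst hi'
    simp only [Pi.add_apply, Pi.sub_apply, Pi.smul_apply, Pi.single_eq_same,
      Pi.single_eq_of_ne hqp, smul_eq_mul, mul_one, mul_zero, add_zero, sub_zero, zero_add, e1, e2]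
    field_simp
    linear_combination (-(π : F) * w s.p) * e3
  · simp [hi, hi']

end HeisenbergIndex

end Integral

end ZPow

/-! ### One step in the lattice of diagonal matrices -/

section Step

open Matrix

namespace HeisenbergIndex

section Weight

variable {n : ℕ} {ι : Type*} [DecidableEq ι] (s : HeisenbergIndex n ι)

/-- The integer vector with given values at the positions of a Heisenberg group. -/
def weight (x y z : ℤ) : ι → ℤ :=
  Pi.single s.p x + Pi.single s.q y + ∑ k, Pi.single (s.j k) z

@[simp] lemma weight_p (x y z : ℤ) : s.weight x y z s.p = x := by
  simp [weight, Pi.single_eq_of_ne (s.j_ne_p _).symm, s.p_ne_q]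

@[simp] lemma weight_q (x y z : ℤ) : s.weight x y z s.q = y := by
  simp [weight, Pi.single_eq_of_ne (s.j_ne_q _).symm, s.p_ne_q.symm]

@[simp] lemma weight_j (x y z : ℤ) (k : Fin n) : s.weight x y z (s.j k) = z := by
  simp [weight, s.j_ne_p k, s.j_ne_q k, Pi.single_apply, s.j_injective.eq_iff]

lemma sum_weight [Fintype ι] (x y z : ℤ) : ∑ i, s.weight x y z i = x + y + n * z := by
  simp only [weight, Pi.add_apply, Finset.sum_add_distrib, Finset.sum_apply]
  rw [Finset.sum_comm]
  simp

end Weight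

variable {n : ℕ} [NeZero n] {ι F O : Type*} [Fintype ι] [DecidableEq ι] [Field F]
  [CommRing O] [IsDomain O] [IsDiscreteValuationRing O] [Algebra O F] [FaithfulSMul O F]
  (s : HeisenbergIndex n ι) {ϖ : O} (hϖ : Irreducible ϖ) [Finite (O ⧸ Ideal.span {ϖ})]
  {π : Fˣ} (hπ : (π : F) = algebraMap O F ϖ)
  [MeasurableSpace (SpecialLinearGroup ι F)] [MeasurableMul (SpecialLinearGroup ι F)]
  [MeasurableSpace.CountablyGenerated (SpecialLinearGroup ι F)]
  {μ : Measure (SpecialLinearGroup ι F)} [μ.IsMulLeftInvariant] [SFinite μ]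
  (hK : MeasurableSet (integralSL ι F O : Set (SpecialLinearGroup ι F)))
  (hK0 : μ (integralSL ι F O) ≠ 0) (hKt : μ (integralSL ι F O) ≠ ∞)
  {f : SpecialLinearGroup ι F → ℂ} {ε : ℝ} {p : ℝ≥0∞}
  (hp : 2 ≤ p ∧ ε = n / 2 - (n + 1) / p.toReal ∨
      1 ≤ p ∧ p ≤ 2 ∧ ε = (n + 1) / p.toReal - (n / 2 + 1))
  {C : ℝ≥0} (hC : MSNormLE p μ (herzSchur f) C)

include hϖ hπ hK hK0 hKt hp hC

/-- Here D = π^a and D' = π^b. In each alternative the nonnegative exponents put the conjugates of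
B(y, 0) and A(x, 0) in K, and those at most -(k+1) detect divisibility by ϖ^(k+1). In the first
alternative A is the row family, in the second the column family. -/
lemma norm_sub_le_of_row_or_col {k : ℕ} {a b : ι → ℤ} (ha : ∑ i, a i = 0) (hb : ∑ i, b i = 0)
    (hpq : a s.q + b s.q ≤ a s.p + b s.p) (hk : a s.p - a s.q = -(k + 1))
    (h : (∀ i, 0 ≤ a (s.j i) - a s.q ∧ 0 ≤ b (s.j i) - b s.p ∧ a s.p - a (s.j i) ≤ -(k + 1) ∧
        b s.q - b (s.j i) ≤ -(k + 1)) ∨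
      (∀ i, 0 ≤ a s.p - a (s.j i) ∧ 0 ≤ b s.q - b (s.j i) ∧ a (s.j i) - a s.q ≤ -(k + 1) ∧
        b (s.j i) - b s.p ≤ -(k + 1))) (hbk : b s.q - b s.p ≤ -(k + 1)) :
    ‖doubleCosetAvg μ (integralSL ι F O) f (zpowSL π (a + b)
          (by simp [Finset.sum_add_distrib, ha, hb])) -
        doubleCosetAvg μ (integralSL ι F O) f (zpowSL π (a + b + Pi.single s.p 1 - Pi.single s.q 1)
          (by simp [Finset.sum_add_distrib, ha, hb]))‖ ≤
      2 * C * ((Nat.card (O ⧸ Ideal.span {ϖ}) : ℝ) ^ (k + 1)) ^ (-ε) := by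
  obtain ⟨U, hU, V, hV, hUV⟩ := s.exists_mul_rowSL_mul π hπ ha hb
    (by simp only [Pi.add_apply]; omega) hk
  have hb' : ∑ i, (-b) i = 0 := by simp [hb]
  have hinv : zpowSL π (-b) hb' = (zpowSL π b hb)⁻¹ := (zpowSL_inv π b hb).symm
  have hinv' : (zpowSL π (-b) hb')⁻¹ = zpowSL π b hb := by rw [hinv, inv_inv]
  have h0 (e : ℤ) : ((π ^ e : Fˣ) : F) * algebraMap O F 0 ∈ (algebraMap O F).range := by
    simp [zero_mem]
  have hI (c : O) (hc : ϖ ^ (k + 1) ∣ c) :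
      ((π ^ (a s.p - a s.q) : Fˣ) : F) * algebraMap O F c ∈ (algebraMap O F).range := by
    obtain ⟨c, rfl⟩ := hc
    refine ⟨c, ?_⟩
    rw [hk, map_mul, map_pow, ← hπ, ← Units.val_pow_eq_pow_val, ← mul_assoc, ← Units.val_mul,
      ← zpow_natCast, ← _root_.zpow_add, Nat.cast_succ, neg_add_cancel, zpow_zero, Units.val_one,
      one_mul]
  have hu (u : Oˣ) (z : O) := s.exists_conj_eq_unit_mul π ha hb u z
  have key : ‖doubleCosetAvg μ (integralSL ι F O) f (zpowSL π a ha * zpowSL π b hb) -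
      doubleCosetAvg μ (integralSL ι F O) f (zpowSL π a ha * s.rowSL 0 (ϖ ^ k) * zpowSL π b hb)‖ ≤
      2 * C * ((Nat.card (O ⧸ Ideal.span {ϖ}) : ℝ) ^ (k + 1)) ^ (-ε) := by
    rcases h with h | h
    · refine norm_sub_le_of_heisenberg hK hK0 hKt hϖ (A := s.rowSL) (B := s.colSL)
        s.rowSL_mul_inv s.colSL_inv_mul s.rowSL_mul_colSL (fun y => ?_) (fun x => ?_)
        (fun x z hx => ?_) (fun y w hy => ?_) (fun c hc => ?_) hu hp hC
      · rw [zpowSL_conj_colSL_mem]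
        exact ⟨fun i => zpow_mul_mem hπ (h i).1 _, h0 _⟩
      · rw [← hinv', inv_inv, zpowSL_conj_rowSL_mem]
        refine ⟨fun i => zpow_mul_mem hπ ?_ _, h0 _⟩
        have := (h i).2.1
        simp only [Pi.neg_apply]; omega
      · rw [zpowSL_conj_rowSL_mem] at hx
        refine ⟨fun i => pow_dvd_of_zpow_mul_mem hπ ?_ (hx.1 i),
          pow_dvd_of_zpow_mul_mem hπ ?_ hx.2⟩
        · have := (h i).2.2.1; push_cast; omega
        · push_cast; omega
      · rw [← hinv', inv_inv, zpowSL_conj_colSL_mem] at hy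
        refine ⟨fun i => pow_dvd_of_zpow_mul_mem hπ ?_ (hy.1 i),
          pow_dvd_of_zpow_mul_mem hπ ?_ hy.2⟩
        · have := (h i).2.2.2; simp only [Pi.neg_apply]; push_cast; omega
        · simp only [Pi.neg_apply]; push_cast; omega
      · rw [zpowSL_conj_rowSL_mem]
        exact ⟨fun i => h0 _, hI c hc⟩
    -- The central element is rewritten as a column element with first argument -0, to match the
    -- family A x z = `s.colSL (-x) z`.
    · simp only [rowSL_zero_left] at hu ⊢
      rw [← neg_zero (G := Fin n → O)] at hu ⊢
      refine norm_sub_le_of_heisenberg hK hK0 hKt hϖ (A := fun x z => s.colSL (-x) z) (B := s.rowSL)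
        (fun x z x' z' => ?_) s.rowSL_inv_mul (fun x z y w => ?_) (fun y => ?_) (fun x => ?_)
        (fun x z hx => ?_) (fun y w hy => ?_) (fun c hc => ?_) hu hp hC
      · rw [s.colSL_mul_inv, neg_sub_neg, neg_sub]
      · rw [s.colSL_mul_rowSL, neg_zero]
      · rw [zpowSL_conj_rowSL_mem]
        exact ⟨fun i => zpow_mul_mem hπ (h i).1 _, h0 _⟩
      · rw [← hinv', inv_inv, zpowSL_conj_colSL_mem]
        refine ⟨fun i => zpow_mul_mem hπ ?_ _, h0 _⟩
        have := (h i).2.1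
        simp only [Pi.neg_apply]; omega
      · rw [zpowSL_conj_colSL_mem] at hx
        refine ⟨fun i => (dvd_neg (α := O)).1 (pow_dvd_of_zpow_mul_mem hπ ?_ (hx.1 i)),
          pow_dvd_of_zpow_mul_mem hπ ?_ hx.2⟩
        · have := (h i).2.2.1; push_cast; omega
        · push_cast; omega
      · rw [← hinv', inv_inv, zpowSL_conj_rowSL_mem] at hy
        refine ⟨fun i => pow_dvd_of_zpow_mul_mem hπ ?_ (hy.1 i),
          pow_dvd_of_zpow_mul_mem hπ ?_ hy.2⟩
        · have := (h i).2.2.2; simp only [Pi.neg_apply]; push_cast; omega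
        · simp only [Pi.neg_apply]; push_cast; omega
      · rw [neg_zero, ← rowSL_zero_left, zpowSL_conj_rowSL_mem]
        exact ⟨fun i => h0 _, hI c hc⟩
  rwa [hUV, doubleCosetAvg_mul_right _ _ hV, doubleCosetAvg_mul_left _ _ hU, zpowSL_mul] at key

/-- Moving a unit of weight from position `q` to position `p` changes the average of the symbol over
a double coset very little, if `n` other weights are far above or far below. -/
lemma norm_sub_le {l : ℕ} (hl : l ≠ 0) {w : ι → ℤ} (hw : ∑ i, w i = 0) (hpq : w s.q ≤ w s.p)
    (h : (∀ k, w s.p + (n + 2) * l ≤ w (s.j k)) ∨ ∀ k, w (s.j k) ≤ w s.q - (n + 2) * l) :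
    ‖doubleCosetAvg μ (integralSL ι F O) f (zpowSL π w hw) -
        doubleCosetAvg μ (integralSL ι F O) f (zpowSL π (w + Pi.single s.p 1 - Pi.single s.q 1)
          (by simp [Finset.sum_add_distrib, hw]))‖ ≤
      2 * C * ((Nat.card (O ⧸ Ideal.span {ϖ}) : ℝ) ^ ((n + 2) * l)) ^ (-ε) := by
  obtain ⟨k, hk⟩ : ∃ k, (n + 2) * l = k + 1 :=
    Nat.exists_eq_succ_of_ne_zero (mul_ne_zero (by omega) hl)
  have hk' : ((n : ℤ) + 2) * l = k + 1 := by exact_mod_cast hk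
  have hnl : (n : ℤ) * l = k + 1 - 2 * l := by linarith
  rw [hk]
  rw [hk'] at h
  -- The vector a is supported on the n + 2 positions of the Heisenberg group, is constant on all of
  -- them except p (or except q), and has sum zero. Its jump is therefore a multiple of n + 2, which
  -- is why k + 1 = (n + 2) l.
  obtain ⟨a, ha, hpq', hj⟩ : ∃ a : ι → ℤ, ∑ i, a i = 0 ∧ a s.p - a s.q = -(k + 1) ∧
      ((∀ i, a s.q = a (s.j i) ∧ w s.p + (k + 1) ≤ w (s.j i)) ∨
        (∀ i, a s.p = a (s.j i) ∧ w (s.j i) ≤ w s.q - (k + 1))) := by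
    rcases h with h | h
    · refine ⟨s.weight (-((n + 1) * l)) l l, ?_, ?_, Or.inl fun i => ⟨by simp, h i⟩⟩
      · rw [sum_weight]; ring
      · simp only [weight_p, weight_q]; linarith
    · refine ⟨s.weight (-l) ((n + 1) * l) (-l), ?_, ?_, Or.inr fun i => ⟨by simp, h i⟩⟩
      · rw [sum_weight]; ring
      · simp only [weight_p, weight_q]; linarith
  have hb : ∑ i, (w - a) i = 0 := by simp [ha, hw]
  have := s.norm_sub_le_of_row_or_col hϖ hπ hK hK0 hKt hp hC ha hb (k := k)
    (by simp only [Pi.sub_apply]; omega) hpq' ?_ (by simp only [Pi.sub_apply]; omega)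
  · simpa only [add_sub_cancel] using this
  · rcases hj with hj | hj
    · refine Or.inl fun i => ?_
      have := hj i
      simp only [Pi.sub_apply]; omega
    · refine Or.inr fun i => ?_
      have := hj i
      simp only [Pi.sub_apply]; omega

end HeisenbergIndex

end Step

/-! ### A path to infinity in the weight lattice -/

section Chain

variable {n : ℕ} {ι : Type*} [DecidableEq ι]

/-- The integer vector with the values `1` on the image of `c` and `-1` on the image of `b`. -/
def signVector (b c : Fin n → ι) (S : Finset (Fin n)) : ι → ℤ :=
  ∑ k ∈ S, (Pi.single (c k) 1 - Pi.single (b k) 1)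

lemma sum_signVector [Fintype ι] (b c : Fin n → ι) (S : Finset (Fin n)) :
    ∑ i, signVector b c S i = 0 := by
  simp only [signVector, Finset.sum_apply, Pi.sub_apply]
  rw [Finset.sum_comm]
  simp

section

variable {b c : Fin n → ι} (hb : Function.Injective b) (hc : Function.Injective c)
  (hbc : ∀ i j, b i ≠ c j)

include hc hbc in
lemma signVector_right (S : Finset (Fin n)) (i : Fin n) :
    signVector b c S (c i) = if i ∈ S then 1 else 0 := by
  simp [signVector, Pi.single_apply, hc.eq_iff, (hbc _ _).symm]

include hb hbc in
lemma signVector_left (S : Finset (Fin n)) (i : Fin n) :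
    signVector b c S (b i) = if i ∈ S then -1 else 0 := by
  simp [signVector, Pi.single_apply, hb.eq_iff, hbc, Finset.sum_ite_eq, apply_ite]

lemma signVector_of_ne {m : ι} (hbm : ∀ i, b i ≠ m) (hcm : ∀ i, c i ≠ m) (S : Finset (Fin n)) :
    signVector b c S m = 0 := by
  simp [signVector, Pi.single_apply, (hbm _).symm, (hcm _).symm]

end

/-- For each k in turn, one unit of weight moves from b k to m, with the c's far above, and then
from m to c k, with the b's far below. This makes 2n moves. -/
lemma norm_sub_le_of_chain [Fintype ι] {Ψ : (ι → ℤ) → ℂ} {β : ℝ} {l : ℕ}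
    (h : ∀ (s : HeisenbergIndex n ι) (w : ι → ℤ), ∑ i, w i = 0 → w s.q ≤ w s.p →
      ((∀ k, w s.p + (n + 2) * l ≤ w (s.j k)) ∨ ∀ k, w (s.j k) ≤ w s.q - (n + 2) * l) →
      ‖Ψ w - Ψ (w + Pi.single s.p 1 - Pi.single s.q 1)‖ ≤ β)
    {b c : Fin n → ι} {m : ι} (hb : Function.Injective b) (hc : Function.Injective c)
    (hbc : ∀ i j, b i ≠ c j) (hbm : ∀ i, b i ≠ m) (hcm : ∀ i, c i ≠ m) {t : ℕ}
    (ht : (n + 2) * l + 1 ≤ t) :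
    ‖Ψ ((t : ℤ) • signVector b c Finset.univ) - Ψ (((t + 1 : ℕ) : ℤ) • signVector b c Finset.univ)‖ ≤
      2 * n * β := by
  have ht' : ((n : ℤ) + 2) * l + 1 ≤ t := by exact_mod_cast ht
  have hnl : (0 : ℤ) ≤ ((n : ℤ) + 2) * l := by positivity
  set v := signVector b c Finset.univ with hv
  have hvb (i) : v (b i) = -1 := by simp [v, signVector_left hb hbc]
  have hvc (i) : v (c i) = 1 := by simp [v, signVector_right hc hbc]
  have hvm : v m = 0 := signVector_of_ne hbm hcm _
  have key (S : Finset (Fin n)) :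
      ‖Ψ ((t : ℤ) • v) - Ψ ((t : ℤ) • v + signVector b c S)‖ ≤ 2 * S.card * β := by
    induction S using Finset.induction_on with
    | empty => simp [signVector]
    | insert k S hk ih =>
      set w := (t : ℤ) • v + signVector b c S with hw
      have hwb (i) : w (b i) = if i ∈ S then -(t : ℤ) - 1 else -t := by
        simp only [hw, Pi.add_apply, Pi.smul_apply, hvb, signVector_left hb hbc]
        split_ifs <;> simp <;> ring
      have hwc (i) : w (c i) = if i ∈ S then t + 1 else t := by
        simp only [hw, Pi.add_apply, Pi.smul_apply, hvc, signVector_right hc hbc]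
        split_ifs <;> simp
      have hwm : w m = 0 := by
        simp [hw, hvm, signVector_of_ne hbm hcm]
      have hws : ∑ i, w i = 0 := by
        simp [hw, Finset.sum_add_distrib, ← Finset.mul_sum, hv, sum_signVector]
      have h1 := h ⟨m, b k, c, (hbm k).symm, hc, hcm, fun i => (hbc k i).symm⟩ w hws
        (by simp only [hwb, hwm]; split_ifs; omega) (Or.inl fun i => by
          simp only [hwm, hwc]; split_ifs <;> omega)
      -- After the first move m has weight 1; since t ≥ 1, this is at most the weight t of c k.
      have h2 := h ⟨c k, m, b, hcm k, hb, fun i => hbc i k, hbm⟩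
        (w + Pi.single m 1 - Pi.single (b k) 1)
        (by simp [Finset.sum_add_distrib, hws])
        (by simp [hwm, hwc, Pi.single_apply, hbm, hcm, hbc, (hbm _).symm, (hbc _ _).symm]
            split_ifs; omega)
        (Or.inr fun i => by
          simp [hwm, hwb, Pi.single_apply, hbm, (hbm _).symm]
          split_ifs <;> omega)
      simp only at h1 h2
      have h3 : w + Pi.single m 1 - Pi.single (b k) 1 + Pi.single (c k) 1 - Pi.single m 1 =
          (t : ℤ) • v + signVector b c (insert k S) := by
        rw [hw, signVector, signVector, Finset.sum_insert hk]
        abel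
      rw [h3] at h2
      rw [Finset.card_insert_of_notMem hk]
      push_cast
      have h4 := norm_sub_le_norm_sub_add_norm_sub (Ψ ((t : ℤ) • v)) (Ψ w)
        (Ψ ((t : ℤ) • v + signVector b c (insert k S)))
      have h5 := norm_sub_le_norm_sub_add_norm_sub (Ψ w) (Ψ (w + Pi.single m 1 - Pi.single (b k) 1))
        (Ψ ((t : ℤ) • v + signVector b c (insert k S)))
      linarith
  have := key Finset.univ
  rw [Finset.card_univ, Fintype.card_fin, ← hv] at this
  rwa [Nat.cast_succ, add_smul, one_smul]

/-- Over a block of n + 2 consecutive t the variation is at most (n + 2) β θ^(l+1). Summing over the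
blocks out to infinity, where the limit is 0, bounds the value itself. -/
lemma norm_le_of_geometric_of_tendsto {n : ℕ} {Ψ : ℕ → ℂ} {β θ : ℝ} (hθ : θ < 1)
    (h : ∀ l t : ℕ, l ≠ 0 → (n + 2) * l + 1 ≤ t → ‖Ψ t - Ψ (t + 1)‖ ≤ β * θ ^ l)
    (hΨ : Tendsto Ψ atTop (nhds 0)) (l : ℕ) :
    ‖Ψ ((n + 2) * (l + 1) + 1)‖ ≤ (n + 2) * β * θ / (1 - θ) * θ ^ l := by
  have hstep (l : ℕ) : dist (Ψ ((n + 2) * (l + 1) + 1)) (Ψ ((n + 2) * (l + 1 + 1) + 1)) ≤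
      (n + 2) * β * θ * θ ^ l := by
    have h1 := dist_le_Ico_sum_of_dist_le (f := Ψ) (d := fun _ => β * θ ^ (l + 1))
      (show (n + 2) * (l + 1) + 1 ≤ (n + 2) * (l + 1 + 1) + 1 by gcongr; omega)
      (fun {t} ht _ => by rw [dist_eq_norm]; exact h (l + 1) t l.succ_ne_zero ht)
    refine h1.trans_eq ?_
    rw [Finset.sum_const, Nat.card_Ico, nsmul_eq_mul,
      show (n + 2) * (l + 1 + 1) + 1 - ((n + 2) * (l + 1) + 1) = n + 2 by
        rw [Nat.mul_succ (n + 2) (l + 1)]; omega]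
    push_cast
    ring
  have hlim : Tendsto (fun l => Ψ ((n + 2) * (l + 1) + 1)) atTop (nhds 0) := by
    refine hΨ.comp (tendsto_atTop_mono (fun l => ?_) tendsto_id)
    simp only [id]
    nlinarith
  have := dist_le_of_le_geometric_of_tendsto θ _ hθ hstep hlim l
  rw [dist_zero_right] at this
  exact this.trans_eq (by ring)

end Chain

/-! ### Topology of the local field and of its special linear group -/

section LocalField

open ValuativeRel Topology

variable (F : Type*) [Field F] [ValuativeRel F] [TopologicalSpace F] [IsNonarchimedeanLocalField F]

/-- A rank-one form of the valuation makes F a normed field; local compactness then makes it proper.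
-/
lemma secondCountable_and_t2_of_localField : SecondCountableTopology F ∧ T2Space F := by
  let := IsTopologicalAddGroup.rightUniformSpace F
  have := isUniformAddGroup_of_addCommGroup (G := F)
  let : (Valued.v (R := F)).RankOne :=
  { hom' := IsRankLeOne.nonempty.some.emb (R := F).comp MonoidWithZeroHom.ValueGroup₀.embedding
    strictMono' := IsRankLeOne.nonempty.some.strictMono.comp
        MonoidWithZeroHom.ValueGroup₀.embedding_strictMono }
  open scoped Valued in
  have : ProperSpace F := .of_nontriviallyNormedField_of_weaklyLocallyCompactSpace F
  open scoped Valued in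
  exact ⟨inferInstance, inferInstance⟩

instance : SecondCountableTopology F := (secondCountable_and_t2_of_localField F).1

instance : T2Space F := (secondCountable_and_t2_of_localField F).2

section SL

variable {ι : Type*} [Fintype ι] [DecidableEq ι]

lemma isClosedEmbedding_SL_entries :
    IsClosedEmbedding fun (g : Matrix.SpecialLinearGroup ι F) (i j : ι) => g i j :=
  Matrix.SpecialLinearGroup.isClosedEmbedding_val

instance : T2Space (Matrix.SpecialLinearGroup ι F) :=
  (isClosedEmbedding_SL_entries F).isEmbedding.t2Space

instance : SecondCountableTopology (Matrix.SpecialLinearGroup ι F) :=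
  (isClosedEmbedding_SL_entries F).isEmbedding.secondCountableTopology

instance : LocallyCompactSpace (Matrix.SpecialLinearGroup ι F) :=
  (isClosedEmbedding_SL_entries F).locallyCompactSpace

variable {F}

lemma isOpen_valuation_le_one : IsOpen {x : F | valuation F x ≤ 1} :=
  (valuation F).isOpen_integer

lemma coe_integralSL : (integralSL ι F 𝒪[F] : Set (Matrix.SpecialLinearGroup ι F)) =
    (fun (g : Matrix.SpecialLinearGroup ι F) (i j : ι) => g i j) ⁻¹'
      Set.pi Set.univ fun _ => Set.pi Set.univ fun _ => {x | valuation F x ≤ 1} := by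
  ext g
  simp only [SetLike.mem_coe, mem_integralSL, Set.mem_preimage, Set.mem_pi, Set.mem_univ,
    forall_true_left]
  refine forall₂_congr fun i j => ⟨?_, fun h => ⟨⟨_, h⟩, rfl⟩⟩
  rintro ⟨x, hx⟩
  exact hx ▸ x.2

lemma isCompact_integralSL :
    IsCompact (integralSL ι F 𝒪[F] : Set (Matrix.SpecialLinearGroup ι F)) := by
  rw [coe_integralSL]
  exact (isClosedEmbedding_SL_entries F).isCompact_preimage (isCompact_univ_pi fun _ =>
    isCompact_univ_pi fun _ => IsNonarchimedeanLocalField.isCompact_closedBall F 1)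

lemma isOpen_integralSL :
    IsOpen (integralSL ι F 𝒪[F] : Set (Matrix.SpecialLinearGroup ι F)) := by
  rw [coe_integralSL]
  exact (isOpen_set_pi Set.finite_univ fun _ _ => isOpen_set_pi Set.finite_univ fun _ _ =>
    isOpen_valuation_le_one).preimage (isClosedEmbedding_SL_entries F).continuous

end SL

variable {F}

lemma eventually_pow_valuation_gt {x : F} (hx : valuation F x < 1) (hx0 : x ≠ 0)
    (γ : ValueGroupWithZero F) : ∀ᶠ t : ℕ in atTop, γ < valuation F x⁻¹ ^ t := by
  have h1 : 1 < valuation F x⁻¹ := by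
    rw [map_inv₀]
    exact (one_lt_inv₀ (by simpa [zero_lt_iff] using hx0)).2 hx
  obtain ⟨k, hk⟩ := MulArchimedean.arch γ h1
  filter_upwards [eventually_gt_atTop k] with t ht
  exact hk.trans_lt (pow_lt_pow_right₀ h1 ht)

/-- The open balls of radius |x|^(-t) increase to F, so a compact set lies in one of them and later
powers of x⁻¹ lie outside it. -/
lemma eventually_inv_pow_notMem {x : F} (hx : valuation F x < 1) (hx0 : x ≠ 0) {S : Set F}
    (hS : IsCompact S) : ∀ᶠ t : ℕ in atTop, x⁻¹ ^ t ∉ S := by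
  have hopen (t : ℕ) : IsOpen ((fun y => x ^ t * y) ⁻¹' {y : F | valuation F y ≤ 1}) :=
    isOpen_valuation_le_one.preimage (continuous_const_mul _)
  have hmem (t : ℕ) (y : F) : y ∈ ((fun y => x ^ t * y) ⁻¹' {y : F | valuation F y ≤ 1}) ↔
      valuation F y ≤ valuation F x⁻¹ ^ t := by
    have : 0 < valuation F x ^ t := pow_pos (by simpa [zero_lt_iff] using hx0) _
    simp [map_inv₀, inv_pow, mul_comm, ← le_div_iff₀ this]
  have hmono : Monotone fun t : ℕ => (fun y => x ^ t * y) ⁻¹' {y : F | valuation F y ≤ 1} := by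
    intro s t hst y hy
    rw [hmem] at hy ⊢
    refine hy.trans (pow_le_pow_right₀ ?_ hst)
    rw [map_inv₀]
    exact (one_le_inv₀ (by simpa [zero_lt_iff] using hx0)).2 hx.le
  obtain ⟨t, ht⟩ := hS.elim_directed_cover _ hopen (fun y _ => by
    obtain ⟨t, ht⟩ := (eventually_pow_valuation_gt hx hx0 (valuation F y)).exists
    exact Set.mem_iUnion.2 ⟨t, (hmem t y).2 ht.le⟩) hmono.directed_le
  filter_upwards [eventually_pow_valuation_gt hx hx0 (valuation F x⁻¹ ^ t)] with s hs hsS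
  have := (hmem t _).1 (ht hsS)
  rw [map_pow] at this
  exact absurd hs this.not_gt

lemma eventually_zpowSL_notMem {ι : Type*} [Fintype ι] [DecidableEq ι] {π : Fˣ}
    (hπ : valuation F (π : F) < 1) {v : ι → ℤ} (hv : ∑ i, v i = 0) {m : ι} (hm : v m = -1)
    {L : Set (Matrix.SpecialLinearGroup ι F)} (hL : IsCompact L) :
    ∀ᶠ t : ℕ in atTop, zpowSL π ((t : ℤ) • v) (by simp [← Finset.mul_sum, hv]) ∉ L := by
  have hc : Continuous fun g : Matrix.SpecialLinearGroup ι F => g m m :=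
    (continuous_apply_apply m m).comp (isClosedEmbedding_SL_entries F).continuous
  filter_upwards [eventually_inv_pow_notMem hπ π.ne_zero (hL.image hc)] with t ht h
  refine ht ⟨_, h, ?_⟩
  simp only
  have := zpowSL_apply π ((t : ℤ) • v) (by simp [← Finset.mul_sum, hv]) m m
  simp [hm] at this
  rw [inv_pow]
  exact this

end LocalField

/-! ### The Fourier algebra inside C₀, and limits of double coset averages -/

section ZeroAtInfty

open Topology

variable {G : Type u} [Group G] [TopologicalSpace G] [IsTopologicalGroup G] [T2Space G]
  [SecondCountableTopology G] [LocallyCompactSpace G] [MeasurableSpace G] [BorelSpace G]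
  {μ : Measure G} [μ.IsHaarMeasure]

omit [T2Space G] [SecondCountableTopology G] [LocallyCompactSpace G] in
lemma norm_coefficient_le {ξ η : G → ℂ} (hξ : MemLp ξ 2 μ) (hη : MemLp η 2 μ) (g : G) :
    ‖∫ x, ξ (g⁻¹ * x) * conj (η x) ∂μ‖ ≤ (eLpNorm ξ 2 μ).toReal * (eLpNorm η 2 μ).toReal := by
  have hmp := measurePreserving_mul_left μ g⁻¹
  have hξ' : MemLp (fun x => ξ (g⁻¹ * x)) 2 μ := hξ.comp_measurePreserving hmp
  have h1 : ∫ x, ξ (g⁻¹ * x) * conj (η x) ∂μ = ⟪hη.toLp, hξ'.toLp⟫_ℂ := by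
    rw [L2.inner_def]
    refine integral_congr_ae ?_
    filter_upwards [hη.coeFn_toLp, hξ'.coeFn_toLp] with x h1 h2
    rw [h1, h2, RCLike.inner_apply]
  rw [h1]
  refine (norm_inner_le_norm _ _).trans_eq ?_
  rw [Lp.norm_toLp, Lp.norm_toLp, mul_comm]
  congr 2
  exact eLpNorm_comp_measurePreserving hξ.1 hmp

lemma exists_zeroAtInfty_eq_of_hasCompactSupport {ξ η : G → ℂ} (hξ : Continuous ξ)
    (hη : Continuous η) (hξ' : HasCompactSupport ξ) (hη' : HasCompactSupport η) :
    ∃ f : C₀(G, ℂ), ∀ g, f g = ∫ x, ξ (g⁻¹ * x) * conj (η x) ∂μ := by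
  have hset (g : G) : ∫ x, ξ (g⁻¹ * x) * conj (η x) ∂μ =
      ∫ x in tsupport η, ξ (g⁻¹ * x) * conj (η x) ∂μ := by
    rw [setIntegral_eq_integral_of_forall_compl_eq_zero]
    intro x hx
    rw [image_eq_zero_of_notMem_tsupport hx, map_zero, mul_zero]
  have hc : Continuous fun g => ∫ x, ξ (g⁻¹ * x) * conj (η x) ∂μ := by
    simp only [hset]
    refine continuous_parametric_integral_of_continuous ?_ hη'
    simp only [Function.uncurry_def]
    fun_prop
  have hsupp : HasCompactSupport fun g => ∫ x, ξ (g⁻¹ * x) * conj (η x) ∂μ := by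
    refine HasCompactSupport.intro (IsCompact.mul hη' (IsCompact.inv hξ')) fun g hg => ?_
    rw [hset]
    refine setIntegral_eq_zero_of_forall_eq_zero fun x hx => ?_
    rw [image_eq_zero_of_notMem_tsupport (f := ξ), zero_mul]
    intro h
    exact hg ⟨x, hx, _, Set.inv_mem_inv.2 h, by simp⟩
  exact ⟨⟨⟨_, hc⟩, hsupp.is_zero_at_infty⟩, fun g => rfl⟩

/-- The Fourier algebra consists of continuous functions that vanish at infinity. -/
lemma MemFourierAlgebra.exists_zeroAtInfty {φ : G → ℂ} (h : MemFourierAlgebra μ φ) :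
    ∃ f : C₀(G, ℂ), ⇑f = φ := by
  obtain ⟨ξ, η, hξ, hη, hφ⟩ := h
  have hint {ξ η : G → ℂ} (hξ : MemLp ξ 2 μ) (hη : MemLp η 2 μ) (g : G) :
      Integrable (fun x => ξ (g⁻¹ * x) * conj (η x)) μ := by
    have hξ' : MemLp (fun x => ξ (g⁻¹ * x)) 2 μ :=
      hξ.comp_measurePreserving (measurePreserving_mul_left μ g⁻¹)
    exact hξ'.integrable_mul hη.star
  have key (δ : ℝ) (hδ : 0 < δ) : ∃ f : C₀(G, ℂ), ∀ g, ‖φ g - f g‖ ≤ δ := by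
    set A := (eLpNorm ξ 2 μ).toReal
    set B := (eLpNorm η 2 μ).toReal
    have hA : 0 ≤ A := ENNReal.toReal_nonneg
    have hB : 0 ≤ B := ENNReal.toReal_nonneg
    obtain ⟨κ, hκ, hκ1, hκδ⟩ : ∃ κ : ℝ, 0 < κ ∧ κ ≤ 1 ∧ κ * (A + B + 1) ≤ δ := by
      refine ⟨min 1 (δ / (A + B + 1)), by positivity, min_le_left _ _, ?_⟩
      rw [← le_div_iff₀ (by positivity)]
      exact min_le_right _ _
    have hκ' : ENNReal.ofReal κ ≠ 0 := by simpa using hκ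
    obtain ⟨ξ', hξs, hξ1, hξc, hξm⟩ :=
      hξ.exists_hasCompactSupport_eLpNorm_sub_le (by norm_num) hκ'
    obtain ⟨η', hηs, hη1, hηc, hηm⟩ :=
      hη.exists_hasCompactSupport_eLpNorm_sub_le (by norm_num) hκ'
    obtain ⟨f, hf⟩ := exists_zeroAtInfty_eq_of_hasCompactSupport (μ := μ) hξc hηc hξs hηs
    refine ⟨f, fun g => ?_⟩
    -- This expansion involves only the norms of ξ, η and of the two errors, not those of ξ' and η'.
    -- The error is at most κ B + κ² + A κ, whence the choice of κ ≤ 1.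
    have h1 : φ g - f g = ∫ x, (ξ - ξ') (g⁻¹ * x) * conj (η x) ∂μ -
        ∫ x, (ξ - ξ') (g⁻¹ * x) * conj ((η - η') x) ∂μ +
          ∫ x, ξ (g⁻¹ * x) * conj ((η - η') x) ∂μ := by
      rw [hφ, hf, ← integral_sub (hint (hξ.sub hξm) hη g) (hint (hξ.sub hξm) (hη.sub hηm) g),
        ← integral_sub (hint hξ hη g) (hint hξm hηm g), ← integral_add]
      · refine integral_congr_ae (Eventually.of_forall fun x => ?_)
        simp only [Pi.sub_apply, map_sub]
        ring
      · exact (hint (hξ.sub hξm) hη g).sub (hint (hξ.sub hξm) (hη.sub hηm) g)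
      · exact hint hξ (hη.sub hηm) g
    have h2 : (eLpNorm (ξ - ξ') 2 μ).toReal ≤ κ := ENNReal.toReal_le_of_le_ofReal hκ.le hξ1
    have h3 : (eLpNorm (η - η') 2 μ).toReal ≤ κ := ENNReal.toReal_le_of_le_ofReal hκ.le hη1
    rw [h1]
    refine (norm_add_le_of_le (norm_sub_le_of_le (norm_coefficient_le (hξ.sub hξm) hη g)
      (norm_coefficient_le (hξ.sub hξm) (hη.sub hηm) g))
      (norm_coefficient_le hξ (hη.sub hηm) g)).trans ?_
    refine le_trans ?_ hκδ
    have h4 := ENNReal.toReal_nonneg (a := eLpNorm (η - η') 2 μ)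
    calc _ ≤ κ * B + κ * κ + A * κ := by gcongr
      _ ≤ κ * (A + B + 1) := by nlinarith
  choose f hf using fun k : ℕ => key (1 / (k + 1)) (by positivity)
  have hlim : Tendsto (fun k : ℕ => 1 / ((k : ℝ) + 1)) atTop (𝓝 0) :=
    tendsto_one_div_add_atTop_nhds_zero_nat
  have hu : TendstoUniformly (fun k => ⇑(f k)) φ atTop := by
    rw [Metric.tendstoUniformly_iff]
    intro δ hδ
    filter_upwards [hlim.eventually (gt_mem_nhds hδ)] with k hk g
    rw [dist_eq_norm]
    exact (hf k g).trans_lt hk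
  have hc : Continuous φ := hu.continuous (Frequently.of_forall fun k => (f k).continuous)
  refine ⟨⟨⟨φ, hc⟩, ?_⟩, rfl⟩
  simp only
  exact hu.tendsto_of_eventually_tendsto (Eventually.of_forall fun k => (f k).zero_at_infty')
    tendsto_const_nhds

/-- This reduces the claim on the completely bounded property to the one on C₀ nets. -/
lemma HasAPcbSchur.hasC0SchurApproximation {p : ℝ≥0∞} (hp : p ≠ 0) (h : HasAPcbSchur p μ) :
    HasC0SchurApproximation p μ := by
  obtain ⟨C, ι, h1, h2, h3, φ, hφ, hconv, hC⟩ := h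
  choose f hf using fun a => (hφ a).exists_zeroAtInfty
  refine ⟨C, ι, h1, h2, h3, f, ?_, fun a => ?_⟩
  · simpa only [hf] using hconv
  · rw [hf]
    exact (hC a).msNormLE hp

variable {K : Subgroup G} (hKo : IsOpen (K : Set G)) (hKc : IsCompact (K : Set G))

include hKo hKc

lemma norm_doubleCosetAvg_sub_le {f : G → ℂ} (hf : Continuous f) {g : G} {z : ℂ} {δ : ℝ}
    (h : ∀ u ∈ K, ∀ w ∈ K, ‖f (u * g * w) - z‖ ≤ δ) : ‖doubleCosetAvg μ K f g - z‖ ≤ δ := by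
  have hKt : μ K ≠ ∞ := hKc.measure_lt_top.ne
  have hK0 : μ K ≠ 0 := (hKo.measure_pos μ ⟨1, K.one_mem⟩).ne'
  have hc : 0 < (μ K).toReal := ENNReal.toReal_pos hK0 hKt
  have hcC : ((μ K).toReal : ℂ) ≠ 0 := by exact_mod_cast hc.ne'
  have hin (u : G) : IntegrableOn (fun w => f (u⁻¹ * g * w)) K μ :=
    Continuous.continuousOn (by fun_prop) |>.integrableOn_compact hKc
  have hcont : Continuous fun u => ∫ w in (K : Set G), f (u⁻¹ * g * w) ∂μ := by
    refine continuous_parametric_integral_of_continuous ?_ hKc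
    simp only [Function.uncurry_def]
    fun_prop
  have hout : IntegrableOn (fun u => ∫ w in (K : Set G), f (u⁻¹ * g * w) ∂μ) K μ :=
    hcont.continuousOn.integrableOn_compact hKc
  have hcst (y : ℂ) : IntegrableOn (fun _ : G => y) K μ := integrableOn_const hKt
  have h1 (u : G) (hu : u ∈ (K : Set G)) :
      ‖(∫ w in (K : Set G), f (u⁻¹ * g * w) ∂μ) - (μ K).toReal * z‖ ≤ δ * (μ K).toReal := by
    have : (∫ w in (K : Set G), f (u⁻¹ * g * w) ∂μ) - (μ K).toReal * z =
        ∫ w in (K : Set G), (f (u⁻¹ * g * w) - z) ∂μ := by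
      rw [integral_sub (hin u) (hcst z), setIntegral_const, Measure.real, Complex.real_smul]
    rw [this]
    exact norm_setIntegral_le_of_norm_le_const hKt.lt_top
      fun w hw => h _ (K.inv_mem hu) w hw
  have h2 : ‖(∫ u in (K : Set G), ∫ w in (K : Set G), f (u⁻¹ * g * w) ∂μ ∂μ) -
      (μ K).toReal * ((μ K).toReal * z)‖ ≤ δ * (μ K).toReal * (μ K).toReal := by
    have : (∫ u in (K : Set G), ∫ w in (K : Set G), f (u⁻¹ * g * w) ∂μ ∂μ) -
        (μ K).toReal * ((μ K).toReal * z) = ∫ u in (K : Set G),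
          ((∫ w in (K : Set G), f (u⁻¹ * g * w) ∂μ) - (μ K).toReal * z) ∂μ := by
      rw [integral_sub hout (hcst _), setIntegral_const, Measure.real, Complex.real_smul]
    rw [this]
    exact norm_setIntegral_le_of_norm_le_const hKt.lt_top h1
  have h3 : doubleCosetAvg μ K f g - z = ((μ K).toReal ^ 2 : ℂ)⁻¹ *
      ((∫ u in (K : Set G), ∫ w in (K : Set G), f (u⁻¹ * g * w) ∂μ ∂μ) -
        (μ K).toReal * ((μ K).toReal * z)) := by
    rw [doubleCosetAvg, mul_sub, ← mul_assoc _ _ z, ← sq, inv_mul_cancel_left₀ (pow_ne_zero 2 hcC)]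
    push_cast
    rfl
  rw [h3, norm_mul, norm_inv, norm_pow, Complex.norm_real, Real.norm_of_nonneg hc.le,
    inv_mul_le_iff₀ (by positivity)]
  linarith

lemma tendsto_doubleCosetAvg_zero (f : C₀(G, ℂ)) {x : ℕ → G}
    (hx : ∀ L : Set G, IsCompact L → ∀ᶠ t in atTop, x t ∉ L) :
    Tendsto (fun t => doubleCosetAvg μ K f (x t)) atTop (𝓝 0) := by
  rw [Metric.tendsto_nhds]
  intro δ hδ
  have h0 := f.zero_at_infty'
  rw [Metric.tendsto_nhds] at h0
  have h1 := h0 (δ / 2) (half_pos hδ)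
  obtain ⟨L, hL, hLf⟩ := mem_cocompact.1 h1
  filter_upwards [hx _ ((hKc.mul hL).mul hKc)] with t ht
  refine lt_of_le_of_lt ?_ (half_lt_self hδ)
  rw [dist_eq_norm]
  refine norm_doubleCosetAvg_sub_le hKo hKc f.continuous fun u hu w hw => ?_
  have h2 : u * x t * w ∈ Lᶜ := fun h => by
    refine ht ⟨u⁻¹ * (u * x t * w), ⟨u⁻¹, K.inv_mem hu, _, h, rfl⟩, w⁻¹, K.inv_mem hw, ?_⟩
    group
  have h3 := hLf h2
  rw [← dist_eq_norm]
  exact le_of_lt h3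

lemma tendsto_doubleCosetAvg_one {α : Type*} [Preorder α] {f : α → C₀(G, ℂ)}
    (hf : ∀ L : Set G, IsCompact L → TendstoUniformlyOn (fun a => ⇑(f a)) (fun _ => 1) atTop L)
    (g : G) : Tendsto (fun a => doubleCosetAvg μ K (f a) g) atTop (𝓝 1) := by
  rw [Metric.tendsto_nhds]
  intro δ hδ
  have h1 := Metric.tendstoUniformlyOn_iff.1 (hf _ ((hKc.mul (isCompact_singleton (x := g))).mul hKc))
    (δ / 2) (half_pos hδ)
  filter_upwards [h1] with a ha
  refine lt_of_le_of_lt ?_ (half_lt_self hδ)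
  rw [dist_eq_norm]
  refine norm_doubleCosetAvg_sub_le hKo hKc (f a).continuous fun u hu w hw => ?_
  have := ha (u * g * w) ⟨u * g, ⟨u, hu, g, rfl, rfl⟩, w, hw, rfl⟩
  rw [← dist_eq_norm, dist_comm]
  exact this.le

end ZeroAtInfty

/-! ### The contradiction -/

section Main

open ValuativeRel Topology

variable {F : Type*} [Field F] [ValuativeRel F] [TopologicalSpace F] [IsNonarchimedeanLocalField F]

lemma not_hasC0SchurApproximation {r n : ℕ} (hn : 1 ≤ n) (hr : 2 * n + 1 ≤ r) {p : ℝ≥0∞}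
    (hp : (1 ≤ p ∧ p < ENNReal.ofReal (2 - 2 / ((n : ℝ) + 2))) ∨
      ENNReal.ofReal (2 + 2 / (n : ℝ)) < p)
    [MeasurableSpace (Matrix.SpecialLinearGroup (Fin r) F)]
    [BorelSpace (Matrix.SpecialLinearGroup (Fin r) F)]
    (μ : Measure (Matrix.SpecialLinearGroup (Fin r) F)) [μ.IsHaarMeasure] :
    ¬ HasC0SchurApproximation p μ := by
  rintro ⟨C, α, _, _, _, f, hconv, hC⟩
  obtain ⟨ε, hε, hp⟩ := exists_exponent hn hp
  have : NeZero n := ⟨by omega⟩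
  obtain ⟨ϖ, hϖ⟩ := IsDiscreteValuationRing.exists_irreducible 𝒪[F]
  have hϖ0 : algebraMap 𝒪[F] F ϖ ≠ 0 := by
    simpa using hϖ.ne_zero
  set π : Fˣ := Units.mk0 _ hϖ0 with hπdef
  have hπ : (π : F) = algebraMap 𝒪[F] F ϖ := rfl
  have hπv : valuation F (π : F) < 1 :=
    (Valuation.integer.integers (valuation F)).valuation_irreducible_lt_one hϖ
  have hfin : Finite (𝒪[F] ⧸ Ideal.span {ϖ}) := by
    rw [← hϖ.maximalIdeal_eq]
    exact inferInstanceAs (Finite 𝓀[F])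
  have hq : (1 : ℝ) < Nat.card (𝒪[F] ⧸ Ideal.span {ϖ}) := by
    have : Nontrivial (𝒪[F] ⧸ Ideal.span {ϖ}) :=
      Ideal.Quotient.nontrivial_iff.2 (by simpa [Ideal.span_singleton_eq_top] using hϖ.not_isUnit)
    exact_mod_cast Finite.one_lt_card
  set q : ℝ := (Nat.card (𝒪[F] ⧸ Ideal.span {ϖ}) : ℝ)
  set K := integralSL (Fin r) F 𝒪[F]
  have hKo : IsOpen (K : Set (Matrix.SpecialLinearGroup (Fin r) F)) := isOpen_integralSL
  have hKc : IsCompact (K : Set (Matrix.SpecialLinearGroup (Fin r) F)) := isCompact_integralSL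
  have hK0 : μ K ≠ 0 := (hKo.measure_pos μ ⟨1, K.one_mem⟩).ne'
  -- The coordinates 0, ..., 2n split into n negative ones b, n positive ones c and the transit
  -- coordinate m; this is where r ≥ 2n + 1 is used.
  let b : Fin n → Fin r := fun i => ⟨i, by omega⟩
  let c : Fin n → Fin r := fun i => ⟨n + i, by omega⟩
  let m : Fin r := ⟨2 * n, by omega⟩
  have hb : Function.Injective b := fun i j h => by simpa [b, Fin.ext_iff] using h
  have hc : Function.Injective c := fun i j h => by simpa [c, Fin.ext_iff] using h
  have hbc (i j) : b i ≠ c j := by simp only [b, c, ne_eq, Fin.ext_iff]; omega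
  have hbm (i) : b i ≠ m := by simp only [b, m, ne_eq, Fin.ext_iff]; omega
  have hcm (i) : c i ≠ m := by simp only [c, m, ne_eq, Fin.ext_iff]; omega
  have hsum (t : ℕ) : ∑ i, ((t : ℤ) • signVector b c Finset.univ) i = 0 := by
    simp [← Finset.mul_sum, sum_signVector]
  let Ψ (a : α) (w : Fin r → ℤ) : ℂ :=
    if hw : ∑ i, w i = 0 then doubleCosetAvg μ K (f a) (zpowSL π w hw) else 0
  have hΨ (a : α) (t : ℕ) : Ψ a ((t : ℤ) • signVector b c Finset.univ) =
      doubleCosetAvg μ K (f a) (zpowSL π _ (hsum t)) := dif_pos _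
  set θ : ℝ := q ^ (-(ε * (n + 2)))
  have hθ0 : 0 ≤ θ := by positivity
  have hθ : θ < 1 := Real.rpow_lt_one_of_one_lt_of_neg hq (by
    rw [neg_lt_zero]; positivity)
  have hθl (l : ℕ) : (q ^ ((n + 2) * l)) ^ (-ε) = θ ^ l := by
    rw [← Real.rpow_natCast, ← Real.rpow_mul (by positivity), ← Real.rpow_natCast θ,
      ← Real.rpow_mul (by positivity)]
    congr 1
    push_cast
    ring
  have hstep (a : α) (l t : ℕ) (hl : l ≠ 0) (ht : (n + 2) * l + 1 ≤ t) :
      ‖Ψ a ((t : ℤ) • signVector b c Finset.univ) -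
        Ψ a (((t + 1 : ℕ) : ℤ) • signVector b c Finset.univ)‖ ≤ 2 * n * (2 * C) * θ ^ l := by
    refine (norm_sub_le_of_chain (β := 2 * C * θ ^ l) (fun s w hw hpq h => ?_) hb hc hbc hbm hcm
      ht).trans_eq (by ring)
    have := s.norm_sub_le hϖ hπ hKo.measurableSet hK0 hKc.measure_lt_top.ne hp (hC a) hl hw hpq h
    rw [hθl] at this
    have hw' : ∑ i, (w + Pi.single s.p 1 - Pi.single s.q 1 : Fin r → ℤ) i = 0 := by
      simp [Finset.sum_add_distrib, hw]
    simpa only [Ψ, dif_pos hw, dif_pos hw'] using this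
  have hlim (a : α) : Tendsto (fun t : ℕ => Ψ a ((t : ℤ) • signVector b c Finset.univ)) atTop
      (𝓝 0) := by
    simp only [hΨ]
    refine tendsto_doubleCosetAvg_zero hKo hKc (f a) fun L hL => ?_
    exact eventually_zpowSL_notMem hπv (sum_signVector b c _) (m := b 0)
      (by simp [signVector_left hb hbc]) hL
  -- The constants do not involve the net index a, so one l, hence one group element, serves the
  -- whole net.
  obtain ⟨l, hl⟩ : ∃ l : ℕ, (n + 2) * (2 * n * (2 * C)) * θ / (1 - θ) * θ ^ l < 1 / 2 := by
    have h := (tendsto_pow_atTop_nhds_zero_of_lt_one hθ0 hθ).const_mul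
      ((n + 2) * (2 * n * (2 * C)) * θ / (1 - θ))
    rw [mul_zero] at h
    exact (h.eventually (gt_mem_nhds (by norm_num : (0 : ℝ) < 1 / 2))).exists
  have hsmall (a : α) := norm_le_of_geometric_of_tendsto hθ (hstep a) (hlim a) l
  have hone := tendsto_doubleCosetAvg_one (μ := μ) hKo hKc hconv
    (zpowSL π _ (hsum ((n + 2) * (l + 1) + 1)))
  have := le_of_tendsto hone.norm (Eventually.of_forall fun a => (hΨ a _ ▸ hsmall a).trans hl.le)
  norm_num at this

end Main

end SchurAP

end

theorem theoremD {F : Type*} [Field F] [ValuativeRel F] [TopologicalSpace F]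
    [IsNonarchimedeanLocalField F]
    (r n : ℕ) (hn : 1 ≤ n) (hr : 2 * n + 1 ≤ r)
    (p : ℝ≥0∞)
    (hp : (1 ≤ p ∧ p < ENNReal.ofReal (2 - 2 / ((n : ℝ) + 2))) ∨
      ENNReal.ofReal (2 + 2 / (n : ℝ)) < p)
    [MeasurableSpace (Matrix.SpecialLinearGroup (Fin r) F)]
    [BorelSpace (Matrix.SpecialLinearGroup (Fin r) F)]
    (μ : Measure (Matrix.SpecialLinearGroup (Fin r) F)) [μ.IsHaarMeasure] :
    ¬ SchurAP.HasAPcbSchur p μ ∧ ¬ SchurAP.HasC0SchurApproximation p μ := by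
  have hp0 : p ≠ 0 := by
    rintro rfl
    rcases hp with hp | hp
    · exact absurd hp.1 (by simp)
    · exact absurd hp (by simp)
  have h := SchurAP.not_hasC0SchurApproximation hn hr hp μ
  exact ⟨fun h' => h (h'.hasC0SchurApproximation hp0), h⟩
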